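/- **Setting.** Fix a prime $p$. Put $\frac1p\binom p\nu\in\mathbb Z$ for $1\le\nu\le p-1$. A $\delta$-structure on a commutative ring $B$ is a map $\delta\colon B\to B$ with $\delta(0)=\delta(1)=0$, $\delta(x+y)=\delta(x)+\delta(y)-\sum_{\nu=1}^{p-1}\frac1p\binom p\nu x^\nu y^{p-\nu}$ and $\delta(xy)=\delta(x)y^p+x^p\delta(y)+p\,\delta(x)\delta(y)$; a $\delta$-algebra over a $\delta$-ring is a $\delta$-ring with a structure homomorphism commuting with $\delta$. Equip $\mathbb Z[q]$ with $\delta(f)=p^{-1}(f(q^p)-f(q)^p)$ and put $\mu=q-1$, $[p]_q=1+q+\cdots+q^{p-1}$, $\eta=\delta(\mu)\mu^{-1}=\sum_{\nu=1}^{p-1}\frac1p\binom p\nu\mu^{\nu-1}$. Let $R$ be a $\delta$-$\mathbb Z[q]$-algebra, $I=pR+[p]_qR$, and let $A$ be a $\delta$-$R$-algebra with elements $t_1,\dots,t_d\in A$ such that $\delta(t_i)=0$. Let $a_1,\dots,a_d\in R$ and $T_i=t_i-a_i$. Let $D$ be the $\delta$-envelope over $A$ of $D_0=A[S_1,\dots,S_d]/([p]_qS_i-T_i,\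 1\le i\le d)$ (the universal $\delta$-$A$-algebra with an $A$-algebra homomorphism from $D_0$), let $\tau_i\in D$ be the image of $S_i$, and for $m=\sum_n m_np^n$ with $0\le m_n\le p-1$ put $\tau_i^{\{m\}_\delta}=\prod_n\delta^n(\tau_i)^{m_n}$. Assume that for every $n\in\mathbb N$ the $R/I^{n+1}$-module $D/I^{n+1}D$ is free with basis the classes of $\prod_{i=1}^d\tau_i^{\{m_i\}_\delta}$, $(m_i)\in\mathbb N^d$. Let $\widehat D=\varprojlim_n D/I^nD$ with the completed $\delta$-structure. For $\alpha,\beta\in\widehat D$ with $\delta(\alpha)=\beta\alpha$, an $\alpha$-derivation of $\widehat D$ over $R$ is an $R$-linear map $\partial\colon\widehat D\to\widehat D$ with $\partial(1)=0$ and $\partial(xy)=\partial(x)y+x\partial(y)+\alpha\,\partial(x)\partial(y)$; it is $\delta$-compatible with respect to $\beta$ if, for all $x$, $$\partial(\delta(x))=(\alpha^{p-1}+p\beta)\,\delta(\partial(x))+\beta\,\partial(x)^p-\sum_{\nu=1}^{p-1}\tfrac1p\tbinom p\nu x^{p-\nu}\alpha^{\nu-1}\partial(x)^\nu .$$ **Theorem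 ($q$-Higgs Poincaré lemma).** For each $i$ there is a unique $t_i\mu$-derivation $\theta_i$ of $\widehat D$ over $R$, $\delta$-compatible with respect to $t_i^{p-1}\eta$, such that $\theta_i(\tau_i)=1$ and $\theta_i(\tau_j)=0$ for $j\ne i$; moreover $\theta_i\circ\theta_j=\theta_j\circ\theta_i$ for all $i,j$. Let $\Omega=\bigoplus_{i=1}^d\mathbb Z\,dt_i$, $\Omega^k=\bigwedge^k_{\mathbb Z}\Omega$, and define the $R$-linear maps $$\theta^k\colon\widehat D\otimes_{\mathbb Z}\Omega^k\to\widehat D\otimes_{\mathbb Z}\Omega^{k+1},\qquad \theta^k(x\otimes\omega)=\sum_{i=1}^d\theta_i(x)\otimes dt_i\wedge\omega ,$$ so that $\theta^{k+1}\circ\theta^k=0$. Then for every ideal $J$ of $R$ containing some power of $I$ and every $R/J$-module $M$, the complex $(M\otimes_R\widehat D\otimes_{\mathbb Z}\Omega^\bullet,\ \mathrm{id}_M\otimes\theta^\bullet)$ is a resolution of $M$: the sequence $$0\to M\xrightarrow{\,m\mapsto m\otimes1\otimes1\,}M\otimes_R\widehat D\otimes_{\mathbb Z}\Omega^0\to M\otimes_R\widehat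 D\otimes_{\mathbb Z}\Omega^1\to\cdots$$ is exact. -/

import Mathlib

open Polynomial TensorProduct

noncomputable section

set_option linter.unusedSectionVars false

namespace QHiggs

/-! ## Rings with a delta-structure -/

/-- The polynomial `∑_{i=1}^{p-1} p⁻¹ * binom(p, i) * x^i * y^(p-i)`.
For a prime `p` the division `p.choose i / p` is exact. -/
def cross (p : ℕ) {R : Type*} [CommRing R] (x y : R) : R :=
  ∑ i ∈ Finset.Ico 1 p, ((p.choose i / p : ℕ) : R) * x ^ i * y ^ (p - i)

/-- A `δ`-structure (with respect to `p`) on a commutative ring. -/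
class DeltaRing (p : ℕ) (R : Type*) [CommRing R] where
  /-- the operation `δ` -/
  δ (p) : R → R
  δ_zero : δ 0 = 0
  δ_one : δ 1 = 0
  δ_add : ∀ x y : R, δ (x + y) = δ x + δ y - cross p x y
  δ_mul : ∀ x y : R, δ (x * y) = δ x * y ^ p + x ^ p * δ y + p * δ x * δ y

open DeltaRing (δ)

/-- `S` is a `δ`-algebra over the `δ`-ring `R`: the structure map commutes with `δ`. -/
class IsDeltaAlgebra (p : ℕ) (R S : Type*) [CommRing R] [CommRing S] [DeltaRing p R]
    [DeltaRing p S] [Algebra R S] : Prop where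
  algebraMap_δ : ∀ x : R, algebraMap R S (δ p x) = δ p (algebraMap R S x)

/-- Compatibility of a ring homomorphism with the `δ`-structures. -/
def IsDeltaHom (p : ℕ) {S S' : Type*} [CommRing S] [CommRing S'] [DeltaRing p S]
    [DeltaRing p S'] (f : S →+* S') : Prop := ∀ x, f (δ p x) = δ p (f x)

theorem map_cross (p : ℕ) {R S : Type*} [CommRing R] [CommRing S] (f : R →+* S) (x y : R) :
    f (cross p x y) = cross p (f x) (f y) := by
  simp [cross, map_sum]

theorem add_pow_eq_cross (p : ℕ) [hp : Fact p.Prime] {R : Type*} [CommRing R] (x y : R) :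
    (x + y) ^ p = x ^ p + y ^ p + p * cross p x y := by
  rw [add_pow_prime_eq hp.out, cross, mul_assoc, mul_assoc, Finset.mul_sum, Finset.mul_sum]
  have : Finset.Ioo 0 p = Finset.Ico 1 p := by ext i; simp; omega
  rw [this]
  congr 2
  refine Finset.sum_congr rfl fun i hi => ?_
  rw [Finset.mem_Ico] at hi
  obtain ⟨j, rfl⟩ : ∃ j, i = j + 1 := ⟨i - 1, by omega⟩
  obtain ⟨k, hk⟩ : ∃ k, p - (j + 1) = k + 1 := ⟨p - (j + 1) - 1, by omega⟩
  rw [hk]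
  simp only [Nat.add_sub_cancel]
  ring

/-! ## The delta-structure on `ℤ[q]` with Frobenius lift `f(q) ↦ f(q^p)` -/

section IntPoly

variable (p : ℕ) [hp : Fact p.Prime]

theorem exists_delta_intPoly (f : ℤ[X]) :
    ∃ g : ℤ[X], (p : ℤ[X]) * g = expand ℤ p f - f ^ p := by
  have h : (expand ℤ p f - f ^ p).map (Int.castRingHom (ZMod p)) = 0 := by
    rw [Polynomial.map_sub, Polynomial.map_pow, Polynomial.map_expand, ZMod.expand_card, sub_self]
  have h2 : (C (p : ℤ)) ∣ expand ℤ p f - f ^ p := by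
    rw [Polynomial.C_dvd_iff_dvd_coeff]
    intro i
    have := congrArg (fun g => g.coeff i) h
    simp only [coeff_map, coeff_zero, eq_intCast] at this
    exact (ZMod.intCast_zmod_eq_zero_iff_dvd _ _).1 this
  obtain ⟨g, hg⟩ := h2
  exact ⟨g, by rw [hg]; simp⟩

/-- `δ(f) = (f(q^p) - f(q)^p) / p` for `f ∈ ℤ[q]`. -/
def deltaIntPoly (f : ℤ[X]) : ℤ[X] := (exists_delta_intPoly p f).choose

theorem deltaIntPoly_spec (f : ℤ[X]) :
    (p : ℤ[X]) * deltaIntPoly p f = expand ℤ p f - f ^ p :=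
  (exists_delta_intPoly p f).choose_spec

instance instDeltaRingIntPoly : DeltaRing p ℤ[X] :=
  have h0 : (p : ℤ[X]) ≠ 0 := Nat.cast_ne_zero.2 hp.out.ne_zero
  { δ := deltaIntPoly p
    δ_zero := mul_left_cancel₀ h0 <| by
      rw [deltaIntPoly_spec]; simp [hp.out.ne_zero]
    δ_one := mul_left_cancel₀ h0 <| by
      rw [deltaIntPoly_spec]; simp
    δ_add := fun x y => mul_left_cancel₀ h0 <| by
      rw [mul_sub, mul_add, deltaIntPoly_spec, deltaIntPoly_spec, deltaIntPoly_spec, map_add,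
        add_pow_eq_cross]
      ring
    δ_mul := fun x y => mul_left_cancel₀ h0 <| by
      have hx := deltaIntPoly_spec p x
      have hy := deltaIntPoly_spec p y
      rw [deltaIntPoly_spec, map_mul, mul_pow]
      have e : (p : ℤ[X]) * (deltaIntPoly p x * y ^ p + x ^ p * deltaIntPoly p y
          + p * deltaIntPoly p x * deltaIntPoly p y)
          = (p * deltaIntPoly p x) * y ^ p + x ^ p * (p * deltaIntPoly p y)
            + (p * deltaIntPoly p x) * (p * deltaIntPoly p y) := by ring
      rw [e, hx, hy]
      ring }

end IntPoly

/-- `μ = q - 1`. -/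
def qμ : ℤ[X] := X - 1

/-- `[p]_q = 1 + q + ⋯ + q^(p-1)`. -/
def qNum (p : ℕ) : ℤ[X] := ∑ i ∈ Finset.range p, X ^ i

/-- `η = δ(μ) / μ = ∑_{ν=1}^{p-1} p⁻¹ * binom(p, ν) * μ^(ν-1)`. -/
def qη (p : ℕ) : ℤ[X] :=
  ∑ ν ∈ Finset.Ico 1 p, ((p.choose ν / p : ℕ) : ℤ[X]) * qμ ^ (ν - 1)

/-! ## The delta-envelope of an algebra over a delta-ring -/

section Envelope

universe u v w

variable (p : ℕ) (A : Type u) (S : Type v) [CommRing A] [CommRing S] [DeltaRing p A] [Algebra A S]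

/-- Formal expressions in elements of `S`, the ring operations and a unary operation `δ`. -/
inductive DExpr : Type v
  | of : S → DExpr
  | add : DExpr → DExpr → DExpr
  | mul : DExpr → DExpr → DExpr
  | neg : DExpr → DExpr
  | delta : DExpr → DExpr

namespace DExpr

variable {S}

/-- Powers of an expression. -/
def pow (x : DExpr S) : ℕ → DExpr S
  | 0 => of 1
  | n + 1 => mul (pow x n) x

/-- The sum of the expressions `f 0, …, f (n - 1)`. -/
def sum (f : ℕ → DExpr S) : ℕ → DExpr S
  | 0 => of 0
  | n + 1 => add (sum f n) (f n)

/-- The expression for `∑_{i=1}^{p-1} p⁻¹ * binom(p, i) * x^i * y^(p-i)`. -/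
def cross (x y : DExpr S) : DExpr S :=
  sum (fun i => mul (mul (of ((p.choose (1 + i) / p : ℕ) : S)) (pow x (1 + i)))
    (pow y (p - (1 + i)))) (p - 1)

end DExpr

open QHiggs.DExpr in
/-- The relations that define the `δ`-envelope of the `A`-algebra `S`: the operations define a
commutative ring with `δ`-structure, `S` maps to it by a ring homomorphism, and the composite map
from `A` commutes with `δ`. -/
inductive Rel : DExpr S → DExpr S → Prop
  | add_left (x x' y) : Rel x x' → Rel (add x y) (add x' y)
  | add_right (x y y') : Rel y y' → Rel (add x y) (add x y')
  | mul_left (x x' y) : Rel x x' → Rel (mul x y) (mul x' y)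
  | mul_right (x y y') : Rel y y' → Rel (mul x y) (mul x y')
  | neg (x x') : Rel x x' → Rel (neg x) (neg x')
  | delta (x x') : Rel x x' → Rel (delta x) (delta x')
  | add_assoc (x y z) : Rel (add (add x y) z) (add x (add y z))
  | add_comm (x y) : Rel (add x y) (add y x)
  | zero_add (x) : Rel (add (of 0) x) x
  | neg_add_cancel (x) : Rel (add (neg x) x) (of 0)
  | mul_assoc (x y z) : Rel (mul (mul x y) z) (mul x (mul y z))
  | mul_comm (x y) : Rel (mul x y) (mul y x)
  | one_mul (x) : Rel (mul (of 1) x) x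
  | left_distrib (x y z) : Rel (mul x (add y z)) (add (mul x y) (mul x z))
  | of_add (a b) : Rel (of (a + b)) (add (of a) (of b))
  | of_mul (a b) : Rel (of (a * b)) (mul (of a) (of b))
  | of_delta (a : A) : Rel (of (algebraMap A S (δ p a))) (delta (of (algebraMap A S a)))
  | delta_add (x y) : 
      Rel (delta (add x y)) (add (add (delta x) (delta y)) (DExpr.neg (DExpr.cross p x y)))
  | delta_mul (x y) : Rel (delta (mul x y))
      (add (add (mul (delta x) (pow y p)) (mul (pow x p) (delta y)))
        (mul (mul (of (p : S)) (delta x)) (delta y)))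

/-- The `δ`-envelope of the `A`-algebra `S` over the `δ`-ring `A`: the `δ`-`A`-algebra generated
by the elements of `S`, subject to the relations of the `A`-algebra `S`. Its universal property is
`DeltaEnvelope.existsUnique_lift`. -/
def DeltaEnvelope : Type v := Quot (Rel p A S)

namespace DeltaEnvelope

/-- The class of an expression. -/
def mk (x : DExpr S) : DeltaEnvelope p A S := Quot.mk _ x

variable {p A S}

theorem mk_surjective (x : DeltaEnvelope p A S) : ∃ e, mk p A S e = x := Quot.exists_rep x

instance : Add (DeltaEnvelope p A S) :=
  ⟨Quot.map₂ DExpr.add (fun x y y' h => Rel.add_right x y y' h)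
    (fun x x' y h => Rel.add_left x x' y h)⟩

instance : Mul (DeltaEnvelope p A S) :=
  ⟨Quot.map₂ DExpr.mul (fun x y y' h => Rel.mul_right x y y' h)
    (fun x x' y h => Rel.mul_left x x' y h)⟩

instance : Neg (DeltaEnvelope p A S) := ⟨Quot.map DExpr.neg (fun x x' h => Rel.neg x x' h)⟩

instance : Zero (DeltaEnvelope p A S) := ⟨mk p A S (.of 0)⟩

instance : One (DeltaEnvelope p A S) := ⟨mk p A S (.of 1)⟩

theorem mk_add (x y : DExpr S) : mk p A S (.add x y) = mk p A S x + mk p A S y := rfl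

theorem mk_mul (x y : DExpr S) : mk p A S (.mul x y) = mk p A S x * mk p A S y := rfl

theorem mk_neg (x : DExpr S) : mk p A S (.neg x) = -mk p A S x := rfl

theorem mk_zero : mk p A S (.of 0) = 0 := rfl

theorem mk_one : mk p A S (.of 1) = 1 := rfl

theorem mk_eq {x y : DExpr S} (h : Rel p A S x y) : mk p A S x = mk p A S y := Quot.sound h

instance instCommRing : CommRing (DeltaEnvelope p A S) :=
  have zero_add' : ∀ x : DeltaEnvelope p A S, 0 + x = x := by
    rintro ⟨x⟩; exact mk_eq (.zero_add x)
  have add_comm' : ∀ x y : DeltaEnvelope p A S, x + y = y + x := by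
    rintro ⟨x⟩ ⟨y⟩; exact mk_eq (.add_comm x y)
  have mul_comm' : ∀ x y : DeltaEnvelope p A S, x * y = y * x := by
    rintro ⟨x⟩ ⟨y⟩; exact mk_eq (.mul_comm x y)
  have one_mul' : ∀ x : DeltaEnvelope p A S, 1 * x = x := by
    rintro ⟨x⟩; exact mk_eq (.one_mul x)
  have left_distrib' : ∀ x y z : DeltaEnvelope p A S, x * (y + z) = x * y + x * z := by
    rintro ⟨x⟩ ⟨y⟩ ⟨z⟩; exact mk_eq (.left_distrib x y z)
  have neg_add_cancel' : ∀ x : DeltaEnvelope p A S, -x + x = 0 := by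
    rintro ⟨x⟩; exact mk_eq (.neg_add_cancel x)
  have add_assoc' : ∀ x y z : DeltaEnvelope p A S, x + y + z = x + (y + z) := by
    rintro ⟨x⟩ ⟨y⟩ ⟨z⟩; exact mk_eq (.add_assoc x y z)
  have mul_assoc' : ∀ x y z : DeltaEnvelope p A S, x * y * z = x * (y * z) := by
    rintro ⟨x⟩ ⟨y⟩ ⟨z⟩; exact mk_eq (.mul_assoc x y z)
  letI grp : AddCommGroup (DeltaEnvelope p A S) :=
    { add_assoc := add_assoc'
      zero_add := zero_add'
      add_zero := fun x => by rw [add_comm', zero_add']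
      add_comm := add_comm'
      neg_add_cancel := neg_add_cancel'
      nsmul := nsmulRec
      zsmul := zsmulRec }
  have mul_zero' : ∀ x : DeltaEnvelope p A S, x * 0 = 0 := fun x => by
    have h := left_distrib' x 0 0
    rw [zero_add'] at h
    exact left_eq_add.1 h
  { grp with
    mul_assoc := mul_assoc'
    mul_comm := mul_comm'
    one_mul := one_mul'
    mul_one := fun x => by rw [mul_comm', one_mul']
    left_distrib := left_distrib'
    right_distrib := fun x y z => by
      rw [mul_comm', left_distrib', mul_comm' z x, mul_comm' z y]
    mul_zero := mul_zero'
    zero_mul := fun x => by rw [mul_comm', mul_zero'] }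

variable (p A S) in
/-- The ring homomorphism from `S` to its `δ`-envelope. -/
def ofHom : S →+* DeltaEnvelope p A S where
  toFun s := mk p A S (.of s)
  map_zero' := rfl
  map_one' := rfl
  map_add' a b := mk_eq (.of_add a b)
  map_mul' a b := mk_eq (.of_mul a b)

instance instAlgebra : Algebra A (DeltaEnvelope p A S) :=
  ((ofHom p A S).comp (algebraMap A S)).toAlgebra

variable (p A S) in
/-- The `A`-algebra homomorphism from `S` to its `δ`-envelope. -/
def of : S →ₐ[A] DeltaEnvelope p A S :=
  { ofHom p A S with commutes' := fun _ => rfl }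

theorem mk_of (s : S) : mk p A S (.of s) = of p A S s := rfl

theorem mk_pow (x : DExpr S) (n : ℕ) : mk p A S (x.pow n) = mk p A S x ^ n := by
  induction n with
  | zero => rw [pow_zero]; rfl
  | succ n ih => rw [DExpr.pow, mk_mul, ih, pow_succ]

theorem mk_sum (f : ℕ → DExpr S) (n : ℕ) :
    mk p A S (DExpr.sum f n) = ∑ i ∈ Finset.range n, mk p A S (f i) := by
  induction n with
  | zero => rw [Finset.sum_range_zero]; rfl
  | succ n ih => rw [DExpr.sum, mk_add, ih, Finset.sum_range_succ]

theorem mk_cross (x y : DExpr S) :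
    mk p A S (DExpr.cross p x y) = cross p (mk p A S x) (mk p A S y) := by
  rw [DExpr.cross, mk_sum, QHiggs.cross, Finset.sum_Ico_eq_sum_range]
  refine Finset.sum_congr rfl fun i _ => ?_
  rw [mk_mul, mk_mul, mk_pow, mk_pow, mk_of, map_natCast]

instance instDeltaRing : DeltaRing p (DeltaEnvelope p A S) where
  δ := Quot.map DExpr.delta (fun x x' h => Rel.delta x x' h)
  δ_zero := by
    have h := mk_eq (Rel.of_delta (p := p) (A := A) (S := S) 0)
    rw [DeltaRing.δ_zero, map_zero] at h
    exact h.symm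
  δ_one := by
    have h := mk_eq (Rel.of_delta (p := p) (A := A) (S := S) 1)
    rw [DeltaRing.δ_one, map_zero, map_one] at h
    exact h.symm
  δ_add := by
    rintro ⟨x⟩ ⟨y⟩
    have h := mk_eq (Rel.delta_add (p := p) (A := A) (S := S) x y)
    rw [mk_add, mk_add, mk_neg, mk_cross, ← sub_eq_add_neg] at h
    exact h
  δ_mul := by
    rintro ⟨x⟩ ⟨y⟩
    have h := mk_eq (Rel.delta_mul (p := p) (A := A) (S := S) x y)
    rw [mk_add, mk_add, mk_mul, mk_mul, mk_mul, mk_mul, mk_pow, mk_pow, mk_of, map_natCast] at h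
    exact h

theorem mk_delta (x : DExpr S) : mk p A S (.delta x) = δ p (mk p A S x) := rfl

instance : IsDeltaAlgebra p A (DeltaEnvelope p A S) where
  algebraMap_δ a := mk_eq (.of_delta a)

section lift

variable {B : Type w} [CommRing B] [DeltaRing p B] [Algebra A B]

/-- Evaluation of expressions in a `δ`-`A`-algebra. -/
def eval (f : S →ₐ[A] B) : DExpr S → B
  | .of s => f s
  | .add x y => eval f x + eval f y
  | .mul x y => eval f x * eval f y
  | .neg x => -eval f x
  | .delta x => δ p (eval f x)

theorem eval_pow (f : S →ₐ[A] B) (x : DExpr S) (n : ℕ) :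
    eval (p := p) f (x.pow n) = eval (p := p) f x ^ n := by
  induction n with
  | zero => rw [pow_zero]; exact map_one f
  | succ n ih => rw [DExpr.pow, eval, ih, pow_succ]

theorem eval_sum (f : S →ₐ[A] B) (g : ℕ → DExpr S) (n : ℕ) :
    eval (p := p) f (DExpr.sum g n) = ∑ i ∈ Finset.range n, eval (p := p) f (g i) := by
  induction n with
  | zero => rw [Finset.sum_range_zero]; exact map_zero f
  | succ n ih => rw [DExpr.sum, eval, ih, Finset.sum_range_succ]

theorem eval_cross (f : S →ₐ[A] B) (x y : DExpr S) :
    eval (p := p) f (DExpr.cross p x y) = cross p (eval (p := p) f x) (eval (p := p) f y) := by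
  rw [DExpr.cross, eval_sum, QHiggs.cross, Finset.sum_Ico_eq_sum_range]
  refine Finset.sum_congr rfl fun i _ => ?_
  rw [eval, eval, eval, eval_pow, eval_pow, map_natCast]

theorem eval_rel [IsDeltaAlgebra p A B] (f : S →ₐ[A] B) {x y : DExpr S} (h : Rel p A S x y) :
    eval (p := p) f x = eval (p := p) f y := by
  induction h with
  | add_left x x' y _ ih => simp only [eval, ih]
  | add_right x y y' _ ih => simp only [eval, ih]
  | mul_left x x' y _ ih => simp only [eval, ih]
  | mul_right x y y' _ ih => simp only [eval, ih]
  | neg x x' _ ih => simp only [eval, ih]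
  | delta x x' _ ih => simp only [eval, ih]
  | add_assoc x y z => simp only [eval, add_assoc]
  | add_comm x y => simp only [eval, add_comm]
  | zero_add x => simp only [eval, map_zero, zero_add]
  | neg_add_cancel x => simp only [eval, map_zero, neg_add_cancel]
  | mul_assoc x y z => simp only [eval, mul_assoc]
  | mul_comm x y => simp only [eval, mul_comm]
  | one_mul x => simp only [eval, map_one, one_mul]
  | left_distrib x y z => simp only [eval, mul_add]
  | of_add a b => simp only [eval, map_add]
  | of_mul a b => simp only [eval, map_mul]
  | of_delta a => simp only [eval, AlgHom.commutes, IsDeltaAlgebra.algebraMap_δ]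
  | delta_add x y => simp only [eval, eval_cross, DeltaRing.δ_add, sub_eq_add_neg]
  | delta_mul x y => simp only [eval, eval_pow, DeltaRing.δ_mul, map_natCast]

/-- The `δ`-homomorphism from the `δ`-envelope that extends `f`. -/
def lift [IsDeltaAlgebra p A B] (f : S →ₐ[A] B) : DeltaEnvelope p A S →ₐ[A] B where
  toFun := Quot.lift (eval (p := p) f) (fun _ _ h => eval_rel f h)
  map_zero' := map_zero f
  map_one' := map_one f
  map_add' := by rintro ⟨x⟩ ⟨y⟩; rfl
  map_mul' := by rintro ⟨x⟩ ⟨y⟩; rfl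
  commutes' a := f.commutes a

/-- The universal property of the `δ`-envelope. -/
theorem existsUnique_lift [IsDeltaAlgebra p A B] (f : S →ₐ[A] B) :
    ∃! g : DeltaEnvelope p A S →ₐ[A] B,
      IsDeltaHom p g.toRingHom ∧ g.comp (of p A S) = f := by
  refine ⟨lift f, ⟨?_, ?_⟩, ?_⟩
  · rintro ⟨x⟩; rfl
  · ext s; rfl
  · rintro g ⟨hg, hf⟩
    ext x
    obtain ⟨e, rfl⟩ := mk_surjective x
    induction e with
    | of s => exact DFunLike.congr_fun hf s
    | add x y hx hy => rw [mk_add, map_add, map_add, hx, hy]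
    | mul x y hx hy => rw [mk_mul, map_mul, map_mul, hx, hy]
    | neg x hx => rw [mk_neg, map_neg, map_neg, hx]
    | delta x hx =>
      rw [mk_delta]
      refine (hg _).trans ?_
      change δ p (g (mk p A S x)) = _
      rw [hx]
      rfl

end lift

end DeltaEnvelope

end Envelope

/-! ## Completion of a delta-structure -/

section Completion

variable {p : ℕ} [hp : Fact p.Prime] {B : Type*} [CommRing B] [DeltaRing p B] {K : Ideal B}

theorem cross_mem (I : Ideal B) (x : B) {y : B} (hy : y ∈ I) : cross p x y ∈ I := by
  refine Ideal.sum_mem _ fun i hi => Ideal.mul_mem_left _ _ ?_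
  rw [Finset.mem_Ico] at hi
  exact Ideal.pow_mem_of_mem _ hy _ (by omega)

theorem δ_mem_pow (hK : (p : B) ∈ K) (n : ℕ) : ∀ x ∈ K ^ (n + 1), δ p x ∈ K ^ n := by
  have hp0 : 0 < p := hp.out.pos
  induction n with
  | zero => intro x _; simp
  | succ n ih =>
    intro x hx
    rw [pow_succ'] at hx
    suffices h : x ∈ K ^ (n + 1) ∧ δ p x ∈ K ^ (n + 1) from h.2
    refine Submodule.mul_induction_on hx (fun a ha b hb => ⟨?_, ?_⟩)
      (fun a b ha hb => ⟨?_, ?_⟩)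
    · exact Ideal.mul_mem_left _ _ hb
    · rw [DeltaRing.δ_mul]
      have h1 : δ p b ∈ K ^ n := ih b hb
      refine Ideal.add_mem _ (Ideal.add_mem _ ?_ ?_) ?_
      · exact Ideal.mul_mem_left _ _ (Ideal.pow_mem_of_mem _ hb _ hp0)
      · rw [pow_succ']
        exact Ideal.mul_mem_mul (Ideal.pow_mem_of_mem _ ha _ hp0) h1
      · rw [pow_succ', mul_assoc]
        exact Ideal.mul_mem_mul hK (Ideal.mul_mem_left _ _ h1)
    · exact Ideal.add_mem _ ha.1 hb.1
    · rw [DeltaRing.δ_add]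
      exact Ideal.sub_mem _ (Ideal.add_mem _ ha.2 hb.2) (cross_mem _ _ hb.1)

theorem δ_sub_mem (hK : (p : B) ∈ K) (n : ℕ) {x y : B} (h : x - y ∈ K ^ (n + 1)) :
    δ p x - δ p y ∈ K ^ n := by
  have e : x = y + (x - y) := by ring
  rw [e, DeltaRing.δ_add]
  have h1 := δ_mem_pow hK n _ h
  have h2 : cross p y (x - y) ∈ K ^ n := cross_mem _ _ (Ideal.pow_le_pow_right n.le_succ h)
  have e2 : δ p y + δ p (x - y) - cross p y (x - y) - δ p y
      = δ p (x - y) - cross p y (x - y) := by ring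
  rw [e2]
  exact Ideal.sub_mem _ h1 h2

/-- The map `B / K^(n+1) → B / K^n` induced by `δ`, for an ideal `K` containing `p`. -/
def deltaQuot (hK : (p : B) ∈ K) (n : ℕ) :
    B ⧸ (K ^ (n + 1) • ⊤ : Ideal B) → B ⧸ (K ^ n • ⊤ : Ideal B) :=
  Quotient.map' (δ p) fun x y h => by
    rw [Submodule.quotientRel_def, smul_eq_mul, Ideal.mul_top] at h ⊢
    exact δ_sub_mem hK n h

theorem deltaQuot_mk (hK : (p : B) ∈ K) (n : ℕ) (x : B) :
    deltaQuot hK n (Ideal.Quotient.mk _ x) = Ideal.Quotient.mk _ (δ p x) := rfl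

/-- The map `δ` on the `K`-adic completion, the inverse limit of the maps `deltaQuot`. -/
def completedDelta (hK : (p : B) ∈ K) (x : AdicCompletion K B) : AdicCompletion K B :=
  ⟨fun n => deltaQuot hK n (x.val (n + 1)), fun {m n} hmn => by
    obtain ⟨b, hb⟩ := Ideal.Quotient.mk_surjective (x.val (n + 1))
    have h := x.property (Nat.succ_le_succ hmn)
    change AdicCompletion.transitionMap K B _ (x.val (n + 1)) = x.val (m + 1) at h
    change AdicCompletion.transitionMap K B hmn (deltaQuot hK n (x.val (n + 1)))
      = deltaQuot hK m (x.val (m + 1))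
    rw [← h, ← hb]
    rfl⟩

theorem completedDelta_val (hK : (p : B) ∈ K) (x : AdicCompletion K B) (n : ℕ) :
    (completedDelta hK x).val n = deltaQuot hK n (x.val (n + 1)) := rfl

theorem val_eq_transition (x : AdicCompletion K B) (n : ℕ) :
    x.val n = AdicCompletion.transitionMap K B n.le_succ (x.val (n + 1)) :=
  (x.property n.le_succ).symm

theorem val_cross (x y : AdicCompletion K B) (n : ℕ) :
    (cross p x y).val n = cross p (x.val n) (y.val n) :=
  map_cross p ((Pi.evalRingHom (fun n => B ⧸ (K ^ n • ⊤ : Ideal B)) n).comp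
    (AdicCompletion.subring K).subtype) x y

/-- The `K`-adic completion of the `δ`-structure of `B`, for an ideal `K` containing `p`. -/
@[reducible]
def completedDeltaRing (hK : (p : B) ∈ K) : DeltaRing p (AdicCompletion K B) where
  δ := completedDelta hK
  δ_zero := Subtype.ext <| funext fun n => by
    change Ideal.Quotient.mk _ (δ p (0 : B)) = Ideal.Quotient.mk _ 0
    rw [DeltaRing.δ_zero]
  δ_one := Subtype.ext <| funext fun n => by
    change Ideal.Quotient.mk _ (δ p (1 : B)) = Ideal.Quotient.mk _ 0
    rw [DeltaRing.δ_one]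
  δ_add x y := Subtype.ext <| funext fun n => by
    obtain ⟨a, ha⟩ := Ideal.Quotient.mk_surjective (x.val (n + 1))
    obtain ⟨b, hb⟩ := Ideal.Quotient.mk_surjective (y.val (n + 1))
    change deltaQuot hK n (x.val (n + 1) + y.val (n + 1)) = deltaQuot hK n (x.val (n + 1))
      + deltaQuot hK n (y.val (n + 1)) - (cross p x y).val n
    rw [val_cross, val_eq_transition x n, val_eq_transition y n, ← ha, ← hb, ← map_add,
      deltaQuot_mk, deltaQuot_mk, deltaQuot_mk, DeltaRing.δ_add, map_sub, map_add, map_cross]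
    rfl
  δ_mul x y := Subtype.ext <| funext fun n => by
    obtain ⟨a, ha⟩ := Ideal.Quotient.mk_surjective (x.val (n + 1))
    obtain ⟨b, hb⟩ := Ideal.Quotient.mk_surjective (y.val (n + 1))
    change deltaQuot hK n (x.val (n + 1) * y.val (n + 1)) = deltaQuot hK n (x.val (n + 1))
      * y.val n ^ p + x.val n ^ p * deltaQuot hK n (y.val (n + 1))
      + p * deltaQuot hK n (x.val (n + 1)) * deltaQuot hK n (y.val (n + 1))
    rw [val_eq_transition x n, val_eq_transition y n, ← ha, ← hb, ← map_mul,
      deltaQuot_mk, deltaQuot_mk, deltaQuot_mk, DeltaRing.δ_mul]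
    simp only [map_add, map_mul, map_pow, map_natCast]
    rfl

end Completion

/-! ## The divided delta-envelope and its completion -/

section DividedEnvelope

universe u v

/-- The ring `A[S_1, …, S_d] / (ξ S_i - T_i)`. -/
abbrev DivRing {A : Type v} [CommRing A] {d : ℕ} (ξ : A) (T : Fin d → A) : Type v :=
  MvPolynomial (Fin d) A ⧸
    Ideal.span (Set.range fun i => MvPolynomial.C ξ * MvPolynomial.X i - MvPolynomial.C (T i))

variable (p : ℕ) [hp : Fact p.Prime] (R : Type u) [CommRing R] [Algebra ℤ[X] R]

/-- The element of `R` given by an element of `ℤ[q]`. -/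
abbrev qElt (f : ℤ[X]) : R := algebraMap ℤ[X] R f

/-- The ideal `I = (p, [p]_q)` of `R`. -/
def qIdeal : Ideal R := Ideal.span {(p : R), qElt R (qNum p)}

variable {A : Type v} [CommRing A] [DeltaRing p A] [Algebra R A] {d : ℕ} (T : Fin d → A)

/-- The divided `δ`-envelope `D`: the `δ`-envelope over `A` of
`D₀ = A[S_1, …, S_d] / ([p]_q S_i - T_i)`. -/
def DivEnv : Type v := DeltaEnvelope p A (DivRing (algebraMap R A (qElt R (qNum p))) T)

namespace DivEnv

instance instCommRing : CommRing (DivEnv p R T) :=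
  inferInstanceAs (CommRing (DeltaEnvelope p A (DivRing (algebraMap R A (qElt R (qNum p))) T)))

instance instDeltaRing : DeltaRing p (DivEnv p R T) :=
  inferInstanceAs (DeltaRing p (DeltaEnvelope p A (DivRing (algebraMap R A (qElt R (qNum p))) T)))

/-- The structure of an algebra over `A`. -/
instance instAlgebra : Algebra A (DivEnv p R T) :=
  inferInstanceAs (Algebra A (DeltaEnvelope p A (DivRing (algebraMap R A (qElt R (qNum p))) T)))

/-- The structure of an algebra over `R`, by way of `A`. -/
instance instAlgebraBase : Algebra R (DivEnv p R T) :=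
  ((algebraMap A (DivEnv p R T)).comp (algebraMap R A)).toAlgebra

instance : IsScalarTower R A (DivEnv p R T) := IsScalarTower.of_algebraMap_eq fun _ => rfl

/-- The image `τ_i` of `S_i` in `D`. -/
def τ (i : Fin d) : DivEnv p R T :=
  DeltaEnvelope.of p A (DivRing (algebraMap R A (qElt R (qNum p))) T)
    (Ideal.Quotient.mk _ (MvPolynomial.X i))

/-- The ideal `I D` of `D`. -/
def ideal : Ideal (DivEnv p R T) := (qIdeal p R).map (algebraMap R (DivEnv p R T))

theorem p_mem_ideal : (p : DivEnv p R T) ∈ ideal p R T := by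
  rw [← map_natCast (algebraMap R (DivEnv p R T)) p]
  exact Ideal.mem_map_of_mem _ (Ideal.subset_span (Set.mem_insert _ _))

end DivEnv

/-- The element `x^{m}_δ = ∏_n δ^n(x)^(a_n)`, where `m = ∑_n a_n p^n` is the `p`-adic expansion
of `m`, with digits `0 ≤ a_n ≤ p - 1`. -/
def deltaPow {B : Type*} [CommRing B] [DeltaRing p B] (x : B) (m : ℕ) : B :=
  ∏ n ∈ Finset.range (p.digits m).length, ((δ p)^[n] x) ^ ((p.digits m).getD n 0)

/-- For every `n`, the `R/I^(n+1)`-module `D/I^(n+1)D` is free with basis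
`∏_i τ_i^{m_i}_δ` mod `I^(n+1)D`, `(m_i) ∈ ℕ^d`. -/
def FreeOnDeltaMonomials : Prop :=
  ∀ n : ℕ, ∃ b : Module.Basis (Fin d → ℕ) (R ⧸ qIdeal p R ^ (n + 1))
      (DivEnv p R T ⧸ (qIdeal p R ^ (n + 1)).map (algebraMap R (DivEnv p R T))),
    ∀ m : Fin d → ℕ, b m = Ideal.Quotient.mk _ (∏ i, deltaPow p (DivEnv.τ p R T i) (m i))

/-- The completion `lim_n D/I^n D`. -/
def DivEnvHat : Type v := AdicCompletion (DivEnv.ideal p R T) (DivEnv p R T)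

namespace DivEnvHat

instance instCommRing : CommRing (DivEnvHat p R T) :=
  inferInstanceAs (CommRing (AdicCompletion (DivEnv.ideal p R T) (DivEnv p R T)))

/-- The completion of the `δ`-structure of `D`. -/
instance instDeltaRing : DeltaRing p (DivEnvHat p R T) :=
  completedDeltaRing (DivEnv.p_mem_ideal p R T)

/-- The canonical homomorphism from `D` to its completion. -/
instance instAlgebra : Algebra (DivEnv p R T) (DivEnvHat p R T) :=
  inferInstanceAs (Algebra (DivEnv p R T) (AdicCompletion (DivEnv.ideal p R T) (DivEnv p R T)))

/-- The structure of an algebra over `R`, by way of `D`. -/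
instance instAlgebraBase : Algebra R (DivEnvHat p R T) :=
  inferInstanceAs (Algebra R (AdicCompletion (DivEnv.ideal p R T) (DivEnv p R T)))

instance : IsScalarTower R (DivEnv p R T) (DivEnvHat p R T) :=
  IsScalarTower.of_algebraMap_eq fun _ => rfl

/-- The image of an element of `A` in the completion. -/
def ofBase (x : A) : DivEnvHat p R T :=
  algebraMap (DivEnv p R T) (DivEnvHat p R T) (algebraMap A (DivEnv p R T) x)

/-- The image of `τ_i` in the completion. -/
def τ (i : Fin d) : DivEnvHat p R T :=
  algebraMap (DivEnv p R T) (DivEnvHat p R T) (DivEnv.τ p R T i)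

end DivEnvHat

end DividedEnvelope

/-! ## Twisted derivations -/

section TwistedDerivation

variable {R B : Type*} [CommRing R] [CommRing B] [Algebra R B]

/-- An `α`-derivation of `B` over `R`. -/
structure IsTwistedDerivation (α : B) (D : B →ₗ[R] B) : Prop where
  map_one : D 1 = 0
  map_mul : ∀ x y : B, D (x * y) = D x * y + x * D y + α * D x * D y

/-- The `α`-derivation `D` is `δ`-compatible with respect to `β`, where `δ(α) = β α`. -/
def IsDeltaCompatible (p : ℕ) [DeltaRing p B] (α β : B) (D : B →ₗ[R] B) : Prop :=
  ∀ x : B, D (δ p x) = (α ^ (p - 1) + p * β) * δ p (D x) + β * D x ^ p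
    - ∑ ν ∈ Finset.Ico 1 p,
        ((p.choose ν / p : ℕ) : B) * x ^ (p - ν) * α ^ (ν - 1) * D x ^ ν

end TwistedDerivation

/-- `θ` is a `t_i μ`-derivation over `R` of the completed divided `δ`-envelope, `δ`-compatible
with respect to `t_i^(p-1) η`, with `θ(τ_i) = 1` and `θ(τ_j) = 0` for `j ≠ i`. -/
structure IsQHiggsDerivation (p : ℕ) [Fact p.Prime] {R A : Type*} [CommRing R] [Algebra ℤ[X] R]
    [CommRing A] [DeltaRing p A] [Algebra R A] {d : ℕ} (T t : Fin d → A) (i : Fin d)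
    (θ : DivEnvHat p R T →ₗ[R] DivEnvHat p R T) : Prop where
  twisted : IsTwistedDerivation
    (DivEnvHat.ofBase p R T (t i) * algebraMap R (DivEnvHat p R T) (qElt R qμ)) θ
  compatible : IsDeltaCompatible p
    (DivEnvHat.ofBase p R T (t i) * algebraMap R (DivEnvHat p R T) (qElt R qμ))
    (DivEnvHat.ofBase p R T (t i) ^ (p - 1) * algebraMap R (DivEnvHat p R T) (qElt R (qη p))) θ
  map_τ_self : θ (DivEnvHat.τ p R T i) = 1
  map_τ_ne : ∀ j, j ≠ i → θ (DivEnvHat.τ p R T j) = 0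

/-! ## The complex -/

section Complex

/-- The free `ℤ`-module `Ω` with basis `dt_1, …, dt_d`. -/
abbrev Ω (d : ℕ) : Type := Fin d → ℤ

/-- The basis element `dt_i` of `Ω`. -/
def dt {d : ℕ} (i : Fin d) : Ω d := Pi.single i 1

/-- The map `ω ↦ dt_i ∧ ω` from `Ω^k` to `Ω^(k+1)`. -/
def wedge {d : ℕ} (i : Fin d) (k : ℕ) : ⋀[ℤ]^k (Ω d) →ₗ[ℤ] ⋀[ℤ]^(k + 1) (Ω d) :=
  (LinearMap.mulLeft ℤ (ExteriorAlgebra.ι ℤ (dt i))).restrict fun x hx => by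
    change _ ∈ LinearMap.range _ ^ (k + 1)
    rw [pow_succ']
    exact Submodule.mul_mem_mul (LinearMap.mem_range_self _ _) hx

variable {R B : Type*} [CommRing R] [CommRing B] [Algebra R B] {d : ℕ}

/-- The map `x ⊗ ω ↦ ∑_i θ_i(x) ⊗ (dt_i ∧ ω)` from `B ⊗ Ω^k` to `B ⊗ Ω^(k+1)`. -/
def thetaMap (θ : Fin d → B →ₗ[R] B) (k : ℕ) :
    B ⊗[ℤ] ⋀[ℤ]^k (Ω d) →ₗ[R] B ⊗[ℤ] ⋀[ℤ]^(k + 1) (Ω d) :=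
  ∑ i, TensorProduct.AlgebraTensorModule.map (θ i) (wedge i k)

/-- The augmentation `m ↦ m ⊗ 1 ⊗ 1` from `M` to `M ⊗_R B ⊗ Ω^0`. -/
def augmentation (R B : Type*) [CommRing R] [CommRing B] [Algebra R B] (d : ℕ)
    (M : Type*) [AddCommGroup M] [Module R M] :
    M →ₗ[R] M ⊗[R] (B ⊗[ℤ] ⋀[ℤ]^0 (Ω d)) :=
  (TensorProduct.mk R M (B ⊗[ℤ] ⋀[ℤ]^0 (Ω d))).flip
    (1 ⊗ₜ[ℤ] ⟨1, Submodule.one_le.1 (pow_zero _).ge⟩)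

/-- The sequence `M ⊗_R B ⊗ Ω^•` with the maps `id_M ⊗ θ^•` is a resolution of `M`: the sequence
`0 → M → M ⊗_R B ⊗ Ω^0 → M ⊗_R B ⊗ Ω^1 → ⋯` is exact (in particular a complex). -/
structure IsResolution (θ : Fin d → B →ₗ[R] B) (M : Type*) [AddCommGroup M] [Module R M] :
    Prop where
  injective : Function.Injective (augmentation R B d M)
  exact_zero : Function.Exact (augmentation R B d M) ((thetaMap θ 0).lTensor M)
  exact_succ : ∀ k, Function.Exact ((thetaMap θ k).lTensor M) ((thetaMap θ (k + 1)).lTensor M)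

end Complex

end QHiggs

end

open QHiggs QHiggs.DeltaRing

/-! An α-derivation θ of a ring B is the same as a ring section x ↦ x + θ(x)ε of the projection
B[ε]/(ε² - αε) → B. When δ(α) = βα, this ring carries a δ-structure with δ(ε) = βε
(`TwEps.deltaRing`), and θ is δ-compatible with respect to β exactly when the section commutes with
δ. Here α = t_i μ and β = t_i^(p-1) η.

Existence. The section is built from the δ-monomial basis, not from the universal property of the
envelope. Let G ⊆ D[ε] be the R-subalgebra generated by all δ^k(τ_j + [j = i]ε). An identity in
ℤ[q], which expresses δ(q^p) = 0, gives δ(t_i + [p]_q ε) = 0; so the shifted generators x still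
satisfy δ([p]_q x + a) = 0. This relation makes each δ^k(x) integral of degree p modulo I over the
lower ones (`exists_pow_sub_mem`), so the δ-monomials span G up to I^n G (`deltaAdjoin_le`). Their
real parts are a basis of D modulo I^n, hence modulo I^n the algebra G is the graph of a map
(`im_mem_of_re_mem`). The limit of these maps is θ_i.

Uniqueness. Compatibility with δ fixes the values on all δ^k(τ_j), which generate a dense
R-subalgebra. Every R-linear endomorphism of the completion respects the filtration, because I is
finitely generated.

Poincaré lemma. In the coordinates modulo I^n, θ_i acts on the i-th index alone, by an endomorphism
Θ_i of (R/I^n)^(ℕ); in particular the θ_i commute. Modulo (p, μ), which is nilpotent in R/I^n, α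
vanishes, θ_i becomes an ordinary derivation, and y_k = θ_i(δ^k(τ_i)) obeys y_0 = 1, y_(k+1) = b
y_k^p - δ^k(τ_i)^(p-1) y_k. Hence θ_i sends the δ-power of exponent m + 1 to c times that of
exponent m plus lower terms, with c an integer prime to p (`exists_im_digitProd_sub_mem`). So Θ_i
has a section σ_i for which 1 - σ_i Θ_i maps to the line of the zeroth basis vector
(`exists_section_of_triangular`). The operators σ_i ⊗ (contraction with dt_i) assemble into a
homotopy of the Koszul complex (`exists_homotopy`), which leaves only the copy of M spanned by 1. -/

noncomputable section

set_option linter.unusedSectionVars false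

namespace QHiggs

/-! ### Identities for the cross term of the p-th power -/

section Cross

variable (p : ℕ) [hp : Fact p.Prime] {B : Type*} [CommRing B]

theorem cross_mul_left (z x y : B) : cross p (z * x) (z * y) = z ^ p * cross p x y := by
  rw [cross, cross, Finset.mul_sum]
  refine Finset.sum_congr rfl fun i hi => ?_
  rw [Finset.mem_Ico] at hi
  rw [mul_pow, mul_pow, show z ^ p = z ^ i * z ^ (p - i) by rw [← pow_add]; congr 1; omega]
  ring

/-- After multiplication by p this is the symmetry of (x + y)^p. Division by p is legitimate in
ℤ[X_0, X_1], and evaluation carries the identity to every ring. -/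
theorem cross_comm (x y : B) : cross p x y = cross p y x := by
  have hp0 : (p : MvPolynomial (Fin 2) ℤ) ≠ 0 := Nat.cast_ne_zero.2 hp.out.ne_zero
  have h : cross p (MvPolynomial.X 0 : MvPolynomial (Fin 2) ℤ) (MvPolynomial.X 1)
      = cross p (MvPolynomial.X 1) (MvPolynomial.X 0) := by
    refine mul_left_cancel₀ hp0 ?_
    have h1 := add_pow_eq_cross p (MvPolynomial.X 0 : MvPolynomial (Fin 2) ℤ) (MvPolynomial.X 1)
    have h2 := add_pow_eq_cross p (MvPolynomial.X 1 : MvPolynomial (Fin 2) ℤ) (MvPolynomial.X 0)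
    rw [add_comm] at h2
    linear_combination h2 - h1
  have := congrArg (MvPolynomial.aeval ![x, y]).toRingHom h
  rw [map_cross, map_cross] at this
  simpa using this

/-- Two ways of grouping the p-th power of a sum of four terms, again divided by p in the universal
case. It yields the sum rule for `TwEps.delta`. -/
theorem cross_add_add (x y z w : B) :
    cross p x y + cross p z w + cross p (x + y) (z + w)
      = cross p x z + cross p y w + cross p (x + z) (y + w) := by
  have hp0 : (p : MvPolynomial (Fin 4) ℤ) ≠ 0 := Nat.cast_ne_zero.2 hp.out.ne_zero
  have key : ∀ x y z w : MvPolynomial (Fin 4) ℤ,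
      cross p x y + cross p z w + cross p (x + y) (z + w)
        = cross p x z + cross p y w + cross p (x + z) (y + w) := by
    intro x y z w
    refine mul_left_cancel₀ hp0 ?_
    have h1 := add_pow_eq_cross p x y
    have h2 := add_pow_eq_cross p z w
    have h3 := add_pow_eq_cross p (x + y) (z + w)
    have h4 := add_pow_eq_cross p x z
    have h5 := add_pow_eq_cross p y w
    have h6 := add_pow_eq_cross p (x + z) (y + w)
    have e : (x + y + (z + w)) ^ p = (x + z + (y + w)) ^ p := by congr 1; ring
    linear_combination h4 + h5 + h6 - h1 - h2 - h3 + e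
  have := congrArg (MvPolynomial.aeval ![x, y, z, w]).toRingHom
    (key (MvPolynomial.X 0) (MvPolynomial.X 1) (MvPolynomial.X 2) (MvPolynomial.X 3))
  simp only [map_add, map_cross] at this
  simpa using this

theorem cross_zero_right (x : B) : cross p x 0 = 0 :=
  Finset.sum_eq_zero fun i hi => by
    rw [Finset.mem_Ico] at hi
    rw [zero_pow (by omega), mul_zero]

theorem cross_zero_left (x : B) : cross p 0 x = 0 := by
  rw [cross_comm, cross_zero_right]

theorem cross_mem_subalgebra {R : Type*} [CommRing R] [Algebra R B] (S : Subalgebra R B) {x y : B}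
    (hx : x ∈ S) (hy : y ∈ S) : cross p x y ∈ S :=
  sum_mem fun _ _ => mul_mem (mul_mem (natCast_mem _ _) (pow_mem hx _)) (pow_mem hy _)

theorem cross_mem_left (I : Ideal B) {x : B} (y : B) (hx : x ∈ I) : cross p x y ∈ I :=
  Ideal.sum_mem _ fun _ hi => Ideal.mul_mem_right _ _ (Ideal.mul_mem_left _ _
    (Ideal.pow_mem_of_mem _ hx _ (Nat.lt_of_lt_of_le zero_lt_one (Finset.mem_Ico.1 hi).1)))

end Cross

/-! ### The δ-structure on B[ε]/(ε² - αε) -/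

section TwistedSquare

variable {p : ℕ} [hp : Fact p.Prime] {B : Type*} [CommRing B] {α : B}

/-- The algebra `B[ε] / (ε² - α ε)`. -/
abbrev TwEps (α : B) : Type _ := QuadraticAlgebra B 0 α

namespace TwEps

/-- The element `y ε`. -/
def eps (α y : B) : TwEps α := ⟨0, y⟩

theorem eps_add (x y : B) : eps α (x + y) = eps α x + eps α y := by
  ext <;> simp [eps]

theorem eps_sub (x y : B) : eps α (x - y) = eps α x - eps α y := by
  ext <;> simp [eps]

theorem algebraMap_mul_eps (x y : B) : algebraMap B (TwEps α) x * eps α y = eps α (x * y) := by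
  ext <;> simp [eps]

theorem eps_mul_eps (x y : B) : eps α x * eps α y = eps α (α * x * y) := by
  ext <;> simp [eps, mul_assoc]

theorem eps_pow_succ (y : B) (n : ℕ) : eps α y ^ (n + 1) = eps α (α ^ n * y ^ (n + 1)) := by
  induction n with
  | zero => simp
  | succ n ih => rw [pow_succ, ih, eps_mul_eps]; congr 1; ring

theorem eps_pow_of_pos (y : B) {n : ℕ} (hn : 0 < n) :
    eps α y ^ n = eps α (α ^ (n - 1) * y ^ n) := by
  obtain ⟨m, rfl⟩ := Nat.exists_eq_succ_of_ne_zero hn.ne'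
  exact eps_pow_succ y m

theorem eta (x : TwEps α) : x = algebraMap B (TwEps α) x.re + eps α x.im := by
  ext <;> simp [eps]

/-- Since ε^ν = α^(ν-1) ε, the cross term is a multiple of ε; its coefficient is the sum subtracted
in `IsDeltaCompatible`. -/
theorem cross_eps_algebraMap (x y : B) :
    cross p (eps α y) (algebraMap B (TwEps α) x) = eps α (∑ ν ∈ Finset.Ico 1 p,
        ((p.choose ν / p : ℕ) : B) * x ^ (p - ν) * α ^ (ν - 1) * y ^ ν) := by
  have hsum : ∀ f : ℕ → B, eps α (∑ ν ∈ Finset.Ico 1 p, f ν)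
      = ∑ ν ∈ Finset.Ico 1 p, eps α (f ν) := fun f =>
    map_sum (⟨⟨eps α, rfl⟩, eps_add⟩ : B →+ TwEps α) f _
  rw [hsum, cross]
  refine Finset.sum_congr rfl fun ν hν => ?_
  rw [Finset.mem_Ico] at hν
  rw [eps_pow_of_pos _ (by omega), ← map_natCast (algebraMap B (TwEps α)), algebraMap_mul_eps,
    ← map_pow, mul_comm (eps α _), algebraMap_mul_eps]
  congr 1
  ring

theorem cross_eps_eps (x y : B) :
    cross p (eps α x) (eps α y) = eps α (α ^ (p - 1) * cross p x y) := by
  have h : ∀ z : B, eps α z = eps α 1 * algebraMap B (TwEps α) z := fun z => by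
    rw [mul_comm, algebraMap_mul_eps, mul_one]
  rw [h x, h y, cross_mul_left, ← map_cross, eps_pow_of_pos _ hp.out.pos, mul_comm,
    algebraMap_mul_eps]
  congr 1
  ring

variable [DeltaRing p B]

/-- The coefficient of `ε` in `δ(y ε)`. -/
def deltaCoeff (p : ℕ) [DeltaRing p B] (α β y : B) : B :=
  (α ^ (p - 1) + p * β) * δ p y + β * y ^ p

/-- The map `δ` on `B[ε] / (ε² - α ε)` with `δ(ε) = β ε`. -/
def delta (p : ℕ) [DeltaRing p B] (α β : B) (x : TwEps α) : TwEps α :=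
  algebraMap B (TwEps α) (δ p x.re) + eps α (deltaCoeff p α β x.im)
    - cross p (eps α x.im) (algebraMap B (TwEps α) x.re)

theorem deltaCoeff_add (α β x y : B) :
    eps α (deltaCoeff p α β (x + y)) = eps α (deltaCoeff p α β x) + eps α (deltaCoeff p α β y)
      - cross p (eps α x) (eps α y) := by
  rw [cross_eps_eps, ← eps_add, ← eps_sub]
  congr 1
  simp only [deltaCoeff, DeltaRing.δ_add, add_pow_eq_cross]
  ring

theorem delta_add (β : B) (x y : TwEps α) :
    delta p α β (x + y) = delta p α β x + delta p α β y - cross p x y := by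
  have h := cross_add_add p (eps α x.im) (algebraMap B (TwEps α) x.re) (eps α y.im)
    (algebraMap B (TwEps α) y.re)
  rw [add_comm (eps α x.im), add_comm (eps α y.im), ← eta, ← eta] at h
  rw [delta, delta, delta, QuadraticAlgebra.re_add, QuadraticAlgebra.im_add, deltaCoeff_add,
    DeltaRing.δ_add, map_sub, map_cross, map_add, map_add, eps_add]
  linear_combination h

theorem delta_algebraMap (β x : B) :
    delta p α β (algebraMap B (TwEps α) x) = algebraMap B (TwEps α) (δ p x) := by
  have h0 : eps α 0 = 0 := rfl
  rw [delta, QuadraticAlgebra.algebraMap_re, QuadraticAlgebra.algebraMap_im, h0, cross_zero_left,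
    deltaCoeff, DeltaRing.δ_zero, zero_pow hp.out.ne_zero, mul_zero, mul_zero, add_zero, h0]
  ring

theorem delta_eps (β y : B) : delta p α β (eps α y) = eps α (deltaCoeff p α β y) := by
  have h1 : (eps α y).re = 0 := rfl
  have h2 : (eps α y).im = y := rfl
  rw [delta, h1, h2, DeltaRing.δ_zero, map_zero, cross_zero_right]
  ring

/-- The defect of `δ(x y)` is additive. -/
theorem delta_mul_add {E : Type*} [CommRing E] (f : E → E)
    (hf : ∀ x y, f (x + y) = f x + f y - cross p x y) {x x' y : E}
    (h : f (x * y) = f x * y ^ p + x ^ p * f y + p * f x * f y)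
    (h' : f (x' * y) = f x' * y ^ p + x' ^ p * f y + p * f x' * f y) :
    f ((x + x') * y) = f (x + x') * y ^ p + (x + x') ^ p * f y + p * f (x + x') * f y := by
  rw [add_mul, hf, hf, h, h', add_pow_eq_cross, mul_comm x y, mul_comm x' y, cross_mul_left]
  ring

theorem delta_algebraMap_mul_eps (β x y : B) :
    delta p α β (algebraMap B (TwEps α) x * eps α y)
      = delta p α β (algebraMap B (TwEps α) x) * eps α y ^ p
        + algebraMap B (TwEps α) x ^ p * delta p α β (eps α y)
        + p * delta p α β (algebraMap B (TwEps α) x) * delta p α β (eps α y) := by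
  rw [algebraMap_mul_eps, delta_eps, delta_eps, delta_algebraMap, eps_pow_of_pos _ hp.out.pos,
    algebraMap_mul_eps, ← map_pow, algebraMap_mul_eps, ← map_natCast (algebraMap B (TwEps α)),
    ← map_mul, algebraMap_mul_eps, ← eps_add, ← eps_add]
  congr 1
  simp only [deltaCoeff, DeltaRing.δ_mul]
  ring

/-- The condition δ(α) = βα enters here. The product of xε and yε is also (αx)(yε), and the
condition says precisely that δ(αx) is α times the coefficient of δ(xε). -/
theorem delta_eps_mul_eps {β : B} (hβ : δ p α = β * α) (x y : B) :
    delta p α β (eps α x * eps α y)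
      = delta p α β (eps α x) * eps α y ^ p
        + eps α x ^ p * delta p α β (eps α y)
        + p * delta p α β (eps α x) * delta p α β (eps α y) := by
  have e : eps α x * eps α y = algebraMap B (TwEps α) (α * x) * eps α y := by
    rw [eps_mul_eps, algebraMap_mul_eps]
  have hn : δ p (α * x) = α * deltaCoeff p α β x := by
    rw [DeltaRing.δ_mul, hβ, deltaCoeff]
    have := mul_pow_sub_one hp.out.ne_zero α
    linear_combination -δ p x * this
  have hα : α ^ p = α * α ^ (p - 1) := (mul_pow_sub_one hp.out.ne_zero α).symm
  rw [e, delta_algebraMap_mul_eps, delta_eps, delta_eps, delta_algebraMap,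
    eps_pow_of_pos _ hp.out.pos, eps_pow_of_pos _ hp.out.pos, hn,
    ← map_natCast (algebraMap B (TwEps α))]
  simp only [algebraMap_mul_eps, ← map_pow, ← map_mul, eps_mul_eps, ← eps_add]
  congr 1
  rw [mul_pow, hα]
  ring

/-- By `delta_mul_add` the product rule may be checked on additive generators in each variable, so
only products of elements of B and of Bε remain. -/
theorem delta_mul {β : B} (hβ : δ p α = β * α) (x y : TwEps α) :
    delta p α β (x * y) = delta p α β x * y ^ p + x ^ p * delta p α β y
      + p * delta p α β x * delta p α β y := by
  have hadd := delta_add (p := p) (α := α) β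
  have comm : ∀ x y : TwEps α, delta p α β (y * x) = delta p α β y * x ^ p
      + y ^ p * delta p α β x + p * delta p α β y * delta p α β x →
      delta p α β (x * y) = delta p α β x * y ^ p + x ^ p * delta p α β y
      + p * delta p α β x * delta p α β y := by
    intro x y h
    rw [mul_comm, h]; ring
  rw [eta x]
  refine delta_mul_add _ hadd (comm _ _ ?_) (comm _ _ ?_) <;> rw [eta y] <;>
    refine delta_mul_add _ hadd ?_ ?_
  · rw [← map_mul, delta_algebraMap, delta_algebraMap, delta_algebraMap, DeltaRing.δ_mul]
    simp
  · exact comm _ _ (delta_algebraMap_mul_eps _ _ _)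
  · exact delta_algebraMap_mul_eps _ _ _
  · exact delta_eps_mul_eps hβ _ _

/-- The `δ`-structure on `B[ε] / (ε² - α ε)` with `δ(ε) = β ε`, where `δ(α) = β α`. -/
@[reducible]
def deltaRing {β : B} (hβ : δ p α = β * α) : DeltaRing p (TwEps α) where
  δ := delta p α β
  δ_zero := by
    have h := delta_algebraMap (p := p) (α := α) β 0
    rwa [DeltaRing.δ_zero, map_zero] at h
  δ_one := by
    have h := delta_algebraMap (p := p) (α := α) β 1
    rwa [DeltaRing.δ_one, map_zero, map_one] at h
  δ_add := delta_add β
  δ_mul := delta_mul hβ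

theorem delta_re (β : B) (x : TwEps α) : (delta p α β x).re = δ p x.re := by
  rw [delta, cross_eps_algebraMap]; simp [eps]

/-- For x + ∂(x)ε the right side is that of `IsDeltaCompatible`: compatibility means that x ↦ x +
∂(x)ε commutes with δ. -/
theorem delta_im (β : B) (x : TwEps α) :
    (delta p α β x).im = (α ^ (p - 1) + p * β) * δ p x.im + β * x.im ^ p
      - ∑ ν ∈ Finset.Ico 1 p,
        ((p.choose ν / p : ℕ) : B) * x.re ^ (p - ν) * α ^ (ν - 1) * x.im ^ ν := by
  rw [delta, cross_eps_algebraMap]; simp [eps, deltaCoeff]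

end TwEps

end TwistedSquare

/-! ### Products indexed by p-adic digits, and reduction of exponents below p -/

section DigitProd

/-- The product `∏_n x_n ^ (a_n)` for `m = ∑_n a_n p^n`. -/
def digitProd (p : ℕ) {Q : Type*} [CommRing Q] (x : ℕ → Q) (m : ℕ) : Q :=
  ∏ n ∈ Finset.range (p.digits m).length, x n ^ ((p.digits m).getD n 0)

theorem map_digitProd (p : ℕ) {Q Q' : Type*} [CommRing Q] [CommRing Q'] (f : Q →+* Q')
    (x : ℕ → Q) (m : ℕ) : f (digitProd p x m) = digitProd p (fun n => f (x n)) m := by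
  simp [digitProd]

variable {p : ℕ} [hp : Fact p.Prime] {Q : Type*} [CommRing Q] (x : ℕ → Q)

theorem digitProd_eq_prod_range {m k : ℕ} (h : m < p ^ k) :
    digitProd p x m = ∏ n ∈ Finset.range k, x n ^ (m / p ^ n % p) := by
  have hp2 : 2 ≤ p := hp.out.two_le
  have hl : (p.digits m).length ≤ k := (Nat.digits_length_le_iff hp2 m).2 h
  rw [digitProd, ← Finset.prod_subset (Finset.range_mono hl)]
  · exact Finset.prod_congr rfl fun n _ => by rw [Nat.getD_digits _ _ hp2]
  · intro n _ hn
    rw [Finset.mem_range, not_lt] at hn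
    have : m < p ^ n := (Nat.digits_length_le_iff hp2 m).1 hn
    rw [Nat.div_eq_of_lt this, Nat.zero_mod, pow_zero]

/-- Splitting off the digit in place k, possibly zero, gives the recursion behind the inductions on
the number of digits. -/
theorem digitProd_add {j k r : ℕ} (hj : j < p) (hr : r < p ^ k) :
    digitProd p x (j * p ^ k + r) = x k ^ j * digitProd p x r := by
  have hpk : 0 < p ^ k := pow_pos hp.out.pos k
  have h : j * p ^ k + r < p ^ (k + 1) := by
    rw [pow_succ']
    calc j * p ^ k + r < j * p ^ k + p ^ k := by omega
      _ = (j + 1) * p ^ k := by ring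
      _ ≤ p * p ^ k := Nat.mul_le_mul_right _ hj
  rw [digitProd_eq_prod_range x h, digitProd_eq_prod_range x hr, Finset.prod_range_succ, mul_comm]
  congr 1
  · congr 1
    rw [mul_comm j, Nat.mul_add_div hpk, Nat.div_eq_of_lt hr, add_zero, Nat.mod_eq_of_lt hj]
  · refine Finset.prod_congr rfl fun n hn => ?_
    rw [Finset.mem_range] at hn
    congr 1
    obtain ⟨c, rfl⟩ : ∃ c, k = n + (c + 1) := ⟨k - n - 1, by omega⟩
    have e : j * p ^ (n + (c + 1)) + r = p ^ n * (p * (j * p ^ c)) + r := by ring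
    rw [e, Nat.mul_add_div (pow_pos hp.out.pos n), Nat.mul_add_mod]

theorem digitProd_zero : digitProd p x 0 = 1 := by simp [digitProd]

variable (R : Type*) [CommRing R] [Algebra R Q]

/-- The subalgebra generated by `x_0, …, x_(k-1)`. -/
def lowAdjoin (k : ℕ) : Subalgebra R Q := Algebra.adjoin R (x '' Set.Iio k)

/-- The span of the products `digitProd p x l` for `l < m`. -/
def lowSpan (p m : ℕ) : Submodule R Q := Submodule.span R (digitProd p x '' Set.Iio m)

variable {x}

theorem mem_lowAdjoin {j k : ℕ} (h : j < k) : x j ∈ lowAdjoin x R k :=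
  Algebra.subset_adjoin ⟨j, h, rfl⟩

theorem lowAdjoin_mono {k l : ℕ} (h : k ≤ l) : lowAdjoin x R k ≤ lowAdjoin x R l :=
  Algebra.adjoin_mono (Set.image_mono (Set.Iio_subset_Iio h))

theorem lowSpan_mono {k l : ℕ} (h : k ≤ l) : lowSpan x R p k ≤ lowSpan x R p l :=
  Submodule.span_mono (Set.image_mono (Set.Iio_subset_Iio h))

theorem digitProd_mem_lowSpan {l m : ℕ} (h : l < m) : digitProd p x l ∈ lowSpan x R p m :=
  Submodule.subset_span ⟨l, h, rfl⟩

theorem pow_mul_mem_lowSpan {j k m : ℕ} (hj : j < p) (hm : m ≤ p ^ k) {y : Q}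
    (hy : y ∈ lowSpan x R p m) : x k ^ j * y ∈ lowSpan x R p (j * p ^ k + m) := by
  refine Submodule.span_induction (p := fun y _ => x k ^ j * y ∈ lowSpan x R p (j * p ^ k + m))
    ?_ ?_ ?_ ?_ hy
  · rintro _ ⟨l, hl, rfl⟩
    rw [← digitProd_add x hj (lt_of_lt_of_le hl hm)]
    exact digitProd_mem_lowSpan R (Nat.add_lt_add_left hl _)
  · rw [mul_zero]; exact zero_mem _
  · intro a b _ _ ha hb; rw [mul_add]; exact add_mem ha hb
  · intro r a _ ha; rw [mul_smul_comm]; exact Submodule.smul_mem _ _ ha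

theorem adjoin_le_of_mul_mem {s : Set Q} {N : Submodule R Q} (h1 : (1 : Q) ∈ N)
    (h : ∀ a ∈ s, ∀ y ∈ N, a * y ∈ N) : Subalgebra.toSubmodule (Algebra.adjoin R s) ≤ N := by
  intro a ha
  suffices H : ∀ y ∈ N, a * y ∈ N by simpa using H 1 h1
  refine Algebra.adjoin_induction (p := fun a _ => ∀ y ∈ N, a * y ∈ N) h ?_ ?_ ?_ ha
  · intro r y hy; rw [← Algebra.smul_def]; exact N.smul_mem _ hy
  · intro a b _ _ ha hb y hy; rw [add_mul]; exact add_mem (ha y hy) (hb y hy)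
  · intro a b _ _ ha hb y hy; rw [mul_assoc]; exact ha _ (hb y hy)

theorem lowSpan_le_lowAdjoin (k : ℕ) :
    lowSpan x R p (p ^ k) ≤ Subalgebra.toSubmodule (lowAdjoin x R k) := by
  refine Submodule.span_le.2 ?_
  rintro _ ⟨l, hl, rfl⟩
  rw [digitProd_eq_prod_range x hl]
  exact Subalgebra.prod_mem _ fun n hn =>
    pow_mem (mem_lowAdjoin R (Finset.mem_range.1 hn)) _

/-- The relation lowers x_k^p to degree at most one in x_k with coefficients of lower level, so all
exponents can be brought below p, one level at a time. -/
theorem lowAdjoin_le_lowSpan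
    (hx : ∀ k, ∃ u ∈ lowAdjoin x R k, ∃ v ∈ lowAdjoin x R k, x k ^ p = u + x k * v) (k : ℕ) :
    Subalgebra.toSubmodule (lowAdjoin x R k) ≤ lowSpan x R p (p ^ k) := by
  have hp0 : 0 < p := hp.out.pos
  induction k with
  | zero =>
    refine adjoin_le_of_mul_mem R ?_ ?_
    · rw [← digitProd_zero (p := p) x]
      exact digitProd_mem_lowSpan R (by simp)
    · rintro _ ⟨j, hj, rfl⟩
      exact absurd hj (Nat.not_lt_zero j)
  | succ k ih =>
    have hlow : ∀ j < p, ∀ y ∈ lowAdjoin x R k,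
        x k ^ j * y ∈ lowSpan x R p (p ^ (k + 1)) := by
      intro j hj y hy
      refine lowSpan_mono R ?_ (pow_mul_mem_lowSpan R hj le_rfl (ih hy))
      rw [pow_succ']
      calc j * p ^ k + p ^ k = (j + 1) * p ^ k := by ring
        _ ≤ p * p ^ k := Nat.mul_le_mul_right _ hj
    refine adjoin_le_of_mul_mem R ?_ ?_
    · rw [← digitProd_zero (p := p) x]
      exact digitProd_mem_lowSpan R (pow_pos hp0 _)
    · rintro _ ⟨i, hi, rfl⟩ y hy
      refine Submodule.span_induction
        (p := fun y _ => x i * y ∈ lowSpan x R p (p ^ (k + 1))) ?_ ?_ ?_ ?_ hy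
      · rintro _ ⟨l, hl, rfl⟩
        have hl' : l < p * p ^ k := by rw [← pow_succ']; exact hl
        have hj : l / p ^ k < p := Nat.div_lt_of_lt_mul (by rwa [mul_comm])
        have hr : l % p ^ k < p ^ k := Nat.mod_lt _ (pow_pos hp0 k)
        rw [← Nat.div_add_mod' l (p ^ k), digitProd_add x hj hr]
        have he : digitProd p x (l % p ^ k) ∈ lowAdjoin x R k :=
          lowSpan_le_lowAdjoin R k (digitProd_mem_lowSpan R hr)
        rcases (Nat.lt_succ_iff_lt_or_eq.1 hi) with hik | rfl
        · rw [mul_left_comm]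
          exact hlow _ hj _ (mul_mem (mem_lowAdjoin R hik) he)
        · rw [← mul_assoc, ← pow_succ']
          rcases (Nat.succ_le_of_lt hj).lt_or_eq with h | h
          · exact hlow _ h _ he
          -- Only the digit p - 1 overflows; here the relation replaces x_i^p.
          · rw [show l / p ^ i + 1 = p from h]
            obtain ⟨u, hu, v, hv, huv⟩ := hx i
            have h0 := hlow 0 hp0 _ (mul_mem hu he)
            have h1 := hlow 1 hp.out.one_lt _ (mul_mem hv he)
            rw [pow_zero, one_mul] at h0
            rw [pow_one, ← mul_assoc] at h1
            rw [huv, add_mul]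
            exact add_mem h0 h1
      · rw [mul_zero]; exact zero_mem _
      · intro a b _ _ ha hb; rw [mul_add]; exact add_mem ha hb
      · intro r a _ ha; rw [mul_smul_comm]; exact Submodule.smul_mem _ _ ha

theorem adjoin_le_span_digitProd
    (hx : ∀ k, ∃ u ∈ lowAdjoin x R k, ∃ v ∈ lowAdjoin x R k, x k ^ p = u + x k * v) :
    Subalgebra.toSubmodule (Algebra.adjoin R (Set.range x))
      ≤ Submodule.span R (Set.range (digitProd p x)) := by
  have hle : ∀ k, lowSpan x R p k ≤ Submodule.span R (Set.range (digitProd p x)) := fun k =>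
    Submodule.span_mono (Set.image_subset_range _ _)
  refine adjoin_le_of_mul_mem R ?_ ?_
  · rw [← digitProd_zero (p := p) x]
    exact Submodule.subset_span ⟨0, rfl⟩
  · rintro _ ⟨j, rfl⟩ y hy
    refine Submodule.span_induction
      (p := fun y _ => x j * y ∈ Submodule.span R (Set.range (digitProd p x))) ?_ ?_ ?_ ?_ hy
    · rintro _ ⟨l, rfl⟩
      -- At this level both x_j and the product of index l are available.
      have hl : l < p ^ (max (j + 1) l) := lt_of_le_of_lt (le_max_right (j + 1) l)
        (Nat.lt_pow_self hp.out.one_lt)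
      refine hle _ (lowAdjoin_le_lowSpan R hx (max (j + 1) l) ?_)
      exact Subalgebra.mul_mem _ (mem_lowAdjoin R (lt_of_lt_of_le j.lt_succ_self (le_max_left _ _)))
        (lowSpan_le_lowAdjoin R _ (digitProd_mem_lowSpan R hl))
    · rw [mul_zero]; exact zero_mem _
    · intro a b _ _ ha hb; rw [mul_add]; exact add_mem ha hb
    · intro r a _ ha; rw [mul_smul_comm]; exact Submodule.smul_mem _ _ ha

/-- Multi-variable version of `adjoin_le_span_digitProd`. -/
theorem adjoin_iUnion_le_span_prod {ι : Type*} [Fintype ι] [DecidableEq ι] {x : ι → ℕ → Q}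
    (hx : ∀ i k, ∃ u ∈ lowAdjoin (x i) R k, ∃ v ∈ lowAdjoin (x i) R k,
      x i k ^ p = u + x i k * v) :
    Subalgebra.toSubmodule (Algebra.adjoin R (Set.range fun ik : ι × ℕ => x ik.1 ik.2))
      ≤ Submodule.span R (Set.range fun m : ι → ℕ => ∏ i, digitProd p (x i) (m i)) := by
  set N := Submodule.span R (Set.range fun m : ι → ℕ => ∏ i, digitProd p (x i) (m i))
  refine adjoin_le_of_mul_mem R ?_ ?_
  · refine Submodule.subset_span ⟨0, ?_⟩
    simp [digitProd_zero]
  · rintro _ ⟨⟨i, k⟩, rfl⟩ y hy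
    refine Submodule.span_induction (p := fun y _ => x i k * y ∈ N) ?_ ?_ ?_ ?_ hy
    · rintro _ ⟨m, rfl⟩
      have h1 : x i k * digitProd p (x i) (m i) ∈
          Submodule.span R (Set.range (digitProd p (x i))) := by
        refine adjoin_le_span_digitProd R (hx i) (Subalgebra.mul_mem _ (Algebra.subset_adjoin ⟨k, rfl⟩) ?_)
        exact Subalgebra.prod_mem (Algebra.adjoin R (Set.range (x i))) fun n _ =>
          pow_mem (Algebra.subset_adjoin (Set.mem_range_self n)) _
      change x i k * ∏ j, digitProd p (x j) (m j) ∈ N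
      rw [← Finset.mul_prod_erase _ _ (Finset.mem_univ i), ← mul_assoc]
      refine Submodule.span_induction (p := fun z _ => z * ∏ j ∈ Finset.univ.erase i,
        digitProd p (x j) (m j) ∈ N) ?_ ?_ ?_ ?_ h1
      · rintro _ ⟨l, rfl⟩
        refine Submodule.subset_span ⟨Function.update m i l, ?_⟩
        change ∏ j, digitProd p (x j) (Function.update m i l j) = _
        rw [← Finset.mul_prod_erase _ _ (Finset.mem_univ i), Function.update_self]
        congr 1
        refine Finset.prod_congr rfl fun j hj => ?_
        rw [Function.update_of_ne (Finset.ne_of_mem_erase hj)]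
      · rw [zero_mul]; exact zero_mem _
      · intro a b _ _ ha hb; rw [add_mul]; exact add_mem ha hb
      · intro r a _ ha; rw [smul_mul_assoc]; exact Submodule.smul_mem _ _ ha
    · rw [mul_zero]; exact zero_mem _
    · intro a b _ _ ha hb; rw [mul_add]; exact add_mem ha hb
    · intro r a _ ha; rw [mul_smul_comm]; exact Submodule.smul_mem _ _ ha

end DigitProd

/-! ### The polynomials [p]_q at q^(p^k), and units modulo I -/

section QNumIter

variable (p : ℕ) [hp : Fact p.Prime]

/-- The polynomial `[p]_q` with `q` replaced by `q^(p^k)`. -/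
def qNumIter : ℕ → ℤ[X]
  | 0 => qNum p
  | k + 1 => qNumIter k ^ p + p * δ p (qNumIter k)

/-- The recursion f^p + p δ(f) is the Frobenius lift f(q) ↦ f(q^p), by the definition of δ on ℤ[q].
-/
theorem qNumIter_succ_eq_expand (k : ℕ) : qNumIter p (k + 1) = expand ℤ p (qNumIter p k) := by
  rw [qNumIter, show δ p (qNumIter p k) = deltaIntPoly p (qNumIter p k) from rfl,
    deltaIntPoly_spec]
  ring

theorem eval_one_qNumIter (k : ℕ) : (qNumIter p k).eval 1 = p := by
  induction k with
  | zero => simp [qNumIter, qNum, eval_finsetSum]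
  | succ k ih => rw [qNumIter_succ_eq_expand, expand_eval, one_pow, ih]

/-- Both f(q^p) and f take the value p at q = 1, so p δ(f) takes the value p - p^p there. -/
theorem eval_one_delta_qNumIter (k : ℕ) :
    (δ p (qNumIter p k) : ℤ[X]).eval 1 = 1 - (p : ℤ) ^ (p - 1) := by
  have hp0 : (p : ℤ) ≠ 0 := Nat.cast_ne_zero.2 hp.out.ne_zero
  refine mul_left_cancel₀ hp0 ?_
  have h := congrArg (eval 1) (deltaIntPoly_spec p (qNumIter p k))
  rw [eval_mul, eval_natCast, eval_sub, eval_pow, expand_eval, one_pow, eval_one_qNumIter] at h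
  change (p : ℤ) * (deltaIntPoly p (qNumIter p k)).eval 1 = _
  rw [h, mul_sub, mul_pow_sub_one hp.out.ne_zero, mul_one]

/-- Expand q^p = (1 + μ)^p and compare with q^p - 1 = [p]_q μ. It shows μ^p ∈ I, so that μ is
nilpotent modulo I. -/
theorem qμ_pow_eq : qμ ^ p = qNum p * qμ - p * cross p 1 qμ := by
  have h1 : (1 + qμ) ^ p = X ^ p := by rw [qμ]; congr 1; ring
  have h2 : qNum p * qμ = X ^ p - 1 := geom_sum_mul X p
  have h3 := add_pow_eq_cross p 1 qμ
  rw [one_pow] at h3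
  linear_combination h1 - h2 - h3

variable (R : Type*) [CommRing R] [Algebra ℤ[X] R]

theorem natCast_mem_qIdeal : (p : R) ∈ qIdeal p R := Ideal.subset_span (Set.mem_insert _ _)

theorem qElt_qNum_mem_qIdeal : qElt R (qNum p) ∈ qIdeal p R :=
  Ideal.subset_span (Set.mem_insert_of_mem _ rfl)

theorem qElt_qμ_pow_mem : qElt R qμ ^ p ∈ qIdeal p R := by
  rw [qElt, ← map_pow, qμ_pow_eq, map_sub, map_mul, map_mul, map_natCast]
  exact Ideal.sub_mem _ (Ideal.mul_mem_right _ _ (qElt_qNum_mem_qIdeal p R))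
    (Ideal.mul_mem_right _ _ (natCast_mem_qIdeal p R))

theorem qElt_qNumIter_mem (k : ℕ) : qElt R (qNumIter p k) ∈ qIdeal p R := by
  induction k with
  | zero => exact qElt_qNum_mem_qIdeal p R
  | succ k ih =>
    rw [qElt, qNumIter, map_add, map_mul, map_pow, map_natCast]
    exact Ideal.add_mem _ (Ideal.pow_mem_of_mem _ ih _ hp.out.pos)
      (Ideal.mul_mem_right _ _ (natCast_mem_qIdeal p R))

/-- The value of the polynomial at q = 1 is 1 - p^(p-1), so modulo I it is 1 plus a multiple of the
nilpotent element μ, hence a unit. -/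
theorem exists_mul_delta_qNumIter_sub_one_mem (k : ℕ) :
    ∃ v : R, v * qElt R (δ p (qNumIter p k)) - 1 ∈ qIdeal p R := by
  set f : ℤ[X] := δ p (qNumIter p k)
  set φ : ℤ[X] →+* R ⧸ qIdeal p R := (Ideal.Quotient.mk _).comp (algebraMap ℤ[X] R)
  have hpz : φ (p : ℤ[X]) = 0 := by
    rw [map_natCast, ← map_natCast (Ideal.Quotient.mk (qIdeal p R))]
    exact Ideal.Quotient.eq_zero_iff_mem.2 (natCast_mem_qIdeal p R)
  have hμ : IsNilpotent (φ qμ) := ⟨p, by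
    rw [RingHom.comp_apply, ← map_pow]
    exact Ideal.Quotient.eq_zero_iff_mem.2 (qElt_qμ_pow_mem p R)⟩
  obtain ⟨g, hg⟩ : qμ ∣ f - C (f.eval 1) := by
    rw [qμ, ← C_1, dvd_iff_isRoot]
    simp
  have hf : φ f = 1 + φ qμ * φ g := by
    have e : f = 1 - (p : ℤ[X]) ^ (p - 1) + qμ * g := by
      rw [← hg, eval_one_delta_qNumIter]
      simp
    rw [e, map_add, map_sub, map_pow, hpz, map_mul, map_one,
      zero_pow (Nat.sub_ne_zero_of_lt hp.out.one_lt), sub_zero]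
  have hu : IsUnit (φ f) := by
    rw [hf]
    exact IsNilpotent.isUnit_one_add (Commute.isNilpotent_mul_right (Commute.all _ _) hμ)
  obtain ⟨w, hw⟩ := hu.exists_left_inv
  obtain ⟨v, rfl⟩ := Ideal.Quotient.mk_surjective w
  exact ⟨v, Ideal.Quotient.eq.1 (by rw [map_mul, map_one]; exact hw)⟩

end QNumIter

/-! ### Integral equations for δ^k(τ) modulo I -/

section Relation

variable {p : ℕ} [hp : Fact p.Prime] {R B : Type*} [CommRing R] [DeltaRing p R]
  [CommRing B] [DeltaRing p B] [Algebra R B] [IsDeltaAlgebra p R B]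

/-- Applying δ to an element of level k produces δ^k(τ) linearly, except in the term p δ(a) δ(b) of
the product rule; there the factor p absorbs the higher degree. -/
theorem delta_mem_lowAdjoin (τ : B) (k : ℕ) {y : B}
    (hy : y ∈ lowAdjoin (fun j => (δ p)^[j] τ) R k) :
    ∃ u ∈ lowAdjoin (fun j => (δ p)^[j] τ) R k, ∃ v ∈ lowAdjoin (fun j => (δ p)^[j] τ) R k,
      ∃ z ∈ lowAdjoin (fun j => (δ p)^[j] τ) R (k + 1),
        δ p y = u + (δ p)^[k] τ * v + p * z := by
  set x : ℕ → B := fun j => (δ p)^[j] τ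
  have hle : lowAdjoin x R k ≤ lowAdjoin x R (k + 1) := lowAdjoin_mono R k.le_succ
  have hxk : (δ p)^[k] τ ∈ lowAdjoin x R (k + 1) := mem_lowAdjoin (x := x) R k.lt_succ_self
  have hp1 : (p : B) ∈ lowAdjoin x R (k + 1) := natCast_mem _ _
  refine Algebra.adjoin_induction (p := fun y _ => ∃ u ∈ lowAdjoin x R k,
    ∃ v ∈ lowAdjoin x R k, ∃ z ∈ lowAdjoin x R (k + 1),
      δ p y = u + (δ p)^[k] τ * v + p * z) ?_ ?_ ?_ ?_ hy
  · rintro _ ⟨j, hj, rfl⟩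
    have e : δ p (x j) = (δ p)^[j + 1] τ := (Function.iterate_succ_apply' _ _ _).symm
    rcases (Nat.succ_le_of_lt hj).lt_or_eq with h | h
    · exact ⟨x (j + 1), mem_lowAdjoin R h, 0, zero_mem _, 0, zero_mem _, by rw [e]; simp [x]⟩
    · subst h
      exact ⟨0, zero_mem _, 1, one_mem _, 0, zero_mem _, by rw [e]; simp⟩
  · intro r
    exact ⟨algebraMap R B (δ p r), Subalgebra.algebraMap_mem _ _, 0, zero_mem _, 0, zero_mem _,
      by rw [IsDeltaAlgebra.algebraMap_δ]; simp⟩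
  · rintro a b ha hb ⟨u, hu, v, hv, z, hz, h⟩ ⟨u', hu', v', hv', z', hz', h'⟩
    refine ⟨u + u' - cross p a b, sub_mem (add_mem hu hu') (cross_mem_subalgebra p _ ha hb),
      v + v', add_mem hv hv', z + z', add_mem hz hz', ?_⟩
    rw [DeltaRing.δ_add, h, h']
    ring
  · rintro a b ha hb ⟨u, hu, v, hv, z, hz, h⟩ ⟨u', hu', v', hv', z', hz', h'⟩
    refine ⟨u * b ^ p + a ^ p * u',
      add_mem (mul_mem hu (pow_mem hb _)) (mul_mem (pow_mem ha _) hu'),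
      v * b ^ p + a ^ p * v', add_mem (mul_mem hv (pow_mem hb _)) (mul_mem (pow_mem ha _) hv'),
      z * b ^ p + a ^ p * z' + δ p a * δ p b, ?_, ?_⟩
    · refine add_mem (add_mem (mul_mem hz (pow_mem (hle hb) _))
        (mul_mem (pow_mem (hle ha) _) hz')) ?_
      rw [h, h']
      exact mul_mem (add_mem (add_mem (hle hu) (mul_mem hxk (hle hv))) (mul_mem hp1 hz))
        (add_mem (add_mem (hle hu') (mul_mem hxk (hle hv'))) (mul_mem hp1 hz'))
    · rw [DeltaRing.δ_mul, h, h']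
      ring

theorem delta_mem_adjoin_of_forall {s : Set B} (S : Subalgebra R B)
    (hs : ∀ x ∈ s, x ∈ S ∧ δ p x ∈ S) {y : B} (hy : y ∈ Algebra.adjoin R s) : δ p y ∈ S := by
  refine (Algebra.adjoin_induction (p := fun y _ => y ∈ S ∧ δ p y ∈ S) hs ?_ ?_ ?_ hy).2
  · intro r
    rw [← IsDeltaAlgebra.algebraMap_δ]
    exact ⟨S.algebraMap_mem _, S.algebraMap_mem _⟩
  · rintro a b _ _ ⟨ha, ha'⟩ ⟨hb, hb'⟩
    rw [DeltaRing.δ_add]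
    exact ⟨add_mem ha hb, sub_mem (add_mem ha' hb') (cross_mem_subalgebra p _ ha hb)⟩
  · rintro a b _ _ ⟨ha, ha'⟩ ⟨hb, hb'⟩
    rw [DeltaRing.δ_mul]
    exact ⟨mul_mem ha hb, add_mem (add_mem (mul_mem ha' (pow_mem hb _))
      (mul_mem (pow_mem ha _) hb')) (mul_mem (mul_mem (natCast_mem _ _) ha') hb')⟩

variable [Algebra ℤ[X] R] [IsDeltaAlgebra p ℤ[X] R]

theorem algebraMap_qElt_δ (f : ℤ[X]) :
    algebraMap R B (qElt R (δ p f)) = δ p (algebraMap R B (qElt R f)) := by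
  rw [qElt, IsDeltaAlgebra.algebraMap_δ, IsDeltaAlgebra.algebraMap_δ]

/-- The coefficient of δ(x) in the product rule is w^p + p δ(w), which is the next iterate of w. -/
theorem delta_qNumIter_mul (k : ℕ) (x : B) :
    δ p (algebraMap R B (qElt R (qNumIter p k)) * x)
      = algebraMap R B (qElt R (δ p (qNumIter p k))) * x ^ p
        + algebraMap R B (qElt R (qNumIter p (k + 1))) * δ p x := by
  rw [DeltaRing.δ_mul, algebraMap_qElt_δ, qNumIter, qElt, qElt, map_add, map_add, map_mul, map_mul,
    map_pow, map_pow, map_natCast, map_natCast]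
  have := algebraMap_qElt_δ (p := p) (R := R) (B := B) (qNumIter p k)
  rw [qElt, qElt] at this
  rw [this]
  ring

variable {τ : B} {a : R}

/-- Write w_k for the k-th iterate of [p]_q. Expanding δ(w_k δ^k(τ) + g) = 0 exhibits 0 as w_(k+1)
δ^(k+1)(τ) plus an element of level k + 1, and δ of this expression is again 0. -/
theorem exists_delta_relation
    (h : δ p (algebraMap R B (qElt R (qNum p)) * τ + algebraMap R B a) = 0) (k : ℕ) :
    ∃ g ∈ lowAdjoin (fun j => (δ p)^[j] τ) R k,
      δ p (algebraMap R B (qElt R (qNumIter p k)) * (δ p)^[k] τ + g) = 0 := by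
  induction k with
  | zero => exact ⟨algebraMap R B a, Subalgebra.algebraMap_mem _ _, h⟩
  | succ k ih =>
    obtain ⟨g, hg, h0⟩ := ih
    set x : ℕ → B := fun j => (δ p)^[j] τ
    have hle : lowAdjoin x R k ≤ lowAdjoin x R (k + 1) := lowAdjoin_mono R k.le_succ
    have hxk : (δ p)^[k] τ ∈ lowAdjoin x R (k + 1) := mem_lowAdjoin (x := x) R k.lt_succ_self
    have hδg : δ p g ∈ lowAdjoin x R (k + 1) := by
      obtain ⟨u, hu, v, hv, z, hz, e⟩ := delta_mem_lowAdjoin τ k hg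
      rw [e]
      exact add_mem (add_mem (hle hu) (mul_mem hxk (hle hv))) (mul_mem (natCast_mem _ _) hz)
    rw [DeltaRing.δ_add, delta_qNumIter_mul] at h0
    refine ⟨algebraMap R B (qElt R (δ p (qNumIter p k))) * ((δ p)^[k] τ) ^ p + δ p g
      - cross p (algebraMap R B (qElt R (qNumIter p k)) * (δ p)^[k] τ) g, ?_, ?_⟩
    · refine sub_mem (add_mem (mul_mem (Subalgebra.algebraMap_mem _ _) (pow_mem hxk _)) hδg)
        (cross_mem_subalgebra p _ (mul_mem (Subalgebra.algebraMap_mem _ _) hxk) (hle hg))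
    · rw [← DeltaRing.δ_zero (p := p), Function.iterate_succ_apply']
      congr 1
      rw [← h0]
      ring

/-- The relation `δ([p]_q τ + a) = 0` makes `δ^k(τ)` integral of degree `p` modulo `I`. -/
theorem exists_pow_sub_mem
    (h : δ p (algebraMap R B (qElt R (qNum p)) * τ + algebraMap R B a) = 0) (k : ℕ) :
    ∃ u ∈ lowAdjoin (fun j => (δ p)^[j] τ) R k, ∃ v ∈ lowAdjoin (fun j => (δ p)^[j] τ) R k,
      ((δ p)^[k] τ) ^ p - (u + (δ p)^[k] τ * v) ∈ (qIdeal p R).map (algebraMap R B) := by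
  obtain ⟨g, hg, h0⟩ := exists_delta_relation h k
  obtain ⟨u, hu, v, hv, z, hz, e⟩ := delta_mem_lowAdjoin τ k hg
  obtain ⟨c, hc⟩ := exists_mul_delta_qNumIter_sub_one_mem p R k
  have hI : ∀ r ∈ qIdeal p R, algebraMap R B r ∈ (qIdeal p R).map (algebraMap R B) :=
    fun r hr => Ideal.mem_map_of_mem _ hr
  set J := (qIdeal p R).map (algebraMap R B)
  have hp' : (p : B) ∈ J := by
    rw [← map_natCast (algebraMap R B)]; exact hI _ (natCast_mem_qIdeal p R)
  rw [DeltaRing.δ_add, delta_qNumIter_mul, e] at h0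
  have hw := hI _ (qElt_qNumIter_mem p R k)
  have hw' := hI _ (qElt_qNumIter_mem p R (k + 1))
  have hcr := cross_mem_left p J g (J.mul_mem_right ((δ p)^[k] τ) hw)
  have hc' := hI _ hc
  rw [map_sub, map_mul, map_one] at hc'
  refine ⟨algebraMap R B (-c) * u, mul_mem (Subalgebra.algebraMap_mem _ _) hu,
    algebraMap R B (-c) * v, mul_mem (Subalgebra.algebraMap_mem _ _) hv, ?_⟩
  set D := algebraMap R B (qElt R (δ p (qNumIter p k)))
  set w := algebraMap R B (qElt R (qNumIter p (k + 1)))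
  set X := cross p (algebraMap R B (qElt R (qNumIter p k)) * (δ p)^[k] τ) g
  -- The relation is multiplied by `c`, an inverse of δ(w_k) modulo I. Each summand on the right has
  -- a factor in I: `c` δ(w_k) - 1, w_(k+1), p, or the cross term with its factor w_k.
  have key : ((δ p)^[k] τ) ^ p - (algebraMap R B (-c) * u + (δ p)^[k] τ * (algebraMap R B (-c) * v))
      = (-((δ p)^[k] τ) ^ p) * (algebraMap R B c * D - 1)
        + (-algebraMap R B c * δ p ((δ p)^[k] τ)) * w + (-algebraMap R B c * z) * p
        + algebraMap R B c * X := by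
    rw [map_neg]
    linear_combination algebraMap R B c * h0
  rw [key]
  exact add_mem (add_mem (add_mem (J.mul_mem_left _ hc') (J.mul_mem_left _ hw'))
    (J.mul_mem_left _ hp')) (J.mul_mem_left _ hcr)

end Relation

/-- The hypothesis is substituted into its own I-part repeatedly; for nilpotent I this is Nakayama's
lemma without finiteness. -/
theorem sup_pow_smul_top_eq_top {R M : Type*} [CommRing R] [AddCommGroup M] [Module R M] {N : Submodule R M}
    {I : Ideal R} (h : N ⊔ I • ⊤ = ⊤) (n : ℕ) : N ⊔ I ^ n • ⊤ = ⊤ := by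
  induction n with
  | zero => simp
  | succ n ih =>
    rw [eq_top_iff]
    calc (⊤ : Submodule R M) = N ⊔ I ^ n • (N ⊔ I • ⊤) := by rw [h, ih]
      _ = N ⊔ (I ^ n • N ⊔ I ^ (n + 1) • ⊤) := by
        rw [Submodule.smul_sup, ← mul_smul, pow_succ]
      _ ≤ N ⊔ I ^ (n + 1) • ⊤ :=
        sup_le le_sup_left (sup_le (Submodule.smul_le_right.trans le_sup_left) le_sup_right)

/-! ### Spanning by δ-monomials up to powers of I -/

section DeltaSubalgebra

variable {p : ℕ} [hp : Fact p.Prime] {R B : Type*} [CommRing R] [DeltaRing p R]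
  [CommRing B] [DeltaRing p B] [Algebra R B] [IsDeltaAlgebra p R B]

/-- The `δ`-structure on a subalgebra that is stable under `δ`. -/
@[reducible]
def deltaRingSubalgebra (S : Subalgebra R B) (hS : ∀ x ∈ S, δ p x ∈ S) : DeltaRing p S where
  δ x := ⟨δ p (x : B), hS _ x.2⟩
  δ_zero := Subtype.ext DeltaRing.δ_zero
  δ_one := Subtype.ext DeltaRing.δ_one
  δ_add x y := Subtype.ext <| by
    have h := map_cross p S.val.toRingHom x y
    change δ p ((x : B) + y) = δ p (x : B) + δ p (y : B) - S.val.toRingHom (cross p x y)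
    rw [h, DeltaRing.δ_add]
    rfl
  δ_mul x y := Subtype.ext <| by
    change δ p ((x : B) * y) = _
    rw [DeltaRing.δ_mul]
    simp

/-- The `R`-subalgebra generated by the elements `δ^k(τ_i)`. -/
def deltaAdjoin (p : ℕ) (R : Type*) {B ι : Type*} [CommRing R] [CommRing B] [DeltaRing p B]
    [Algebra R B] (τ : ι → B) : Subalgebra R B :=
  Algebra.adjoin R (Set.range fun ik : ι × ℕ => (δ p)^[ik.2] (τ ik.1))

theorem iterate_mem_deltaAdjoin {ι : Type*} (τ : ι → B) (i : ι) (k : ℕ) :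
    (δ p)^[k] (τ i) ∈ deltaAdjoin p R τ :=
  Algebra.subset_adjoin ⟨(i, k), rfl⟩

theorem mem_deltaAdjoin {ι : Type*} (τ : ι → B) (i : ι) : τ i ∈ deltaAdjoin p R τ :=
  iterate_mem_deltaAdjoin τ i 0

theorem delta_mem_deltaAdjoin {ι : Type*} (τ : ι → B) {x : B} (hx : x ∈ deltaAdjoin p R τ) :
    δ p x ∈ deltaAdjoin p R τ := by
  refine delta_mem_adjoin_of_forall _ ?_ hx
  rintro _ ⟨⟨i, k⟩, rfl⟩
  refine ⟨iterate_mem_deltaAdjoin τ i k, ?_⟩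
  have := iterate_mem_deltaAdjoin (p := p) (R := R) τ i (k + 1)
  rwa [Function.iterate_succ_apply'] at this

theorem deltaPow_eq_digitProd (x : B) (m : ℕ) :
    deltaPow p x m = digitProd p (fun k => (δ p)^[k] x) m := rfl

theorem deltaPow_mem_deltaAdjoin {ι : Type*} (τ : ι → B) (i : ι) (m : ℕ) :
    deltaPow p (τ i) m ∈ deltaAdjoin p R τ :=
  Subalgebra.prod_mem _ fun k _ => pow_mem (iterate_mem_deltaAdjoin τ i k) _

theorem prod_deltaPow_mem_deltaAdjoin {ι : Type*} [Fintype ι] (τ : ι → B) (m : ι → ℕ) :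
    ∏ i, deltaPow p (τ i) (m i) ∈ deltaAdjoin p R τ :=
  Subalgebra.prod_mem _ fun i _ => deltaPow_mem_deltaAdjoin τ i _

theorem mem_lowAdjoin_map {Q Q' : Type*} [CommRing Q] [CommRing Q'] [Algebra R Q] [Algebra R Q']
    (f : Q →ₐ[R] Q') (x : ℕ → Q) {k : ℕ} {y : Q} (hy : y ∈ lowAdjoin x R k) :
    f y ∈ lowAdjoin (fun n => f (x n)) R k := by
  have h : f y ∈ (lowAdjoin x R k).map f := ⟨y, hy, rfl⟩
  rw [lowAdjoin, AlgHom.map_adjoin, ← Set.image_comp] at h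
  exact h

variable [Algebra ℤ[X] R] [IsDeltaAlgebra p ℤ[X] R]

theorem exists_quotient_pow_eq {J : Ideal B} (hJ : (qIdeal p R).map (algebraMap R B) ≤ J)
    {τ : B} {a : R}
    (h : δ p (algebraMap R B (qElt R (qNum p)) * τ + algebraMap R B a) = 0) (k : ℕ) :
    ∃ u ∈ lowAdjoin (fun j => Ideal.Quotient.mk J ((δ p)^[j] τ)) R k,
    ∃ v ∈ lowAdjoin (fun j => Ideal.Quotient.mk J ((δ p)^[j] τ)) R k,
      Ideal.Quotient.mk J ((δ p)^[k] τ) ^ p = u + Ideal.Quotient.mk J ((δ p)^[k] τ) * v := by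
  obtain ⟨u, hu, v, hv, huv⟩ := exists_pow_sub_mem h k
  refine ⟨_, mem_lowAdjoin_map (Ideal.Quotient.mkₐ R J) _ hu, _,
    mem_lowAdjoin_map (Ideal.Quotient.mkₐ R J) _ hv, ?_⟩
  have := Ideal.Quotient.eq.2 (hJ huv)
  rw [map_pow, map_add, map_mul] at this
  exact this

variable {ι : Type*} [Fintype ι] [DecidableEq ι] {τ : ι → B} {a : ι → R}

/-- It is enough to treat n = 1, that is, the quotient by IB; there the integral equations let the
digit products span the whole algebra. -/
theorem span_sup_pow_smul_eq_top (hgen : deltaAdjoin p R τ = ⊤)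
    (h : ∀ i, δ p (algebraMap R B (qElt R (qNum p)) * τ i + algebraMap R B (a i)) = 0) (n : ℕ) :
    Submodule.span R (Set.range fun m : ι → ℕ => ∏ i, deltaPow p (τ i) (m i))
      ⊔ qIdeal p R ^ n • ⊤ = ⊤ := by
  refine sup_pow_smul_top_eq_top ?_ n
  set J := (qIdeal p R).map (algebraMap R B)
  set f := Ideal.Quotient.mkₐ R J
  rw [eq_top_iff]
  intro b _
  have hb : f b ∈ Algebra.adjoin R
      (Set.range fun ik : ι × ℕ => Ideal.Quotient.mk J ((δ p)^[ik.2] (τ ik.1))) := by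
    have h1 : f b ∈ (deltaAdjoin p R τ).map f := ⟨b, hgen ▸ Algebra.mem_top, rfl⟩
    rw [deltaAdjoin, AlgHom.map_adjoin, ← Set.range_comp] at h1
    exact h1
  have h2 := adjoin_iUnion_le_span_prod R (p := p)
    (x := fun i k => Ideal.Quotient.mk J ((δ p)^[k] (τ i)))
    (fun i k => exists_quotient_pow_eq le_rfl (h i) k) hb
  have h3 : (Set.range fun m : ι → ℕ =>
      ∏ i, digitProd p (fun k => Ideal.Quotient.mk J ((δ p)^[k] (τ i))) (m i))
      = f.toLinearMap '' Set.range fun m : ι → ℕ => ∏ i, deltaPow p (τ i) (m i) := by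
    rw [← Set.range_comp]
    congr 1
    funext m
    simp only [Function.comp_apply, AlgHom.toLinearMap_apply, map_prod]
    refine Finset.prod_congr rfl fun i _ => ?_
    rw [deltaPow_eq_digitProd]
    exact (map_digitProd p (Ideal.Quotient.mk J) _ _).symm
  rw [h3, ← Submodule.map_span] at h2
  obtain ⟨y, hy, hyb⟩ := h2
  have h4 : b - y ∈ J := Ideal.Quotient.eq.1 hyb.symm
  rw [← sub_add_cancel b y, add_comm]
  refine Submodule.add_mem_sup hy ?_
  rw [Ideal.smul_top_eq_map]
  exact h4

/-- The error lies in I^n times the subalgebra itself, which is stronger than lying in I^n B. This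
comes from applying the previous statement to the subalgebra as a δ-ring in its own right. -/
theorem deltaAdjoin_le
    (h : ∀ i, δ p (algebraMap R B (qElt R (qNum p)) * τ i + algebraMap R B (a i)) = 0) (n : ℕ) :
    Subalgebra.toSubmodule (deltaAdjoin p R τ)
      ≤ Submodule.span R (Set.range fun m : ι → ℕ => ∏ i, deltaPow p (τ i) (m i))
        ⊔ qIdeal p R ^ n • Subalgebra.toSubmodule (deltaAdjoin p R τ) := by
  set S := deltaAdjoin p R τ
  let _ : DeltaRing p S := deltaRingSubalgebra S fun x hx => delta_mem_deltaAdjoin τ hx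
  have : IsDeltaAlgebra p R S := ⟨fun x => Subtype.ext (IsDeltaAlgebra.algebraMap_δ (S := B) x)⟩
  let τ' : ι → S := fun i => ⟨τ i, mem_deltaAdjoin τ i⟩
  have hδ : ∀ (k : ℕ) (x : S), (((δ p)^[k] x : S) : B) = (δ p)^[k] (x : B) := by
    intro k
    induction k with
    | zero => intro x; rfl
    | succ k ih =>
      intro x
      rw [Function.iterate_succ_apply', Function.iterate_succ_apply', ← ih]
      rfl
  have hgen : deltaAdjoin p R τ' = ⊤ := by
    refine Subalgebra.map_injective (f := S.val) Subtype.val_injective ?_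
    rw [Algebra.map_top, Subalgebra.range_val, deltaAdjoin, AlgHom.map_adjoin, ← Set.range_comp]
    change Algebra.adjoin R (Set.range fun ik : ι × ℕ => (((δ p)^[ik.2] (τ' ik.1) : S) : B)) = _
    simp only [hδ]
    rfl
  have key := span_sup_pow_smul_eq_top (τ := τ') (a := a) hgen
    (fun i => Subtype.ext (h i)) n
  have h2 := congrArg (Submodule.map S.val.toLinearMap) key
  have h5 : Submodule.map S.val.toLinearMap ⊤ = Subalgebra.toSubmodule S := by
    ext; simp
  have h3 : S.val.toLinearMap '' (Set.range fun m : ι → ℕ => ∏ i, deltaPow p (τ' i) (m i))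
      = Set.range fun m : ι → ℕ => ∏ i, deltaPow p (τ i) (m i) := by
    rw [← Set.range_comp]
    congr 1
    funext m
    simp only [Function.comp_apply, AlgHom.toLinearMap_apply, map_prod]
    refine Finset.prod_congr rfl fun i _ => ?_
    rw [deltaPow_eq_digitProd, deltaPow_eq_digitProd]
    refine (map_digitProd p S.val.toRingHom _ _).trans ?_
    congr 1
    funext k
    exact hδ k _
  rw [Submodule.map_sup, Submodule.map_smul'', Submodule.map_span, h3, h5] at h2
  exact h2.ge

end DeltaSubalgebra

/-! ### Leading terms of an ordinary derivation on digit products -/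

section Triangular

variable {p : ℕ} [hp : Fact p.Prime] {Q : Type*} [CommRing Q]

/-- The projection `x + y ε ↦ x`. -/
def TwEps.reHom {B : Type*} [CommRing B] (α : B) : TwEps α →+* B where
  toFun x := x.re
  map_zero' := rfl
  map_one' := rfl
  map_add' _ _ := rfl
  map_mul' x y := by simp

/-- The ring homomorphism `x + y ε ↦ f(x) + f(y) ε`. -/
def TwEps.map {B C : Type*} [CommRing B] [CommRing C] (f : B →+* C) {α : B} {α' : C}
    (h : f α = α') : TwEps α →+* TwEps α' where
  toFun x := ⟨f x.re, f x.im⟩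
  map_zero' := by ext <;> simp
  map_one' := by ext <;> simp [QuadraticAlgebra.re_one, QuadraticAlgebra.im_one]
  map_add' x y := by ext <;> simp
  map_mul' x y := by subst h; ext <;> simp

theorem TwEps.im_pow (x : TwEps (0 : Q)) (j : ℕ) :
    (x ^ j).im = j * x.re ^ (j - 1) * x.im := by
  induction j with
  | zero => simp [QuadraticAlgebra.im_one]
  | succ j ih =>
    have hre : (x ^ j).re = x.re ^ j := map_pow (TwEps.reHom 0) x j
    rw [pow_succ, QuadraticAlgebra.im_mul, ih, hre]
    rcases j with _ | j
    · simp
    · simp only [Nat.add_sub_cancel, pow_succ]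
      push_cast
      ring

variable (R : Type*) [CommRing R] [Algebra R Q] (X : ℕ → TwEps (0 : Q))

/-- The leading term of the `k`-th derivative `y_k` is `± digitProd p x (p^k - 1)`. -/
theorem im_sub_mem_lowSpan {x : ℕ → Q}
    (hx : ∀ k, ∃ u ∈ lowAdjoin x R k, ∃ v ∈ lowAdjoin x R k, x k ^ p = u + x k * v)
    (b : R) (h0 : (X 0).im = 1)
    (hsucc : ∀ k, (X (k + 1)).im
      = algebraMap R Q b * (X k).im ^ p - x k ^ (p - 1) * (X k).im) (k : ℕ) :
    (X k).im - (((-1) ^ k : ℤ) : R) • digitProd p x (p ^ k - 1) ∈ lowSpan x R p (p ^ k - 1) := by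
  have hp1 : 0 < p := hp.out.pos
  induction k with
  | zero =>
    rw [h0]
    simp [digitProd_zero]
  | succ k ih =>
    have hpk : 0 < p ^ k := pow_pos hp1 k
    have hpp : p ^ k * 2 ≤ p ^ (k + 1) := Nat.mul_le_mul_left _ hp.out.two_le
    have e1 : (p - 1) * p ^ k + (p ^ k - 1) = p ^ (k + 1) - 1 := by
      obtain ⟨q, hq⟩ : ∃ q, p = q + 1 := ⟨p - 1, by omega⟩
      rw [pow_succ', Nat.sub_mul, one_mul]
      have : p ^ k ≤ p * p ^ k := Nat.le_mul_of_pos_left _ hp1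
      omega
    have hy : (X k).im ∈ lowAdjoin x R k := by
      refine lowSpan_le_lowAdjoin (p := p) R k ?_
      rw [← sub_add_cancel (X k).im]
      exact add_mem (lowSpan_mono R (Nat.sub_le _ _) ih)
        (Submodule.smul_mem _ _ (digitProd_mem_lowSpan R (by omega)))
    -- The derivative y_k involves x_0, …, x_(k-1) only, so b y_k^p stays below index p^k and cannot
    -- reach p^(k+1) - 1. The leading term comes from -x_k^(p-1) y_k.
    have h1 := lowSpan_mono (p := p) R (show p ^ k ≤ p ^ (k + 1) - 1 by omega)
      (lowAdjoin_le_lowSpan R hx k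
        (Subalgebra.mul_mem _ (Subalgebra.algebraMap_mem _ b) (Subalgebra.pow_mem _ hy p)))
    have h2 := pow_mul_mem_lowSpan R (k := k) (Nat.sub_lt hp1 one_pos) (Nat.sub_le _ 1) ih
    rw [e1, mul_sub, mul_smul_comm, ← digitProd_add x (Nat.sub_lt hp1 one_pos)
      (Nat.sub_lt hpk one_pos), e1] at h2
    rw [hsucc]
    convert sub_mem h1 h2 using 1
    rw [pow_succ]
    push_cast
    rw [mul_neg_one, neg_smul]
    ring

/-- Write m + 1 = j p^k + r with r < p^k. If r > 0, the leading term comes from differentiating the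
lower product, and c is the constant belonging to r. If r = 0, it comes from j x_k^(j-1) y_k, so c =
± j, which is prime to p because 0 < j < p. -/
theorem exists_im_digitProd_sub_mem {x : ℕ → Q} (hX : ∀ k, (X k).re = x k)
    (hx : ∀ k, ∃ u ∈ lowAdjoin x R k, ∃ v ∈ lowAdjoin x R k, x k ^ p = u + x k * v)
    (b : R) (h0 : (X 0).im = 1)
    (hsucc : ∀ k, (X (k + 1)).im
      = algebraMap R Q b * (X k).im ^ p - x k ^ (p - 1) * (X k).im) (m : ℕ) :
    ∃ c : ℤ, ¬ (p : ℤ) ∣ c ∧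
      (digitProd p X (m + 1)).im - (c : R) • digitProd p x m ∈ lowSpan x R p m := by
  have hp1 : 0 < p := hp.out.pos
  -- Here k only bounds the number of digits; the top digit j may vanish.
  suffices H : ∀ k m, m + 1 < p ^ k → ∃ c : ℤ, ¬ (p : ℤ) ∣ c ∧
      (digitProd p X (m + 1)).im - (c : R) • digitProd p x m ∈ lowSpan x R p m from
    H (m + 1) m (Nat.lt_pow_self hp.out.one_lt)
  intro k
  induction k with
  | zero => intro m hm; simp at hm
  | succ k ih =>
    intro m hm
    have hpk : 0 < p ^ k := pow_pos hp1 k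
    have hj : (m + 1) / p ^ k < p := Nat.div_lt_of_lt_mul (by rwa [← pow_succ])
    have hr : (m + 1) % p ^ k < p ^ k := Nat.mod_lt _ hpk
    have hm' := Nat.div_add_mod' (m + 1) (p ^ k)
    generalize (m + 1) / p ^ k = j at *
    generalize (m + 1) % p ^ k = r at *
    have hreX : (digitProd p X r).re = digitProd p x r :=
      (map_digitProd p (TwEps.reHom 0) X r).trans
        (congrArg (fun f => digitProd p f r) (funext hX))
    have him : (digitProd p X (m + 1)).im = x k ^ j * (digitProd p X r).im
        + j * (x k ^ (j - 1) * ((X k).im * digitProd p x r)) := by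
      have hre : (X k ^ j).re = (X k).re ^ j := map_pow (TwEps.reHom 0) (X k) j
      rw [← hm', digitProd_add X hj hr, QuadraticAlgebra.im_mul, TwEps.im_pow, hre, hreX, hX]
      ring
    have hy := im_sub_mem_lowSpan R X hx b h0 hsucc k
    rcases r with _ | r
    · -- `m + 1 = j p^k`
      have hj0 : 0 < j := by
        rcases Nat.eq_zero_or_pos j with rfl | h
        · simp at hm'
        · exact h
      have e1 : (j - 1) * p ^ k + (p ^ k - 1) = m := by
        have : p ^ k ≤ j * p ^ k := Nat.le_mul_of_pos_left _ hj0
        rw [Nat.sub_mul, one_mul]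
        omega
      have h2 := pow_mul_mem_lowSpan R (k := k) (j := j - 1) (by omega) (Nat.sub_le _ 1) hy
      rw [e1, mul_sub, mul_smul_comm, ← digitProd_add x (by omega)
        (Nat.sub_lt hpk one_pos), e1] at h2
      refine ⟨j * (-1) ^ k, ?_, ?_⟩
      · have hpz := Nat.prime_iff_prime_int.1 hp.out
        intro hdvd
        rcases hpz.dvd_mul.1 hdvd with h | h
        · exact absurd (Nat.le_of_dvd hj0 (Int.natCast_dvd_natCast.1 h)) (by omega)
        · exact hpz.not_isUnit (isUnit_of_dvd_unit (hpz.dvd_of_dvd_pow h) isUnit_one.neg)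
      · have h3 := Submodule.smul_mem _ (j : R) h2
        rw [smul_sub, smul_smul] at h3
        rw [him, digitProd_zero, digitProd_zero, QuadraticAlgebra.im_one, mul_zero, zero_add,
          mul_one, ← nsmul_eq_mul, ← Nat.cast_smul_eq_nsmul R]
        simpa using h3
    · obtain ⟨c, hc, hcm⟩ := ih r hr
      have e1 : j * p ^ k + r = m := by omega
      refine ⟨c, hc, ?_⟩
      have h2 := pow_mul_mem_lowSpan R (k := k) hj (by omega : r ≤ p ^ k) hcm
      rw [e1, mul_sub, mul_smul_comm, ← digitProd_add x hj (by omega), e1] at h2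
      have h3 : (X k).im * digitProd p x (r + 1) ∈ lowAdjoin x R k := by
        have hy' : (X k).im ∈ lowSpan x R p (p ^ k) := by
          rw [← sub_add_cancel (X k).im]
          exact add_mem (lowSpan_mono R (Nat.sub_le _ _) hy)
            (Submodule.smul_mem _ _ (digitProd_mem_lowSpan R (by omega)))
        exact mul_mem (lowSpan_le_lowAdjoin R k hy')
          (lowSpan_le_lowAdjoin R k (digitProd_mem_lowSpan R hr))
      -- Differentiating x_k^j lowers the top digit: this term has indices below j p^k ≤ m.
      have h4 : (j : Q) * (x k ^ (j - 1) * ((X k).im * digitProd p x (r + 1)))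
          ∈ lowSpan x R p m := by
        rcases Nat.eq_zero_or_pos j with rfl | hj0
        · simp
        · rw [← nsmul_eq_mul]
          refine nsmul_mem (lowSpan_mono R ?_ (pow_mul_mem_lowSpan R (k := k) (j := j - 1)
            (by omega) le_rfl (lowAdjoin_le_lowSpan R hx k h3))) j
          have : p ^ k ≤ j * p ^ k := Nat.le_mul_of_pos_left _ hj0
          rw [Nat.sub_mul, one_mul]
          omega
      rw [him, add_sub_right_comm]
      exact add_mem h2 h4

end Triangular

/-! ### Identities in ℤ[q] from δ(q) = δ(q^p) = 0 -/

section QIdentities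

variable (p : ℕ) [hp : Fact p.Prime]

theorem delta_X_pow (n : ℕ) : δ p (X ^ n : ℤ[X]) = 0 := by
  have hp0 : (p : ℤ[X]) ≠ 0 := Nat.cast_ne_zero.2 hp.out.ne_zero
  refine mul_left_cancel₀ hp0 ?_
  refine (deltaIntPoly_spec p _).trans ?_
  rw [map_pow, expand_X, mul_zero]
  ring

theorem cross_qμ_mul_one (x : ℤ[X]) : cross p (qμ * x) 1
    = qμ * ∑ ν ∈ Finset.Ico 1 p, ((p.choose ν / p : ℕ) : ℤ[X]) * qμ ^ (ν - 1) * x ^ ν := by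
  rw [cross, Finset.mul_sum]
  refine Finset.sum_congr rfl fun ν hν => ?_
  rw [Finset.mem_Ico] at hν
  obtain ⟨n, rfl⟩ : ∃ n, ν = n + 1 := ⟨ν - 1, by omega⟩
  rw [Nat.add_sub_cancel]
  ring

/-- This is the sum rule for δ(μ + 1) = δ(q) = 0. -/
theorem delta_qμ : δ p qμ = qη p * qμ := by
  have h := DeltaRing.δ_add (p := p) qμ (1 : ℤ[X])
  have e : qμ + 1 = X ^ 1 := by rw [qμ]; ring
  rw [e, delta_X_pow, DeltaRing.δ_one, ← mul_one qμ, cross_qμ_mul_one, mul_one] at h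
  have e2 : qη p = ∑ ν ∈ Finset.Ico 1 p, ((p.choose ν / p : ℕ) : ℤ[X]) * qμ ^ (ν - 1) * 1 ^ ν := by
    simp [qη]
  rw [e2]
  linear_combination -h

/-- Since μ[p]_q + 1 = q^p, the sum and product rules expand δ(q^p) = 0 into μ times the identity,
and μ can be cancelled in ℤ[q]. It is the vanishing of the ε-coefficient of δ(t + [p]_q ε) with the
powers of t removed. -/
theorem qη_identity : (qμ ^ (p - 1) + p * qη p) * δ p (qNum p) + qη p * qNum p ^ p
    - ∑ ν ∈ Finset.Ico 1 p,
      ((p.choose ν / p : ℕ) : ℤ[X]) * qμ ^ (ν - 1) * qNum p ^ ν = 0 := by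
  have hμ : qμ ≠ 0 := by rw [qμ, ← C_1]; exact X_sub_C_ne_zero 1
  refine mul_left_cancel₀ hμ ?_
  have h := DeltaRing.δ_add (p := p) (qμ * qNum p) (1 : ℤ[X])
  have e : qμ * qNum p + 1 = X ^ p := by
    have h2 : qNum p * qμ = X ^ p - 1 := geom_sum_mul X p
    rw [mul_comm, h2]; ring
  rw [e, delta_X_pow, DeltaRing.δ_one, cross_qμ_mul_one, DeltaRing.δ_mul, delta_qμ] at h
  have := mul_pow_sub_one hp.out.ne_zero qμ
  linear_combination -h + δ p (qNum p) * this

end QIdentities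

/-! ### The shifted generators τ_j + [j = i]ε and the graph property -/

section Shift

variable {p : ℕ} [hp : Fact p.Prime] {R B : Type*} [CommRing R] [DeltaRing p R]
  [CommRing B] [DeltaRing p B] [Algebra R B] [IsDeltaAlgebra p R B]
  [Algebra ℤ[X] R] [IsDeltaAlgebra p ℤ[X] R]

/-- The element `t μ`. -/
def shiftParam (R : Type*) {B : Type*} [CommRing R] [CommRing B] [Algebra R B] [Algebra ℤ[X] R]
    (t : B) : B := t * algebraMap R B (qElt R qμ)

/-- The element `t^(p-1) η`. -/
def shiftEta (p : ℕ) (R : Type*) {B : Type*} [CommRing R] [CommRing B] [Algebra R B]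
    [Algebra ℤ[X] R] (t : B) : B := t ^ (p - 1) * algebraMap R B (qElt R (qη p))

theorem delta_shiftParam {t : B} (ht : δ p t = 0) :
    δ p (shiftParam R t) = shiftEta p R t * shiftParam R t := by
  rw [shiftParam, shiftEta, DeltaRing.δ_mul, ht, ← algebraMap_qElt_δ, delta_qμ, qElt, qElt, qElt,
    map_mul, map_mul, ← mul_pow_sub_one hp.out.ne_zero t]
  ring

/-- The coefficient of `ε` in `δ(t + [p]_q ε)` vanishes. -/
theorem deltaCoeff_qNum_sub_eq_zero (t : B) :
    TwEps.deltaCoeff p (shiftParam R t) (shiftEta p R t) (algebraMap R B (qElt R (qNum p)))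
      - ∑ ν ∈ Finset.Ico 1 p, ((p.choose ν / p : ℕ) : B) * t ^ (p - ν)
        * shiftParam R t ^ (ν - 1) * algebraMap R B (qElt R (qNum p)) ^ ν = 0 := by
  set φ : ℤ[X] →+* B := (algebraMap R B).comp (algebraMap ℤ[X] R)
  have h := congrArg φ (qη_identity p)
  rw [map_zero, map_sub, map_sum, map_add, map_mul, map_mul, map_add, map_mul, map_pow, map_pow,
    map_natCast] at h
  have hδ : φ (δ p (qNum p)) = δ p (φ (qNum p)) := algebraMap_qElt_δ _
  -- Every summand has degree (p - ν) + (ν - 1) = p - 1 in t, so t^(p-1) factors out and an identity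
  -- from ℤ[q] remains.
  have hsum : ∑ ν ∈ Finset.Ico 1 p, ((p.choose ν / p : ℕ) : B) * t ^ (p - ν)
        * (t * φ qμ) ^ (ν - 1) * φ (qNum p) ^ ν
      = t ^ (p - 1) * ∑ ν ∈ Finset.Ico 1 p, φ (((p.choose ν / p : ℕ) : ℤ[X]) * qμ ^ (ν - 1)
        * qNum p ^ ν) := by
    rw [Finset.mul_sum]
    refine Finset.sum_congr rfl fun ν hν => ?_
    rw [Finset.mem_Ico] at hν
    rw [map_mul, map_mul, map_pow, map_pow, map_natCast,
      show t ^ (p - 1) = t ^ (p - ν) * t ^ (ν - 1) by rw [← pow_add]; congr 1; omega, mul_pow]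
    ring
  change ((t * φ qμ) ^ (p - 1) + p * (t ^ (p - 1) * φ (qη p))) * δ p (φ (qNum p))
    + (t ^ (p - 1) * φ (qη p)) * φ (qNum p) ^ p - ∑ ν ∈ Finset.Ico 1 p,
      ((p.choose ν / p : ℕ) : B) * t ^ (p - ν) * (t * φ qμ) ^ (ν - 1) * φ (qNum p) ^ ν = 0
  rw [hsum, ← hδ, mul_pow]
  linear_combination t ^ (p - 1) * h

variable {t₀ : B} [DeltaRing p (TwEps (shiftParam R t₀))]

/-- The δ-structure on the twisted square is an instance variable which `hE` identifies with
`TwEps.delta`; it is instantiated by `TwEps.deltaRing` in `exists_commuting_derivations`. -/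
theorem isDeltaAlgebra_twEps
    (hE : ∀ x : TwEps (shiftParam R t₀), δ p x = TwEps.delta p _ (shiftEta p R t₀) x) :
    IsDeltaAlgebra p R (TwEps (shiftParam R t₀)) :=
  ⟨fun x => by
    change algebraMap B _ (algebraMap R B (δ p x)) = δ p (algebraMap B _ (algebraMap R B x))
    rw [hE, TwEps.delta_algebraMap, IsDeltaAlgebra.algebraMap_δ]⟩

theorem iterate_delta_re
    (hE : ∀ x : TwEps (shiftParam R t₀), δ p x = TwEps.delta p _ (shiftEta p R t₀) x) (k : ℕ)
    (x : TwEps (shiftParam R t₀)) : ((δ p)^[k] x).re = (δ p)^[k] x.re := by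
  induction k with
  | zero => rfl
  | succ k ih =>
    rw [Function.iterate_succ_apply', Function.iterate_succ_apply', hE, TwEps.delta_re, ih]

theorem iterate_delta_algebraMap
    (hE : ∀ x : TwEps (shiftParam R t₀), δ p x = TwEps.delta p _ (shiftEta p R t₀) x) (k : ℕ)
    (x : B) : (δ p)^[k] (algebraMap B (TwEps (shiftParam R t₀)) x)
      = algebraMap B _ ((δ p)^[k] x) := by
  induction k with
  | zero => rfl
  | succ k ih =>
    rw [Function.iterate_succ_apply', Function.iterate_succ_apply', ih, hE, TwEps.delta_algebraMap]

theorem deltaPow_re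
    (hE : ∀ x : TwEps (shiftParam R t₀), δ p x = TwEps.delta p _ (shiftEta p R t₀) x)
    (x : TwEps (shiftParam R t₀)) (m : ℕ) : (deltaPow p x m).re = deltaPow p x.re m := by
  rw [deltaPow_eq_digitProd, deltaPow_eq_digitProd]
  refine (map_digitProd p (TwEps.reHom (shiftParam R t₀)) _ m).trans ?_
  congr 1
  funext k
  exact iterate_delta_re hE k x

theorem deltaPow_algebraMap
    (hE : ∀ x : TwEps (shiftParam R t₀), δ p x = TwEps.delta p _ (shiftEta p R t₀) x)
    (x : B) (m : ℕ) : deltaPow p (algebraMap B (TwEps (shiftParam R t₀)) x) m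
      = algebraMap B _ (deltaPow p x m) := by
  rw [deltaPow_eq_digitProd, deltaPow_eq_digitProd, map_digitProd]
  congr 1
  funext k
  exact iterate_delta_algebraMap hE k x

/-- The element `τ + [j = i] ε`. -/
def shiftGen (R : Type*) {B ι : Type*} [CommRing R] [CommRing B] [Algebra R B] [Algebra ℤ[X] R]
    [DecidableEq ι] (t₀ : B) (τ : ι → B) (i j : ι) : TwEps (shiftParam R t₀) :=
  algebraMap B _ (τ j) + TwEps.eps _ (Pi.single (M := fun _ => B) i 1 j)

variable {ι : Type*} [Fintype ι] [DecidableEq ι] {τ t : ι → B} {a : ι → R} {i : ι}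

theorem shiftGen_re (j : ι) : (shiftGen R t₀ τ i j).re = τ j := by
  simp [shiftGen, TwEps.eps]

theorem shiftGen_of_ne {j : ι} (h : j ≠ i) : shiftGen R t₀ τ i j = algebraMap B _ (τ j) := by
  rw [shiftGen, Pi.single_eq_of_ne h]
  ext <;> simp [TwEps.eps]

theorem shiftGen_im_self : (shiftGen R t₀ τ i i).im = 1 := by
  simp [shiftGen, TwEps.eps]

/-- For j = i the argument of δ is t_i + [p]_q ε, and for j ≠ i it is t_j. So the shifted generators
obey the same relation as the τ_j, and the results on spanning by δ-monomials apply to them. -/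
theorem delta_shiftGen_relation
    (hE : ∀ x : TwEps (shiftParam R t₀), δ p x = TwEps.delta p _ (shiftEta p R t₀) x)
    (hτ : ∀ j, algebraMap R B (qElt R (qNum p)) * τ j + algebraMap R B (a j) = t j)
    (ht : ∀ j, δ p (t j) = 0) (hi : t₀ = t i) (j : ι) :
    δ p (algebraMap R (TwEps (shiftParam R t₀)) (qElt R (qNum p)) * shiftGen R t₀ τ i j
      + algebraMap R (TwEps (shiftParam R t₀)) (a j)) = 0 := by
  have e : algebraMap R (TwEps (shiftParam R t₀)) (qElt R (qNum p)) * shiftGen R t₀ τ i j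
      + algebraMap R (TwEps (shiftParam R t₀)) (a j)
      = algebraMap B _ (t j) + TwEps.eps _ (algebraMap R B (qElt R (qNum p))
        * Pi.single (M := fun _ => B) i 1 j) := by
    change algebraMap B _ (algebraMap R B (qElt R (qNum p))) * shiftGen R t₀ τ i j
      + algebraMap B _ (algebraMap R B (a j)) = _
    rw [shiftGen, mul_add, TwEps.algebraMap_mul_eps, ← map_mul, add_right_comm, ← map_add, hτ]
  rw [e, hE]
  by_cases hj : j = i
  · subst hj
    rw [Pi.single_eq_same, mul_one]
    have h1 : (algebraMap B (TwEps (shiftParam R t₀)) (t j)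
        + TwEps.eps _ (algebraMap R B (qElt R (qNum p)))).re = t j := by simp [TwEps.eps]
    have h2 : (algebraMap B (TwEps (shiftParam R t₀)) (t j)
        + TwEps.eps _ (algebraMap R B (qElt R (qNum p)))).im
          = algebraMap R B (qElt R (qNum p)) := by simp [TwEps.eps]
    rw [QuadraticAlgebra.ext_iff, TwEps.delta_re, TwEps.delta_im, h1, h2]
    refine ⟨ht j, ?_⟩
    rw [← hi]
    exact deltaCoeff_qNum_sub_eq_zero (p := p) (R := R) t₀
  · have h0 : TwEps.eps (shiftParam R t₀) 0 = 0 := rfl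
    rw [Pi.single_eq_of_ne hj, mul_zero, h0, add_zero, TwEps.delta_algebraMap, ht, map_zero]

/-- The imaginary part as an `R`-linear map. -/
def TwEps.imₗ (R : Type*) {B : Type*} [CommRing R] [CommRing B] [Algebra R B] (α : B) :
    TwEps α →ₗ[R] B where
  toFun x := x.im
  map_add' _ _ := rfl
  map_smul' _ _ := rfl

/-- The real part as an `R`-linear map. -/
def TwEps.reₗ (R : Type*) {B : Type*} [CommRing R] [CommRing B] [Algebra R B] (α : B) :
    TwEps α →ₗ[R] B where
  toFun x := x.re
  map_add' _ _ := rfl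
  map_smul' _ _ := rfl

theorem prod_deltaPow_shiftGen_re
    (hE : ∀ x : TwEps (shiftParam R t₀), δ p x = TwEps.delta p _ (shiftEta p R t₀) x)
    (m : ι → ℕ) : (∏ j, deltaPow p (shiftGen R t₀ τ i j) (m j)).re
      = ∏ j, deltaPow p (τ j) (m j) := by
  refine (map_prod (TwEps.reHom (shiftParam R t₀)) _ _).trans (Finset.prod_congr rfl fun j _ => ?_)
  refine (deltaPow_re hE _ _).trans ?_
  rw [shiftGen_re]

/-- The derivation is well defined modulo `I^n`. -/
theorem im_mem_of_re_mem
    (hE : ∀ x : TwEps (shiftParam R t₀), δ p x = TwEps.delta p _ (shiftEta p R t₀) x)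
    (hτ : ∀ j, algebraMap R B (qElt R (qNum p)) * τ j + algebraMap R B (a j) = t j)
    (ht : ∀ j, δ p (t j) = 0) (hi : t₀ = t i) {n : ℕ}
    (hind : ∀ c : (ι → ℕ) →₀ R, Finsupp.linearCombination R
      (fun m : ι → ℕ => ∏ j, deltaPow p (τ j) (m j)) c ∈ (qIdeal p R ^ n • ⊤ : Submodule R B) →
      ∀ m, c m ∈ qIdeal p R ^ n)
    {g : TwEps (shiftParam R t₀)} (hg : g ∈ deltaAdjoin p R (shiftGen R t₀ τ i))
    (hre : g.re ∈ (qIdeal p R ^ n • ⊤ : Submodule R B)) :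
    g.im ∈ (qIdeal p R ^ n • ⊤ : Submodule R B) := by
  have := isDeltaAlgebra_twEps hE
  have h1 := deltaAdjoin_le (delta_shiftGen_relation hE hτ ht hi) n hg
  have hle : ∀ f : TwEps (shiftParam R t₀) →ₗ[R] B, ∀ z ∈ qIdeal p R ^ n •
      Subalgebra.toSubmodule (deltaAdjoin p R (shiftGen R t₀ τ i)),
      f z ∈ (qIdeal p R ^ n • ⊤ : Submodule R B) := by
    intro f z hz
    have h := Submodule.mem_map_of_mem (f := f) hz
    rw [Submodule.map_smul''] at h
    exact Submodule.smul_mono le_rfl le_top h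
  obtain ⟨y, hy, z, hz, rfl⟩ := Submodule.mem_sup.1 h1
  obtain ⟨c, rfl⟩ := (Finsupp.mem_span_range_iff_exists_finsupp).1 hy
  have hyre : (c.sum fun m r => r • ∏ j, deltaPow p (shiftGen R t₀ τ i j) (m j)).re
      = Finsupp.linearCombination R (fun m : ι → ℕ => ∏ j, deltaPow p (τ j) (m j)) c := by
    refine (map_finsuppSum (TwEps.reₗ R _) _ _).trans ?_
    rw [Finsupp.linearCombination_apply]
    refine Finsupp.sum_congr fun m _ => ?_
    rw [map_smul]
    congr 1
    exact prod_deltaPow_shiftGen_re hE m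
  -- The real part of g is the same combination of the original monomials, up to I^n B. Independence
  -- then forces the coefficients into I^n, and the imaginary part follows.
  have hc := hind c (by
    rw [← hyre, ← add_sub_cancel_right (QuadraticAlgebra.re _) z.re]
    exact sub_mem hre (hle (TwEps.reₗ R _) z hz))
  rw [QuadraticAlgebra.im_add]
  refine add_mem ?_ (hle (TwEps.imₗ R _) z hz)
  have : (c.sum fun m r => r • ∏ j, deltaPow p (shiftGen R t₀ τ i j) (m j)).im
      = c.sum fun m r => r • (∏ j, deltaPow p (shiftGen R t₀ τ i j) (m j)).im :=
    map_finsuppSum (TwEps.imₗ R _) _ _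
  rw [this]
  exact sum_mem fun m _ => Submodule.smul_mem_smul (hc m) trivial

/-- The subalgebra generated by the elements `δ^k(τ)`. -/
abbrev deltaAdjoinOne (p : ℕ) (R : Type*) {B : Type*} [CommRing R] [CommRing B] [DeltaRing p B]
    [Algebra R B] (τ : B) : Subalgebra R B := deltaAdjoin p R fun _ : Unit => τ

/-- As t_i = [p]_q τ_i + a_i, the parameters α and β already lie in the algebra generated by the
δ^k(τ_i), so all coordinates stay in it. This is why θ_i acts on the i-th index alone. -/
theorem deltaPow_shiftGen_im_mem
    (hE : ∀ x : TwEps (shiftParam R t₀), δ p x = TwEps.delta p _ (shiftEta p R t₀) x)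
    (hτ : ∀ j, algebraMap R B (qElt R (qNum p)) * τ j + algebraMap R B (a j) = t j)
    (hi : t₀ = t i) (m : ℕ) :
    (deltaPow p (shiftGen R t₀ τ i i) m).im ∈ deltaAdjoinOne p R (τ i) := by
  have := isDeltaAlgebra_twEps hE
  set S := deltaAdjoinOne p R (τ i)
  have hSδ : ∀ x ∈ S, δ p x ∈ S := fun x hx => delta_mem_deltaAdjoin _ hx
  have hτS : τ i ∈ S := mem_deltaAdjoin (fun _ : Unit => τ i) ()
  have htS : t₀ ∈ S := by
    rw [hi, ← hτ]
    exact add_mem (mul_mem (Subalgebra.algebraMap_mem _ _) hτS) (Subalgebra.algebraMap_mem _ _)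
  have hα : shiftParam R t₀ ∈ S := mul_mem htS (Subalgebra.algebraMap_mem _ _)
  have hβ : shiftEta p R t₀ ∈ S := mul_mem (pow_mem htS _) (Subalgebra.algebraMap_mem _ _)
  have hgen : ∀ k, ((δ p)^[k] (shiftGen R t₀ τ i i)).re ∈ S ∧
      ((δ p)^[k] (shiftGen R t₀ τ i i)).im ∈ S := by
    intro k
    induction k with
    | zero =>
      rw [Function.iterate_zero_apply, shiftGen_re, shiftGen_im_self]
      exact ⟨hτS, one_mem _⟩
    | succ k ih =>
      rw [Function.iterate_succ_apply', hE, TwEps.delta_re, TwEps.delta_im]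
      refine ⟨hSδ _ ih.1, sub_mem (add_mem (mul_mem (add_mem (pow_mem hα _)
        (mul_mem (natCast_mem _ _) hβ)) (hSδ _ ih.2)) (mul_mem hβ (pow_mem ih.2 _))) ?_⟩
      exact sum_mem fun ν _ => mul_mem (mul_mem (mul_mem (natCast_mem _ _) (pow_mem ih.1 _))
        (pow_mem hα _)) (pow_mem ih.2 _)
  let P : Submonoid (TwEps (shiftParam R t₀)) :=
    { carrier := {x | x.re ∈ S ∧ x.im ∈ S}
      one_mem' := ⟨one_mem S, zero_mem S⟩
      mul_mem' := by
        rintro x y ⟨hx, hx'⟩ ⟨hy, hy'⟩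
        refine ⟨?_, ?_⟩
        · rw [QuadraticAlgebra.re_mul]
          exact add_mem (mul_mem hx hy) (mul_mem (mul_mem (zero_mem S) hx') hy')
        · rw [QuadraticAlgebra.im_mul]
          exact add_mem (add_mem (mul_mem hx hy') (mul_mem hx' hy))
            (mul_mem (mul_mem hα hx') hy') }
  have hP : deltaPow p (shiftGen R t₀ τ i i) m ∈ P :=
    Submonoid.prod_mem P fun k _ => Submonoid.pow_mem P (hgen k) _
  exact hP.2

theorem prod_deltaPow_shiftGen_im
    (hE : ∀ x : TwEps (shiftParam R t₀), δ p x = TwEps.delta p _ (shiftEta p R t₀) x)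
    (m : ι → ℕ) : (∏ j, deltaPow p (shiftGen R t₀ τ i j) (m j)).im
      = (∏ j ∈ Finset.univ.erase i, deltaPow p (τ j) (m j))
        * (deltaPow p (shiftGen R t₀ τ i i) (m i)).im := by
  rw [← Finset.prod_erase_mul _ _ (Finset.mem_univ i)]
  have h : ∏ j ∈ Finset.univ.erase i, deltaPow p (shiftGen R t₀ τ i j) (m j)
      = algebraMap B _ (∏ j ∈ Finset.univ.erase i, deltaPow p (τ j) (m j)) := by
    rw [map_prod]
    refine Finset.prod_congr rfl fun j hj => ?_
    rw [shiftGen_of_ne (Finset.ne_of_mem_erase hj), deltaPow_algebraMap hE]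
  rw [h, QuadraticAlgebra.im_mul, QuadraticAlgebra.algebraMap_re, QuadraticAlgebra.algebraMap_im]
  ring

end Shift

/-! ### Projections from the adic completion -/

section AdicGeneral

variable {R B : Type*} [CommRing R] [CommRing B] [Algebra R B] (I : Ideal R)

/-- The projection from the completion to the `n`-th quotient, as a ring homomorphism. -/
def valHom (K : Ideal B) (n : ℕ) : AdicCompletion K B →+* B ⧸ (K ^ n • ⊤ : Ideal B) :=
  (Pi.evalRingHom (fun n => B ⧸ (K ^ n • ⊤ : Ideal B)) n).comp (AdicCompletion.subring K).subtype

theorem valHom_apply (K : Ideal B) (n : ℕ) (x : AdicCompletion K B) : valHom K n x = x.val n := rfl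

theorem valHom_algebraMap (K : Ideal B) (n : ℕ) (b : B) :
    valHom K n (algebraMap B _ b) = Ideal.Quotient.mk _ b := rfl

theorem valHom_smul (K : Ideal B) (n : ℕ) (r : R) (x : AdicCompletion K B) :
    valHom K n (r • x) = r • valHom K n x := rfl

theorem mem_map_pow_smul_top {n : ℕ} {x : B} :
    x ∈ ((I.map (algebraMap R B)) ^ n • ⊤ : Ideal B) ↔ x ∈ (I ^ n • ⊤ : Submodule R B) := by
  rw [smul_eq_mul, Ideal.mul_top, ← Ideal.map_pow, Ideal.smul_top_eq_map]
  rfl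

theorem smul_quotient_eq_zero {n : ℕ} {r : R} (hr : r ∈ I ^ n)
    (y : B ⧸ ((I.map (algebraMap R B)) ^ n • ⊤ : Ideal B)) : r • y = 0 := by
  obtain ⟨b, rfl⟩ := Ideal.Quotient.mk_surjective y
  change Ideal.Quotient.mk _ (r • b) = 0
  rw [Ideal.Quotient.eq_zero_iff_mem, mem_map_pow_smul_top]
  exact Submodule.smul_mem_smul hr trivial

/-- For finitely generated I the kernel of the n-th projection is I^n times the completion. This
description uses the R-module structure alone, so R-linear maps are automatically continuous. -/
theorem valHom_eq_zero_iff (hI : I.FG) (n : ℕ)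
    (x : AdicCompletion (I.map (algebraMap R B)) B) :
    valHom _ n x = 0 ↔
      x ∈ (I ^ n • ⊤ : Submodule R (AdicCompletion (I.map (algebraMap R B)) B)) := by
  constructor
  · intro hx
    have h1 : x ∈ ((I.map (algebraMap R B)) ^ n • ⊤ :
        Submodule B (AdicCompletion (I.map (algebraMap R B)) B)) := by
      rw [AdicCompletion.pow_smul_top_eq_ker_eval (hI.map _)]
      exact hx
    refine Submodule.smul_induction_on h1 ?_ fun a b ha hb => add_mem ha hb
    intro k hk z _
    have hk' : k ∈ (I ^ n • ⊤ : Submodule R B) := by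
      rw [← mem_map_pow_smul_top]
      simpa using hk
    refine Submodule.smul_induction_on hk' ?_ ?_
    · intro r hr b _
      rw [smul_assoc]
      exact Submodule.smul_mem_smul hr trivial
    · intro a b ha hb
      rw [add_smul]
      exact add_mem ha hb
  · intro hx
    refine Submodule.smul_induction_on hx ?_ ?_
    · intro r hr z _
      rw [valHom_smul, smul_quotient_eq_zero I hr]
    · intro a b ha hb
      rw [map_add, ha, hb, add_zero]

theorem valHom_ext {K : Ideal B} {x y : AdicCompletion K B}
    (h : ∀ n, valHom K n x = valHom K n y) : x = y :=
  Subtype.ext (funext h)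

theorem valHom_eq_of_succ {K : Ideal B} {n : ℕ} {x : AdicCompletion K B} {b : B}
    (h : valHom K (n + 1) x = Ideal.Quotient.mk _ b) : valHom K n x = Ideal.Quotient.mk _ b := by
  rw [valHom_apply, val_eq_transition, ← valHom_apply, h]
  rfl

/-- An `R`-linear endomorphism preserves the kernels of the projections. -/
theorem valHom_map_eq_zero (hI : I.FG) {n : ℕ}
    (θ : AdicCompletion (I.map (algebraMap R B)) B →ₗ[R] AdicCompletion (I.map (algebraMap R B)) B)
    {x : AdicCompletion (I.map (algebraMap R B)) B} (hx : valHom _ n x = 0) :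
    valHom _ n (θ x) = 0 := by
  rw [valHom_eq_zero_iff I hI] at hx ⊢
  have h := Submodule.mem_map_of_mem (f := θ) hx
  rw [Submodule.map_smul''] at h
  exact Submodule.smul_mono le_rfl le_top h

end AdicGeneral

/-! ### Existence and uniqueness of the twisted derivations -/

section Construction

variable {p : ℕ} [hp : Fact p.Prime] {R B : Type*} [CommRing R] [DeltaRing p R]
  [CommRing B] [DeltaRing p B] [Algebra R B] [IsDeltaAlgebra p R B]
  [Algebra ℤ[X] R] [IsDeltaAlgebra p ℤ[X] R]

/-- For every `n`, the products `∏_i τ_i^{m_i}_δ` form a basis modulo `I^n`. -/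
structure IsDeltaBasis (p : ℕ) (R : Type*) {B ι : Type*} [CommRing R] [CommRing B] [DeltaRing p B]
    [Algebra R B] [Algebra ℤ[X] R] [Fintype ι] (τ : ι → B) : Prop where
  span : ∀ (n : ℕ) (x : B), ∃ c : (ι → ℕ) →₀ R, x - Finsupp.linearCombination R
      (fun m : ι → ℕ => ∏ j, deltaPow p (τ j) (m j)) c ∈ (qIdeal p R ^ n • ⊤ : Submodule R B)
  indep : ∀ (n : ℕ) (c : (ι → ℕ) →₀ R), Finsupp.linearCombination R
      (fun m : ι → ℕ => ∏ j, deltaPow p (τ j) (m j)) c ∈ (qIdeal p R ^ n • ⊤ : Submodule R B) →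
      ∀ m, c m ∈ qIdeal p R ^ n

theorem qIdeal_fg : (qIdeal p R).FG :=
  Submodule.fg_span (Set.toFinite _)

variable {ι : Type*} [Fintype ι] [DecidableEq ι] {τ t : ι → B} {a : ι → R} {i : ι}
  {t₀ : B} [DeltaRing p (TwEps (shiftParam R t₀))]

/-- The ideal of `B` generated by `I`. -/
abbrev qIdealMap (p : ℕ) (R B : Type*) [CommRing R] [CommRing B] [Algebra R B] [Algebra ℤ[X] R] :
    Ideal B := (qIdeal p R).map (algebraMap R B)

theorem exists_mem_deltaAdjoin_re
    (hE : ∀ x : TwEps (shiftParam R t₀), δ p x = TwEps.delta p _ (shiftEta p R t₀) x)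
    (hb : IsDeltaBasis p R τ) (i : ι) (n : ℕ) (y : B ⧸ (qIdealMap p R B ^ n • ⊤ : Ideal B)) :
    ∃ g ∈ deltaAdjoin p R (shiftGen R t₀ τ i), y = Ideal.Quotient.mk _ g.re := by
  have := isDeltaAlgebra_twEps hE
  obtain ⟨b, rfl⟩ := Ideal.Quotient.mk_surjective y
  obtain ⟨c, hc⟩ := hb.span n b
  -- The same coefficients are placed on the shifted monomials, whose real parts are the original
  -- ones.
  refine ⟨Finsupp.linearCombination R
    (fun m : ι → ℕ => ∏ j, deltaPow p (shiftGen R t₀ τ i j) (m j)) c, ?_, ?_⟩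
  · rw [Finsupp.linearCombination_apply]
    exact sum_mem fun m _ => Subalgebra.smul_mem _ (prod_deltaPow_mem_deltaAdjoin _ m) _
  · have e : (Finsupp.linearCombination R
        (fun m : ι → ℕ => ∏ j, deltaPow p (shiftGen R t₀ τ i j) (m j)) c).re
        = Finsupp.linearCombination R (fun m : ι → ℕ => ∏ j, deltaPow p (τ j) (m j)) c := by
      refine (Finsupp.apply_linearCombination R (TwEps.reₗ R _) _ c).trans ?_
      congr 2
      funext m
      exact prod_deltaPow_shiftGen_re hE m
    rw [e, Ideal.Quotient.eq, mem_map_pow_smul_top]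
    exact hc

/-- On the algebra G of shifted generators the real part is surjective modulo I^n, and the imaginary
part vanishes modulo I^n wherever the real part does; so im factors through re. -/
theorem exists_quotient_derivation
    (hE : ∀ x : TwEps (shiftParam R t₀), δ p x = TwEps.delta p _ (shiftEta p R t₀) x)
    (hτ : ∀ j, algebraMap R B (qElt R (qNum p)) * τ j + algebraMap R B (a j) = t j)
    (ht : ∀ j, δ p (t j) = 0) (hi : t₀ = t i) (hb : IsDeltaBasis p R τ) (n : ℕ) :
    ∃ θ : (B ⧸ (qIdealMap p R B ^ n • ⊤ : Ideal B)) →ₗ[R]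
        (B ⧸ (qIdealMap p R B ^ n • ⊤ : Ideal B)),
      ∀ g ∈ deltaAdjoin p R (shiftGen R t₀ τ i),
        θ (Ideal.Quotient.mk _ g.re) = Ideal.Quotient.mk _ g.im := by
  set G := deltaAdjoin p R (shiftGen R t₀ τ i)
  set q : B →ₗ[R] B ⧸ (qIdealMap p R B ^ n • ⊤ : Ideal B) :=
    (Ideal.Quotient.mkₐ R (qIdealMap p R B ^ n • ⊤ : Ideal B)).toLinearMap
  let f : G →ₗ[R] B ⧸ (qIdealMap p R B ^ n • ⊤ : Ideal B) :=
    q ∘ₗ TwEps.reₗ R _ ∘ₗ G.val.toLinearMap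
  let h : G →ₗ[R] B ⧸ (qIdealMap p R B ^ n • ⊤ : Ideal B) :=
    q ∘ₗ TwEps.imₗ R _ ∘ₗ G.val.toLinearMap
  have hf : Function.Surjective f := fun y => by
    obtain ⟨g, hg, rfl⟩ := exists_mem_deltaAdjoin_re hE hb i n y
    exact ⟨⟨g, hg⟩, rfl⟩
  have hker : LinearMap.ker f ≤ LinearMap.ker h := by
    rintro ⟨g, hg⟩ hgf
    have h1 : Ideal.Quotient.mk (qIdealMap p R B ^ n • ⊤ : Ideal B) g.re = 0 := hgf
    rw [Ideal.Quotient.eq_zero_iff_mem, mem_map_pow_smul_top] at h1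
    have h2 := im_mem_of_re_mem hE hτ ht hi (hb.indep n) hg h1
    rw [← mem_map_pow_smul_top, ← Ideal.Quotient.eq_zero_iff_mem] at h2
    exact h2
  refine ⟨(LinearMap.ker f).liftQ h hker ∘ₗ (f.quotKerEquivOfSurjective hf).symm.toLinearMap, ?_⟩
  intro g hg
  have e : (f.quotKerEquivOfSurjective hf).symm (f ⟨g, hg⟩)
      = (LinearMap.ker f).mkQ ⟨g, hg⟩ := by
    rw [LinearEquiv.symm_apply_eq]; rfl
  change (LinearMap.ker f).liftQ h hker ((f.quotKerEquivOfSurjective hf).symm (f ⟨g, hg⟩)) = _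
  rw [e]
  rfl

/-- The maps modulo I^n are glued. The characterisation by all elements of G reduces the later
identities for θ to computations in the twisted square. -/
theorem exists_derivation
    (hE : ∀ x : TwEps (shiftParam R t₀), δ p x = TwEps.delta p _ (shiftEta p R t₀) x)
    (hτ : ∀ j, algebraMap R B (qElt R (qNum p)) * τ j + algebraMap R B (a j) = t j)
    (ht : ∀ j, δ p (t j) = 0) (hi : t₀ = t i) (hb : IsDeltaBasis p R τ) :
    ∃ θ : AdicCompletion (qIdealMap p R B) B →ₗ[R] AdicCompletion (qIdealMap p R B) B,
      ∀ n x, ∀ g ∈ deltaAdjoin p R (shiftGen R t₀ τ i),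
        valHom _ n x = Ideal.Quotient.mk _ g.re → valHom _ n (θ x) = Ideal.Quotient.mk _ g.im := by
  choose θ hθ using exists_quotient_derivation hE hτ ht hi hb
  refine ⟨{ toFun := fun x => ⟨fun n => θ n (x.val n), ?_⟩, map_add' := ?_, map_smul' := ?_ }, ?_⟩
  · intro m n hmn
    obtain ⟨g, hg, hx⟩ := exists_mem_deltaAdjoin_re hE hb i n (x.val n)
    have hx' : x.val m = Ideal.Quotient.mk _ g.re := by
      have := x.property hmn
      change AdicCompletion.transitionMap _ B hmn (x.val n) = x.val m at this
      rw [← this, hx]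
      rfl
    change AdicCompletion.transitionMap _ B hmn (θ n (x.val n)) = θ m (x.val m)
    rw [hx, hx', hθ n g hg, hθ m g hg]
    rfl
  · intro x y
    exact valHom_ext fun n => map_add (θ n) (x.val n) (y.val n)
  · intro r x
    exact valHom_ext fun n => map_smul (θ n) r (x.val n)
  · intro n x g hg hx
    change θ n (x.val n) = _
    rw [show x.val n = Ideal.Quotient.mk _ g.re from hx, hθ n g hg]

variable {θ : AdicCompletion (qIdealMap p R B) B →ₗ[R] AdicCompletion (qIdealMap p R B) B}

theorem derivation_algebraMap {g : TwEps (shiftParam R t₀)}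
    (hg : g ∈ deltaAdjoin p R (shiftGen R t₀ τ i))
    (hθ : ∀ n x, ∀ g ∈ deltaAdjoin p R (shiftGen R t₀ τ i),
        valHom _ n x = Ideal.Quotient.mk _ g.re → valHom _ n (θ x) = Ideal.Quotient.mk _ g.im) :
    θ (algebraMap B _ g.re) = algebraMap B _ g.im :=
  valHom_ext fun n => hθ n _ g hg rfl

/-- G is closed under products, and the ε-coefficient of a product in the twisted square is the
twisted Leibniz rule. -/
theorem isTwistedDerivation_of_quotient
    (hE : ∀ x : TwEps (shiftParam R t₀), δ p x = TwEps.delta p _ (shiftEta p R t₀) x)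
    (hb : IsDeltaBasis p R τ)
    (hθ : ∀ n x, ∀ g ∈ deltaAdjoin p R (shiftGen R t₀ τ i),
        valHom _ n x = Ideal.Quotient.mk _ g.re → valHom _ n (θ x) = Ideal.Quotient.mk _ g.im) :
    IsTwistedDerivation (algebraMap B _ (shiftParam R t₀)) θ where
  map_one := by
    have := derivation_algebraMap (one_mem _) hθ
    rwa [QuadraticAlgebra.re_one, QuadraticAlgebra.im_one, map_one, map_zero] at this
  map_mul x y := valHom_ext fun n => by
    obtain ⟨g, hg, hx⟩ := exists_mem_deltaAdjoin_re hE hb i n (valHom _ n x)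
    obtain ⟨h, hh, hy⟩ := exists_mem_deltaAdjoin_re hE hb i n (valHom _ n y)
    have hxy : valHom _ n (x * y) = Ideal.Quotient.mk _ (g * h).re := by
      rw [map_mul, hx, hy, QuadraticAlgebra.re_mul, zero_mul, zero_mul, add_zero, map_mul]
    rw [hθ n _ _ (mul_mem hg hh) hxy, map_add, map_add, map_mul, map_mul, map_mul, map_mul,
      hθ n _ _ hg hx, hθ n _ _ hh hy, valHom_algebraMap, hx, hy, QuadraticAlgebra.im_mul, map_add,
      map_add, map_mul, map_mul, map_mul, map_mul]
    ring

theorem isDeltaCompatible_of_quotient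
    (hE : ∀ x : TwEps (shiftParam R t₀), δ p x = TwEps.delta p _ (shiftEta p R t₀) x)
    (hb : IsDeltaBasis p R τ)
    (hθ : ∀ n x, ∀ g ∈ deltaAdjoin p R (shiftGen R t₀ τ i),
        valHom _ n x = Ideal.Quotient.mk _ g.re → valHom _ n (θ x) = Ideal.Quotient.mk _ g.im)
    (hK : (p : B) ∈ qIdealMap p R B) :
    letI := completedDeltaRing hK
    IsDeltaCompatible p (algebraMap B _ (shiftParam R t₀)) (algebraMap B _ (shiftEta p R t₀)) θ := by
  let _ := completedDeltaRing hK
  intro x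
  refine valHom_ext fun n => ?_
  have := isDeltaAlgebra_twEps hE
  -- The lift is taken modulo I^(n+1), because δ on the completion loses one power of I.
  obtain ⟨g, hg, hx⟩ := exists_mem_deltaAdjoin_re hE hb i (n + 1) (valHom _ (n + 1) x)
  have hδ : ∀ (y : AdicCompletion (qIdealMap p R B) B) (b : B),
      valHom _ (n + 1) y = Ideal.Quotient.mk _ b →
      valHom _ n (δ p y) = Ideal.Quotient.mk _ (δ p b) := by
    intro y b hy
    change deltaQuot hK n (y.val (n + 1)) = _
    rw [show y.val (n + 1) = Ideal.Quotient.mk _ b from hy, deltaQuot_mk]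
  have hδx : valHom _ n (δ p x) = Ideal.Quotient.mk _ (δ p g).re := by
    rw [hδ x _ hx, hE, TwEps.delta_re]
  have hθx := hθ (n + 1) x g hg hx
  rw [hθ n _ _ (delta_mem_deltaAdjoin _ hg) hδx, hE, TwEps.delta_im]
  simp only [map_sub, map_add, map_mul, map_pow, map_sum, map_natCast, hδ _ _ hθx,
    valHom_algebraMap, valHom_eq_of_succ hθx, valHom_eq_of_succ hx]

/-- Compatibility propagates the agreement from τ_j to every δ^k(τ_j), and the Leibniz rule extends
it to the R-algebra they generate. This algebra is dense, and both maps preserve the kernels of the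
projections. -/
theorem derivation_unique (hb : IsDeltaBasis p R τ) (hK : (p : B) ∈ qIdealMap p R B)
    {α β : AdicCompletion (qIdealMap p R B) B}
    {θ θ' : AdicCompletion (qIdealMap p R B) B →ₗ[R] AdicCompletion (qIdealMap p R B) B}
    (h1 : IsTwistedDerivation α θ) (h1' : IsTwistedDerivation α θ')
    (h2 : letI := completedDeltaRing hK; IsDeltaCompatible p α β θ)
    (h2' : letI := completedDeltaRing hK; IsDeltaCompatible p α β θ')
    (h : ∀ j, θ (algebraMap B _ (τ j)) = θ' (algebraMap B _ (τ j))) : θ = θ' := by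
  let _ := completedDeltaRing hK
  have hδ : ∀ b : B, δ p (algebraMap B (AdicCompletion (qIdealMap p R B) B) b)
      = algebraMap B _ (δ p b) := fun b => rfl
  have hgen : ∀ j k, θ (algebraMap B _ ((δ p)^[k] (τ j)))
      = θ' (algebraMap B _ ((δ p)^[k] (τ j))) := by
    intro j k
    induction k with
    | zero => exact h j
    | succ k ih =>
      rw [Function.iterate_succ_apply', ← hδ]
      exact (h2 _).trans (Eq.trans (by rw [ih]) (h2' _).symm)
  have hS : ∀ s ∈ deltaAdjoin p R τ, θ (algebraMap B _ s) = θ' (algebraMap B _ s) := by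
    intro s hs
    refine Algebra.adjoin_induction
      (p := fun s _ => θ (algebraMap B _ s) = θ' (algebraMap B _ s)) ?_ ?_ ?_ ?_ hs
    · rintro _ ⟨⟨j, k⟩, rfl⟩
      exact hgen j k
    · intro r
      have e : algebraMap B (AdicCompletion (qIdealMap p R B) B) (algebraMap R B r) = r • 1 := by
        rw [Algebra.smul_def, mul_one]; rfl
      rw [e, map_smul, map_smul, h1.map_one, h1'.map_one]
    · intro x y _ _ hx hy
      rw [map_add, map_add, map_add, hx, hy]
    · intro x y _ _ hx hy
      rw [map_mul, h1.map_mul, h1'.map_mul, hx, hy]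
  refine LinearMap.ext fun x => valHom_ext fun n => ?_
  obtain ⟨b, hbx⟩ := Ideal.Quotient.mk_surjective (valHom _ n x)
  obtain ⟨c, hc⟩ := hb.span n b
  set s := Finsupp.linearCombination R (fun m : ι → ℕ => ∏ j, deltaPow p (τ j) (m j)) c
  have hs : s ∈ deltaAdjoin p R τ := by
    rw [show s = _ from Finsupp.linearCombination_apply R c]
    exact sum_mem fun m _ => Subalgebra.smul_mem _ (prod_deltaPow_mem_deltaAdjoin _ m) _
  have hx0 : valHom _ n (x - algebraMap B _ s) = 0 := by
    rw [map_sub, ← hbx, valHom_algebraMap, sub_eq_zero, Ideal.Quotient.eq, mem_map_pow_smul_top]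
    exact hc
  have e1 := valHom_map_eq_zero _ qIdeal_fg θ hx0
  have e2 := valHom_map_eq_zero _ qIdeal_fg θ' hx0
  rw [map_sub, map_sub, sub_eq_zero] at e1 e2
  rw [e1, e2, hS s hs]

end Construction

/-! ### Triangular endomorphisms modulo a nilpotent ideal -/

section Triangular

variable {k : Type*} [CommRing k]

/-- A matrix that is triangular with invertible diagonal modulo a nilpotent ideal is invertible. -/
theorem bijective_of_triangular {𝔫 : Ideal k} {N : ℕ} (hN : 𝔫 ^ N = ⊥)
    (ψ : (ℕ →₀ k) →ₗ[k] (ℕ →₀ k))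
    (hdiag : ∀ m, ∃ u, ψ (Finsupp.single m 1) m * u - 1 ∈ 𝔫)
    (hlow : ∀ m l, m < l → ψ (Finsupp.single m 1) l ∈ 𝔫) : Function.Bijective ψ := by
  constructor
  · rw [injective_iff_map_eq_zero]
    intro v hv
    -- The outer induction is on the power of 𝔫. The inner one descends on the index l, starting
    -- beyond the support of v.
    have key : ∀ r l, v l ∈ 𝔫 ^ r := by
      intro r
      induction r with
      | zero => simp
      | succ r ih =>
        obtain ⟨M, hM⟩ : ∃ M, ∀ l, M ≤ l → v l = 0 := by
          refine ⟨v.support.sup id + 1, fun l hl => ?_⟩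
          by_contra h
          have := Finset.le_sup (f := id) (Finsupp.mem_support_iff.2 h)
          simp only [id] at this
          omega
        suffices H : ∀ e l, M ≤ l + e → v l ∈ 𝔫 ^ (r + 1) from fun l => H M l (by omega)
        intro e
        induction e with
        | zero => intro l hl; rw [hM l hl]; exact zero_mem _
        | succ e ihe =>
          intro l hl
          have h0 : v.sum (fun m c => c * ψ (Finsupp.single m 1) l) = 0 := by
            have h1 : ψ v = v.sum fun m c => c • ψ (Finsupp.single m 1) := by
              conv_lhs => rw [← Finsupp.sum_single v]
              rw [map_finsuppSum]
              refine Finsupp.sum_congr fun m _ => ?_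
              rw [← map_smul, Finsupp.smul_single, smul_eq_mul, mul_one]
            have h2 := DFunLike.congr_fun h1 l
            rw [hv, Finsupp.sum_apply] at h2
            simpa using h2.symm
          have h3 : v l * ψ (Finsupp.single l 1) l ∈ 𝔫 ^ (r + 1) := by
            by_cases hl0 : v l = 0
            · rw [hl0, zero_mul]; exact zero_mem _
            rw [Finsupp.sum, ← Finset.add_sum_erase _ _ (Finsupp.mem_support_iff.2 hl0)] at h0
            rw [eq_neg_of_add_eq_zero_left h0]
            refine neg_mem (sum_mem fun m hm => ?_)
            rcases lt_or_gt_of_ne (Finset.ne_of_mem_erase hm) with h | h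
            · rw [pow_succ]
              exact Ideal.mul_mem_mul (ih m) (hlow m l h)
            · exact Ideal.mul_mem_right _ _ (ihe m (by omega))
          obtain ⟨u, hu⟩ := hdiag l
          have e2 : v l = v l * ψ (Finsupp.single l 1) l * u
              - v l * (ψ (Finsupp.single l 1) l * u - 1) := by ring
          rw [e2]
          refine sub_mem (Ideal.mul_mem_right _ _ h3) ?_
          rw [pow_succ]
          exact Ideal.mul_mem_mul (ih l) hu
    ext l
    have := key N l
    rwa [hN] at this
  · rw [← LinearMap.range_eq_top]
    -- As 𝔫 is nilpotent, surjectivity modulo 𝔫 suffices; there ψ is triangular, so basis vectors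
    -- are reached by strong induction.
    have h1 : LinearMap.range ψ ⊔ 𝔫 • ⊤ = ⊤ := by
      have hs : ∀ m, Finsupp.single m (1 : k) ∈ LinearMap.range ψ ⊔ 𝔫 • ⊤ := by
        intro m
        induction m using Nat.strong_induction_on with
        | _ m ih =>
          set T := LinearMap.range ψ ⊔ 𝔫 • ⊤
          have hrest : ψ (Finsupp.single m 1) - Finsupp.single m (ψ (Finsupp.single m 1) m) ∈ T := by
            set w := ψ (Finsupp.single m 1)
            have e : w - Finsupp.single m (w m) = (w.erase m).sum Finsupp.single := by
              rw [Finsupp.sum_single, Finsupp.erase_eq_sub_single]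
            rw [e]
            refine sum_mem fun l hl => ?_
            rw [Finsupp.support_erase] at hl
            have hne := Finset.ne_of_mem_erase hl
            rw [Finsupp.erase_ne hne, ← mul_one (w l), ← smul_eq_mul, ← Finsupp.smul_single]
            rcases lt_or_gt_of_ne hne with h | h
            · exact Submodule.smul_mem _ _ (ih l h)
            · exact Submodule.mem_sup_right (Submodule.smul_mem_smul (hlow m l h) trivial)
          have h2 : Finsupp.single m (ψ (Finsupp.single m 1) m) ∈ T := by
            rw [← sub_sub_cancel (ψ (Finsupp.single m 1)) (Finsupp.single m _)]
            exact sub_mem (Submodule.mem_sup_left ⟨_, rfl⟩) hrest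
          obtain ⟨u, hu⟩ := hdiag m
          have e2 : Finsupp.single m (1 : k) = u • Finsupp.single m (ψ (Finsupp.single m 1) m)
              - (ψ (Finsupp.single m 1) m * u - 1) • Finsupp.single m 1 := by
            rw [Finsupp.smul_single, Finsupp.smul_single, ← Finsupp.single_sub]
            congr 1
            simp only [smul_eq_mul]
            ring
          rw [e2]
          exact sub_mem (Submodule.smul_mem _ _ h2)
            (Submodule.mem_sup_right (Submodule.smul_mem_smul hu trivial))
      rw [eq_top_iff]
      intro v _
      rw [← Finsupp.sum_single v]
      refine sum_mem fun m _ => ?_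
      rw [← mul_one (v m), ← smul_eq_mul, ← Finsupp.smul_single]
      exact Submodule.smul_mem _ _ (hs m)
    have h2 := sup_pow_smul_top_eq_top h1 N
    rwa [hN, Submodule.bot_smul, sup_bot_eq] at h2

/-- Let s be the shift of the basis, e_m ↦ e_(m+1). Then Θs is triangular, hence invertible, and σ =
s(Θs)⁻¹. The operator 1 - σΘ kills the image of s and fixes e_0. -/
theorem exists_section_of_triangular {𝔫 : Ideal k} {N : ℕ} (hN : 𝔫 ^ N = ⊥)
    (Θ : (ℕ →₀ k) →ₗ[k] (ℕ →₀ k)) (h0 : Θ (Finsupp.single 0 1) = 0)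
    (hdiag : ∀ m, ∃ u, Θ (Finsupp.single (m + 1) 1) m * u - 1 ∈ 𝔫)
    (hlow : ∀ m l, m < l → Θ (Finsupp.single (m + 1) 1) l ∈ 𝔫) :
    ∃ σ : (ℕ →₀ k) →ₗ[k] (ℕ →₀ k), Θ * σ = 1 ∧
      ∀ v, ∃ c, (1 - σ * Θ) v = Finsupp.single 0 c := by
  set s : (ℕ →₀ k) →ₗ[k] (ℕ →₀ k) := Finsupp.lmapDomain k k Nat.succ
  have hs : ∀ m c, s (Finsupp.single m c) = Finsupp.single (m + 1) c := fun m c =>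
    Finsupp.mapDomain_single
  have hbij : Function.Bijective (Θ ∘ₗ s) := by
    refine bijective_of_triangular hN (Θ ∘ₗ s) ?_ ?_ <;> intro m <;>
      rw [LinearMap.comp_apply, hs]
    · exact hdiag m
    · exact hlow m
  set e := LinearEquiv.ofBijective (Θ ∘ₗ s) hbij
  have he : ∀ v, e.symm (Θ (s v)) = v := fun v => e.symm_apply_apply v
  refine ⟨s ∘ₗ e.symm.toLinearMap, LinearMap.ext fun v => e.apply_symm_apply v, ?_⟩
  intro v
  change ∃ c, v - s (e.symm (Θ v)) = Finsupp.single 0 c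
  induction v using Finsupp.induction_linear with
  | zero => exact ⟨0, by simp⟩
  | add v w hv hw =>
    obtain ⟨c, hc⟩ := hv
    obtain ⟨c', hc'⟩ := hw
    refine ⟨c + c', ?_⟩
    rw [Finsupp.single_add, ← hc, ← hc', map_add, map_add, map_add]
    abel
  | single m c =>
    rcases m with _ | m
    · refine ⟨c, ?_⟩
      rw [← mul_one c, ← smul_eq_mul, ← Finsupp.smul_single, map_smul, h0]
      simp
    · refine ⟨0, ?_⟩
      rw [← hs, he, sub_self, Finsupp.single_zero]

end Triangular

/-! ### Endomorphisms acting on a single index -/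

section DirectionalExtension

variable {k : Type*} [CommRing k] {ι : Type*} [DecidableEq ι]

/-- The extension of an endomorphism of `k^(ℕ)` to `k^(ℕ^ι)`, acting on the `i`-th index. -/
def dirExt (i : ι) (T : (ℕ →₀ k) →ₗ[k] (ℕ →₀ k)) :
    ((ι → ℕ) →₀ k) →ₗ[k] ((ι → ℕ) →₀ k) :=
  Finsupp.linearCombination k fun m =>
    Finsupp.mapDomain (Function.update m i) (T (Finsupp.single (m i) 1))

theorem dirExt_single (i : ι) (T : (ℕ →₀ k) →ₗ[k] (ℕ →₀ k)) (m : ι → ℕ) (c : k) :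
    dirExt i T (Finsupp.single m c)
      = c • Finsupp.mapDomain (Function.update m i) (T (Finsupp.single (m i) 1)) :=
  Finsupp.linearCombination_single _ _ _

theorem dirExt_mapDomain (i : ι) (T : (ℕ →₀ k) →ₗ[k] (ℕ →₀ k)) (m : ι → ℕ) (w : ℕ →₀ k) :
    dirExt i T (Finsupp.mapDomain (Function.update m i) w)
      = Finsupp.mapDomain (Function.update m i) (T w) := by
  induction w using Finsupp.induction_linear with
  | zero => simp
  | add v w hv hw => simp only [map_add, Finsupp.mapDomain_add, hv, hw]
  | single l c =>
    rw [Finsupp.mapDomain_single, dirExt_single, Function.update_self,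
      ← Finsupp.mapDomain_smul, ← map_smul, Finsupp.smul_single, smul_eq_mul, mul_one]
    congr 1
    funext r
    rw [Function.update_idem]

theorem dirExt_mul (i : ι) (T T' : (ℕ →₀ k) →ₗ[k] (ℕ →₀ k)) :
    dirExt i (T * T') = dirExt i T * dirExt i T' := by
  refine Finsupp.lhom_ext fun m c => ?_
  rw [Module.End.mul_apply, dirExt_single, dirExt_single, map_smul, dirExt_mapDomain]
  rfl

theorem dirExt_one (i : ι) : dirExt i (1 : (ℕ →₀ k) →ₗ[k] (ℕ →₀ k)) = 1 := by
  refine Finsupp.lhom_ext fun m c => ?_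
  rw [dirExt_single, Module.End.one_apply, Module.End.one_apply, Finsupp.mapDomain_single,
    Function.update_eq_self, Finsupp.smul_single, smul_eq_mul, mul_one]

theorem dirExt_sub (i : ι) (T T' : (ℕ →₀ k) →ₗ[k] (ℕ →₀ k)) :
    dirExt i (T - T') = dirExt i T - dirExt i T' := by
  refine Finsupp.lhom_ext fun m c => ?_
  rw [LinearMap.sub_apply, dirExt_single, dirExt_single, dirExt_single, LinearMap.sub_apply,
    ← smul_sub]
  congr 1
  exact map_sub (Finsupp.lmapDomain k k (Function.update m i)) _ _

theorem dirExt_mapDomain_of_ne {i j : ι} (h : i ≠ j) (T : (ℕ →₀ k) →ₗ[k] (ℕ →₀ k))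
    (m : ι → ℕ) (w : ℕ →₀ k) :
    dirExt i T (Finsupp.mapDomain (Function.update m j) w) = w.sum fun l c =>
      (T (Finsupp.single (m i) 1)).sum fun r c' =>
        Finsupp.single (Function.update (Function.update m j l) i r) (c * c') := by
  induction w using Finsupp.induction_linear with
  | zero => simp
  | add v w hv hw =>
    rw [Finsupp.mapDomain_add, map_add, hv, hw, Finsupp.sum_add_index']
    · intro l; simp
    · intro l c c'
      simp only [add_mul, Finsupp.single_add]
      rw [Finsupp.sum_add]
  | single l c =>
    rw [Finsupp.mapDomain_single, dirExt_single, Function.update_of_ne h, Finsupp.sum_single_index]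
    · rw [Finsupp.mapDomain, Finsupp.smul_sum]
      refine Finsupp.sum_congr fun r _ => ?_
      rw [Finsupp.smul_single, smul_eq_mul]
    · simp

/-- On a basis vector both sides are double sums over updates of two different coordinates, which
commute. -/
theorem dirExt_comm {i j : ι} (h : i ≠ j) (T T' : (ℕ →₀ k) →ₗ[k] (ℕ →₀ k)) :
    dirExt i T * dirExt j T' = dirExt j T' * dirExt i T := by
  refine Finsupp.lhom_ext fun m c => ?_
  rw [Module.End.mul_apply, Module.End.mul_apply, dirExt_single, dirExt_single, map_smul, map_smul,
    dirExt_mapDomain_of_ne h, dirExt_mapDomain_of_ne h.symm, Finsupp.sum_comm]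
  congr 1
  refine Finsupp.sum_congr fun r _ => Finsupp.sum_congr fun l _ => ?_
  rw [Function.update_comm h, mul_comm]

/-- If each `P_i` has image in the span of the zeroth basis vector, then so has the product of
their extensions. -/
theorem exists_prod_dirExt_apply [Fintype ι] (P : ι → (ℕ →₀ k) →ₗ[k] (ℕ →₀ k))
    (hP : ∀ i v, ∃ c, P i v = Finsupp.single 0 c) (L : List ι) (hL : ∀ i, i ∈ L)
    (v : (ι → ℕ) →₀ k) :
    ∃ c, (L.map fun i => dirExt i (P i)).prod v = Finsupp.single 0 c := by
  -- For the induction one must record that a coordinate which is zero, or has been treated, remains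
  -- zero.
  have key : ∀ (L : List ι) (m : ι → ℕ), ∃ (c : k) (m' : ι → ℕ),
      (L.map fun i => dirExt i (P i)).prod (Finsupp.single m 1) = Finsupp.single m' c ∧
      ∀ i, (i ∈ L ∨ m i = 0) → m' i = 0 := by
    intro L
    induction L with
    | nil => intro m; exact ⟨1, m, by simp, by simp⟩
    | cons j L ih =>
      intro m
      obtain ⟨c, m', h1, h2⟩ := ih m
      obtain ⟨c', hc'⟩ := hP j (Finsupp.single (m' j) 1)
      refine ⟨c * c', Function.update m' j 0, ?_, ?_⟩
      · rw [List.map_cons, List.prod_cons, Module.End.mul_apply, h1, dirExt_single, hc',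
          Finsupp.mapDomain_single, Finsupp.smul_single, smul_eq_mul]
      · intro i hi
        by_cases hij : i = j
        · subst hij; rw [Function.update_self]
        · rw [Function.update_of_ne hij]
          refine h2 i (hi.imp_left fun h => ?_)
          exact (List.mem_cons.1 h).resolve_left hij
  induction v using Finsupp.induction_linear with
  | zero => exact ⟨0, by simp⟩
  | add v w hv hw =>
    obtain ⟨c, hc⟩ := hv
    obtain ⟨c', hc'⟩ := hw
    exact ⟨c + c', by rw [map_add, hc, hc', Finsupp.single_add]⟩
  | single m c =>
    obtain ⟨c', m', h1, h2⟩ := key L m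
    refine ⟨c * c', ?_⟩
    have hm' : m' = 0 := funext fun i => h2 i (Or.inl (hL i))
    rw [← mul_one c, ← smul_eq_mul, ← Finsupp.smul_single, map_smul, h1, hm', Finsupp.smul_single]
    simp

end DirectionalExtension

/-! ### Combination of one-variable homotopies -/

section Homotopy

variable {E ι : Type*} [Ring E] {D H P : ι → E}

/-- The tensor product of homotopies, built one variable at a time as H_i + P_i h. The
anticommutation of h with the unused D_i is carried along because it gives P_i h D_i = -P_i D_i h =
0 in the next step. -/
theorem exists_homotopy (h1 : ∀ i, D i * H i + H i * D i = 1 - P i)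
    (h2 : ∀ i j, i ≠ j → H j * D i = -(D i * H j)) (h3 : ∀ i j, i ≠ j → P j * D i = D i * P j)
    (h4 : ∀ i, D i * P i = 0) (h5 : ∀ i, P i * D i = 0) {L : List ι} (hL : L.Nodup) :
    ∃ h : E, (∀ i ∉ L, h * D i = -(D i * h)) ∧
      (L.map D).sum * h + h * (L.map D).sum = 1 - (L.map P).prod := by
  induction L with
  | nil => exact ⟨0, by simp, by simp⟩
  | cons i L ih =>
    obtain ⟨hi, hL'⟩ := List.nodup_cons.1 hL
    obtain ⟨h, ha, hb⟩ := ih hL'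
    have hne : ∀ j ∈ L, j ≠ i := fun j hj e => hi (e ▸ hj)
    have hH : ∀ L : List ι, (∀ j ∈ L, j ≠ i) →
        (L.map D).sum * H i + H i * (L.map D).sum = 0 ∧
        (L.map D).sum * P i = P i * (L.map D).sum := by
      intro L
      induction L with
      | nil => simp
      | cons j L ih =>
        intro hj
        obtain ⟨e1, e2⟩ := ih fun l hl => hj l (List.mem_cons_of_mem _ hl)
        have hji := hj j List.mem_cons_self
        rw [List.map_cons, List.sum_cons]
        constructor
        · have := h2 j i hji
          rw [add_mul, mul_add, this]
          calc D j * H i + (L.map D).sum * H i + (-(D j * H i) + H i * (L.map D).sum)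
              = (L.map D).sum * H i + H i * (L.map D).sum := by abel
            _ = 0 := e1
        · have := h3 j i hji
          rw [add_mul, mul_add, this, e2]
    obtain ⟨e1, e2⟩ := hH L hne
    refine ⟨H i + P i * h, ?_, ?_⟩
    · intro j hj
      rw [List.mem_cons, not_or] at hj
      rw [add_mul, mul_assoc, ha j hj.2, h2 j i hj.1, mul_add, ← mul_assoc (D j), ← h3 j i hj.1]
      noncomm_ring
    · rw [List.map_cons, List.sum_cons, List.map_cons, List.prod_cons]
      set S := (L.map D).sum
      set Q := (L.map P).prod
      have e3 : P i * h * D i = 0 := by rw [mul_assoc, ha i hi, mul_neg, ← mul_assoc, h5]; simp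
      calc (D i + S) * (H i + P i * h) + (H i + P i * h) * (D i + S)
          = (D i * H i + H i * D i) + (S * H i + H i * S) + D i * P i * h + S * P i * h
            + P i * h * D i + P i * (h * S) := by noncomm_ring
        _ = 1 - P i + P i * (S * h + h * S) := by
          rw [h1, e1, h4, e2, e3]; noncomm_ring
        _ = 1 - P i * Q := by rw [hb]; noncomm_ring

theorem sum_mul_self_eq_zero (h1 : ∀ i, D i * D i = 0)
    (h2 : ∀ i j, i ≠ j → D i * D j = -(D j * D i)) {L : List ι} (hL : L.Nodup) :
    (L.map D).sum * (L.map D).sum = 0 := by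
  induction L with
  | nil => simp
  | cons i L ih =>
    obtain ⟨hi, hL'⟩ := List.nodup_cons.1 hL
    have hH : ∀ L : List ι, (∀ j ∈ L, j ≠ i) →
        D i * (L.map D).sum = -((L.map D).sum * D i) := by
      intro L
      induction L with
      | nil => simp
      | cons j L ih =>
        intro hj
        have e := ih fun l hl => hj l (List.mem_cons_of_mem _ hl)
        have hji := hj j List.mem_cons_self
        rw [List.map_cons, List.sum_cons, mul_add, e, h2 i j hji.symm, add_mul]
        abel
    have e := hH L fun j hj e => hi (e ▸ hj)
    rw [List.map_cons, List.sum_cons, mul_add, add_mul, add_mul, h1, e, ih hL']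
    abel

end Homotopy

/-! ### Exterior multiplication, contraction and degrees -/

section Exterior

variable {S : Type*} [CommRing S] {d : ℕ}

/-- Exterior multiplication by `dt_i`. -/
def extMul (S : Type*) [CommRing S] {d : ℕ} (i : Fin d) : Module.End S (ExteriorAlgebra S (Fin d → S)) :=
  LinearMap.mulLeft S (ExteriorAlgebra.ι S (Pi.single i (1 : S)))

/-- The restriction of `extMul` to the part of degree `k`. -/
def extWedge (S : Type*) [CommRing S] {d : ℕ} (i : Fin d) (k : ℕ) :
    ⋀[S]^k (Fin d → S) →ₗ[S] ⋀[S]^(k + 1) (Fin d → S) :=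
  (LinearMap.mulLeft S (ExteriorAlgebra.ι S (Pi.single i (1 : S)))).restrict fun x hx => by
    change _ ∈ LinearMap.range _ ^ (k + 1)
    rw [pow_succ']
    exact Submodule.mul_mem_mul (LinearMap.mem_range_self _ _) hx

/-- Contraction with the dual of `dt_i`. -/
def contract (S : Type*) [CommRing S] {d : ℕ} (i : Fin d) : Module.End S (ExteriorAlgebra S (Fin d → S)) :=
  CliffordAlgebra.contractLeft (LinearMap.proj i)

theorem extMul_apply (i : Fin d) (x : ExteriorAlgebra S (Fin d → S)) :
    extMul S i x = ExteriorAlgebra.ι S (Pi.single i (1 : S)) * x := rfl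

theorem extMul_mul_self (i : Fin d) : extMul S i * extMul S i = 0 := by
  refine LinearMap.ext fun x => ?_
  rw [Module.End.mul_apply, extMul_apply, extMul_apply, ← mul_assoc, ExteriorAlgebra.ι_sq_zero,
    zero_mul]
  rfl

theorem extMul_comm (i j : Fin d) : extMul S i * extMul S j = -(extMul S j * extMul S i) := by
  refine LinearMap.ext fun x => ?_
  rw [LinearMap.neg_apply, Module.End.mul_apply, Module.End.mul_apply, extMul_apply, extMul_apply,
    extMul_apply, extMul_apply, ← mul_assoc, ← mul_assoc, eq_neg_iff_add_eq_zero, ← add_mul,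
    ExteriorAlgebra.ι_add_mul_swap, zero_mul]

theorem contract_extMul_apply (i j : Fin d) (x : ExteriorAlgebra S (Fin d → S)) :
    contract S i (extMul S j x) = (if i = j then x else 0) - extMul S j (contract S i x) := by
  refine (CliffordAlgebra.contractLeft_ι_mul (Q := (0 : QuadraticForm S (Fin d → S)))
    (LinearMap.proj i) (Pi.single j (1 : S)) x).trans ?_
  congr 1
  rw [LinearMap.proj_apply]
  by_cases h : i = j
  · subst h; simp
  · simp [h]

theorem contract_mul_extMul_self (i : Fin d) :
    extMul S i * contract S i + contract S i * extMul S i = 1 := by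
  refine LinearMap.ext fun x => ?_
  rw [LinearMap.add_apply, Module.End.mul_apply, Module.End.mul_apply, contract_extMul_apply,
    if_pos rfl, Module.End.one_apply]
  abel

theorem contract_mul_extMul_of_ne {i j : Fin d} (h : i ≠ j) :
    contract S i * extMul S j = -(extMul S j * contract S i) := by
  refine LinearMap.ext fun x => ?_
  rw [LinearMap.neg_apply, Module.End.mul_apply, Module.End.mul_apply, contract_extMul_apply,
    if_neg h, zero_sub]

theorem contract_extMul_mul_extMul {i j : Fin d} (h : i ≠ j) :
    contract S i * extMul S i * extMul S j = extMul S j * (contract S i * extMul S i) := by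
  refine LinearMap.ext fun x => ?_
  have e := LinearMap.congr_fun (extMul_comm i j) x
  rw [LinearMap.neg_apply, Module.End.mul_apply, Module.End.mul_apply] at e
  rw [Module.End.mul_apply, Module.End.mul_apply, Module.End.mul_apply, Module.End.mul_apply, e,
    map_neg, contract_extMul_apply i j, if_neg h, zero_sub, neg_neg]

theorem contract_extMul_mul_extMul_self (i : Fin d) :
    contract S i * extMul S i * extMul S i = 0 := by
  rw [mul_assoc, extMul_mul_self, mul_zero]

/-- The projection of the exterior algebra onto its degree zero part, as a product. -/
def degZero (S : Type*) [CommRing S] {d : ℕ} (L : List (Fin d)) : Module.End S (ExteriorAlgebra S (Fin d → S)) :=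
  (L.map fun i => contract S i * extMul S i).prod

/-- The factor for j commutes with multiplication by dt_i when j ≠ i and annihilates it when j = i.
Over all indices the product therefore kills every positive degree. -/
theorem degZero_mul_extMul (L : List (Fin d)) (i : Fin d) :
    (i ∉ L → degZero S L * extMul S i = extMul S i * degZero S L) ∧
      (i ∈ L → degZero S L * extMul S i = 0) := by
  induction L with
  | nil => simp [degZero]
  | cons j L ih =>
    have e : degZero S (j :: L) = contract S j * extMul S j * degZero S L := by
      rw [degZero, List.map_cons, List.prod_cons]; rfl
    rw [e]
    constructor
    · intro hi
      rw [List.mem_cons, not_or] at hi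
      rw [mul_assoc, ih.1 hi.2, ← mul_assoc, contract_extMul_mul_extMul (Ne.symm hi.1), mul_assoc]
    · intro hi
      by_cases hL : i ∈ L
      · rw [mul_assoc, ih.2 hL, mul_zero]
      · have hij : i = j := (List.mem_cons.1 hi).resolve_right hL
        rw [mul_assoc, ih.1 hL, ← mul_assoc, hij, contract_extMul_mul_extMul_self, zero_mul]

theorem degZero_one (L : List (Fin d)) : degZero S L 1 = 1 := by
  induction L with
  | nil => rfl
  | cons j L ih =>
    rw [degZero, List.map_cons, List.prod_cons, Module.End.mul_apply]
    change (contract S j * extMul S j) (degZero S L 1) = 1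
    have h1 : contract S j (1 : ExteriorAlgebra S (Fin d → S)) = 0 :=
      CliffordAlgebra.contractLeft_one (Q := (0 : QuadraticForm S (Fin d → S))) _
    rw [ih, Module.End.mul_apply, contract_extMul_apply, if_pos rfl, h1, map_zero, sub_zero]

theorem degZero_apply_of_mem {L : List (Fin d)} (hL : ∀ i, i ∈ L) {k : ℕ}
    {x : ExteriorAlgebra S (Fin d → S)} (hx : x ∈ ⋀[S]^(k + 1) (Fin d → S)) : degZero S L x = 0 := by
  change x ∈ LinearMap.range _ ^ (k + 1) at hx
  rw [pow_succ'] at hx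
  refine Submodule.mul_induction_on hx ?_ fun a b ha hb => by rw [map_add, ha, hb, add_zero]
  rintro _ ⟨v, rfl⟩ y _
  have hv : v = ∑ i, v i • (Pi.single i 1 : Fin d → S) := by
    funext j
    simp [Finset.sum_apply, Pi.single_apply]
  rw [hv, map_sum, Finset.sum_mul, map_sum]
  refine Finset.sum_eq_zero fun i _ => ?_
  rw [map_smul, smul_mul_assoc, map_smul, ← extMul_apply, ← Module.End.mul_apply,
    (degZero_mul_extMul L i).2 (hL i), LinearMap.zero_apply, smul_zero]

/-- The projection onto the part of degree `k`. -/
def degProj (S : Type*) [CommRing S] {d : ℕ} (k : ℕ) : ExteriorAlgebra S (Fin d → S) →ₗ[S] ⋀[S]^k (Fin d → S) :=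
  (DirectSum.component S ℕ (fun k => ⋀[S]^k (Fin d → S)) k) ∘ₗ
    (DirectSum.decomposeLinearEquiv fun k => ⋀[S]^k (Fin d → S)).toLinearMap

theorem degProj_apply (k : ℕ) (x : ExteriorAlgebra S (Fin d → S)) :
    degProj S k x = DirectSum.decompose (fun k => ⋀[S]^k (Fin d → S)) x k := rfl

theorem degProj_coe {k : ℕ} (x : ⋀[S]^k (Fin d → S)) :
    degProj S k (x : ExteriorAlgebra S (Fin d → S)) = x := by
  rw [degProj_apply, DirectSum.decompose_coe, DirectSum.of_eq_same]

theorem ι_single_mem (i : Fin d) : ExteriorAlgebra.ι S (Pi.single i (1 : S)) ∈ ⋀[S]^1 (Fin d → S) := by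
  change _ ∈ LinearMap.range _ ^ 1
  rw [pow_one]
  exact ⟨_, rfl⟩

theorem degProj_succ_extMul (k : ℕ) (i : Fin d) (x : ExteriorAlgebra S (Fin d → S)) :
    degProj S (k + 1) (extMul S i x) = extWedge S i k (degProj S k x) := by
  refine Subtype.ext ?_
  rw [degProj_apply, extMul_apply]
  have h := DirectSum.coe_decompose_mul_add_of_left_mem (fun k => ⋀[S]^k (Fin d → S)) (ι_single_mem i)
    (b := x) (j := k)
  rw [add_comm 1 k] at h
  exact h

theorem degProj_zero_extMul (i : Fin d) (x : ExteriorAlgebra S (Fin d → S)) :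
    degProj S 0 (extMul S i x) = 0 := by
  refine Subtype.ext ?_
  rw [degProj_apply, extMul_apply]
  exact DirectSum.coe_decompose_mul_of_left_mem_of_not_le (fun k => ⋀[S]^k (Fin d → S)) (ι_single_mem i)
    (by omega)

end Exterior

/-! ### Exactness of the Koszul complex of commuting operators with sections -/

section Koszul

variable {S : Type*} [CommRing S] {d : ℕ} {V : Type*} [AddCommGroup V] [Module S V]

/-- The differential `v ⊗ ω ↦ ∑_i θ_i(v) ⊗ (dt_i ∧ ω)`. -/
def koszulMap (θ : Fin d → Module.End S V) (k : ℕ) :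
    V ⊗[S] ⋀[S]^k (Fin d → S) →ₗ[S] V ⊗[S] ⋀[S]^(k + 1) (Fin d → S) :=
  ∑ i, TensorProduct.map (θ i) (extWedge S i k)

/-- The total differential on `V ⊗ ⋀ Ω`. -/
def koszulTotal (θ : Fin d → Module.End S V) : Module.End S (V ⊗[S] ExteriorAlgebra S (Fin d → S)) :=
  ((List.finRange d).map fun i => TensorProduct.map (θ i) (extMul S i)).sum

theorem koszulTotal_eq_sum (θ : Fin d → Module.End S V) :
    koszulTotal θ = ∑ i, TensorProduct.map (θ i) (extMul S i) := by
  rw [koszulTotal, ← List.ofFn_eq_map, List.sum_ofFn]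

theorem lTensor_subtype_koszulMap (θ : Fin d → Module.End S V) (k : ℕ)
    (x : V ⊗[S] ⋀[S]^k (Fin d → S)) :
    (⋀[S]^(k + 1) (Fin d → S)).subtype.lTensor V (koszulMap θ k x)
      = koszulTotal θ ((⋀[S]^k (Fin d → S)).subtype.lTensor V x) := by
  rw [koszulTotal_eq_sum, koszulMap, LinearMap.sum_apply, LinearMap.sum_apply, map_sum]
  refine Finset.sum_congr rfl fun i _ => ?_
  rw [← LinearMap.comp_apply, ← LinearMap.comp_apply]
  congr 1
  exact TensorProduct.ext' fun v ω => rfl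

theorem lTensor_degProj_koszulTotal (θ : Fin d → Module.End S V) (k : ℕ)
    (x : V ⊗[S] ExteriorAlgebra S (Fin d → S)) :
    (degProj S (k + 1)).lTensor V (koszulTotal θ x)
      = koszulMap θ k ((degProj S k).lTensor V x) := by
  rw [koszulTotal_eq_sum, koszulMap, LinearMap.sum_apply, LinearMap.sum_apply, map_sum]
  refine Finset.sum_congr rfl fun i _ => ?_
  rw [← LinearMap.comp_apply, ← LinearMap.comp_apply]
  congr 1
  refine TensorProduct.ext' fun v ω => ?_
  change θ i v ⊗ₜ degProj S (k + 1) (extMul S i ω) = θ i v ⊗ₜ extWedge S i k (degProj S k ω)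
  rw [degProj_succ_extMul]

theorem lTensor_degProj_zero_koszulTotal (θ : Fin d → Module.End S V)
    (x : V ⊗[S] ExteriorAlgebra S (Fin d → S)) :
    (degProj S 0).lTensor V (koszulTotal θ x) = 0 := by
  rw [koszulTotal_eq_sum, LinearMap.sum_apply, map_sum]
  refine Finset.sum_eq_zero fun i _ => ?_
  rw [← LinearMap.comp_apply]
  have : (degProj S 0).lTensor V ∘ₗ TensorProduct.map (θ i) (extMul S i) = 0 := by
    refine TensorProduct.ext' fun v ω => ?_
    change θ i v ⊗ₜ degProj S 0 (extMul S i ω) = 0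
    rw [degProj_zero_extMul, tmul_zero]
  rw [this, LinearMap.zero_apply]

theorem lTensor_degProj_subtype (k : ℕ) (x : V ⊗[S] ⋀[S]^k (Fin d → S)) :
    (degProj S k).lTensor V ((⋀[S]^k (Fin d → S)).subtype.lTensor V x) = x := by
  rw [← LinearMap.comp_apply, ← LinearMap.lTensor_comp]
  have : degProj S k ∘ₗ (⋀[S]^k (Fin d → S)).subtype = LinearMap.id :=
    LinearMap.ext fun x => degProj_coe x
  rw [this, LinearMap.lTensor_id, LinearMap.id_apply]

variable {θ σ : Fin d → Module.End S V}

/-- The operators commute while the dt_i anticommute and square to zero. -/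
theorem koszulMap_comp (hθ : ∀ i j, θ i * θ j = θ j * θ i) (k : ℕ) (x : V ⊗[S] ⋀[S]^k (Fin d → S)) :
    koszulMap θ (k + 1) (koszulMap θ k x) = 0 := by
  have h : koszulTotal θ * koszulTotal θ = 0 := by
    refine sum_mul_self_eq_zero ?_ ?_ (List.nodup_finRange d)
    · intro i
      rw [← TensorProduct.map_mul, extMul_mul_self, TensorProduct.map_zero_right]
    · intro i j _
      rw [← TensorProduct.map_mul, ← TensorProduct.map_mul, hθ, extMul_comm]
      exact map_neg (TensorProduct.mapBilinear (.id S) V _ V _ (θ j * θ i)) _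
  rw [← lTensor_degProj_subtype (k + 1 + 1) (koszulMap θ (k + 1) _), lTensor_subtype_koszulMap,
    lTensor_subtype_koszulMap, ← Module.End.mul_apply, h, LinearMap.zero_apply, map_zero]

theorem map_prod_list {M N ι : Type*} [AddCommGroup M] [AddCommGroup N]
    [Module S M] [Module S N]
    (f : ι → Module.End S M) (g : ι → Module.End S N) (L : List ι) :
    (L.map fun i => TensorProduct.map (f i) (g i)).prod
      = TensorProduct.map (L.map f).prod (L.map g).prod := by
  induction L with
  | nil => exact TensorProduct.map_one.symm
  | cons i L ih =>
    rw [List.map_cons, List.prod_cons, ih, ← TensorProduct.map_mul, List.map_cons, List.prod_cons,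
      List.map_cons, List.prod_cons]

/-- In each variable, σ_i ⊗ (contraction) is a homotopy from the identity to (1 - σ_i θ_i) ⊗
(contraction after multiplication). The last operator is annihilated by the differential of that
variable on both sides, as `exists_homotopy` requires. -/
theorem exists_koszul_homotopy (h1 : ∀ i, θ i * σ i = 1)
    (h2 : ∀ i j, i ≠ j → σ j * θ i = θ i * σ j) (hθ : ∀ i j, θ i * θ j = θ j * θ i) :
    ∃ h : Module.End S (V ⊗[S] ExteriorAlgebra S (Fin d → S)),
      koszulTotal θ * h + h * koszulTotal θ = 1 - TensorProduct.map
        ((List.finRange d).map fun i => 1 - σ i * θ i).prod (degZero S (List.finRange d)) := by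
  have hneg : ∀ (f : Module.End S V) (g : Module.End S (ExteriorAlgebra S (Fin d → S))),
      TensorProduct.map f (-g) = -TensorProduct.map f g := fun f g =>
    map_neg (TensorProduct.mapBilinear (.id S) V _ V _ f) _
  have hadd : ∀ (f : Module.End S V) (g g' : Module.End S (ExteriorAlgebra S (Fin d → S))),
      TensorProduct.map f (g + g') = TensorProduct.map f g + TensorProduct.map f g' := fun f g g' =>
    TensorProduct.map_add_right f g g'
  have hsub : ∀ (f f' : Module.End S V) (g : Module.End S (ExteriorAlgebra S (Fin d → S))),
      TensorProduct.map (f - f') g = TensorProduct.map f g - TensorProduct.map f' g := fun f f' g =>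
    LinearMap.map_sub₂ (TensorProduct.mapBilinear (.id S) V _ V _) f f' g
  have hc : ∀ i j, i ≠ j → (1 - σ j * θ j) * θ i = θ i * (1 - σ j * θ j) := fun i j hij => by
    rw [sub_mul, mul_sub, mul_assoc, hθ j i, ← mul_assoc, h2 i j hij, mul_assoc, one_mul, mul_one]
  obtain ⟨h, -, hh⟩ := exists_homotopy
    (D := fun i => TensorProduct.map (θ i) (extMul S i))
    (H := fun i => TensorProduct.map (σ i) (contract S i))
    (P := fun i => TensorProduct.map (1 - σ i * θ i) (contract S i * extMul S i))
    (fun i => by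
      rw [← TensorProduct.map_mul, ← TensorProduct.map_mul, h1, hsub, ← TensorProduct.map_one,
        ← contract_mul_extMul_self i, hadd]
      abel)
    (fun i j hij => by
      rw [← TensorProduct.map_mul, ← TensorProduct.map_mul, h2 i j hij,
        contract_mul_extMul_of_ne hij.symm, hneg])
    (fun i j hij => by
      rw [← TensorProduct.map_mul, ← TensorProduct.map_mul, hc i j hij,
        contract_extMul_mul_extMul hij.symm])
    (fun i => by
      rw [← TensorProduct.map_mul, mul_sub, ← mul_assoc, h1, one_mul, mul_one, sub_self,
        TensorProduct.map_zero_left])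
    (fun i => by
      rw [← TensorProduct.map_mul, contract_extMul_mul_extMul_self, TensorProduct.map_zero_right])
    (List.nodup_finRange d)
  refine ⟨h, ?_⟩
  rw [map_prod_list] at hh
  exact hh

theorem koszul_exact_succ (h1 : ∀ i, θ i * σ i = 1)
    (h2 : ∀ i j, i ≠ j → σ j * θ i = θ i * σ j) (hθ : ∀ i j, θ i * θ j = θ j * θ i) (k : ℕ) :
    Function.Exact (koszulMap θ k) (koszulMap θ (k + 1)) := by
  obtain ⟨h, hh⟩ := exists_koszul_homotopy h1 h2 hθ
  intro x
  constructor
  · intro hx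
    set X := (⋀[S]^(k + 1) (Fin d → S)).subtype.lTensor V x
    have hX : koszulTotal θ X = 0 := by
      rw [← lTensor_subtype_koszulMap, hx, map_zero]
    have e := LinearMap.congr_fun hh X
    have hP : TensorProduct.map ((List.finRange d).map fun i => 1 - σ i * θ i).prod
        (degZero S (List.finRange d)) X = 0 := by
      have hz : degZero S (List.finRange d) ∘ₗ (⋀[S]^(k + 1) (Fin d → S)).subtype = 0 :=
        LinearMap.ext fun y => degZero_apply_of_mem List.mem_finRange y.2
      change (TensorProduct.map _ _ ∘ₗ LinearMap.lTensor V _) x = 0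
      rw [LinearMap.lTensor, ← TensorProduct.map_comp, hz, TensorProduct.map_zero_right]
      rfl
    rw [LinearMap.add_apply, LinearMap.sub_apply, Module.End.mul_apply, Module.End.mul_apply, hX,
      map_zero, add_zero, hP, sub_zero, Module.End.one_apply] at e
    -- The homotopy is not recorded as homogeneous, so the component of degree k is extracted.
    refine ⟨(degProj S k).lTensor V (h X), ?_⟩
    rw [← lTensor_degProj_koszulTotal, e]
    exact lTensor_degProj_subtype _ x
  · rintro ⟨y, rfl⟩
    exact koszulMap_comp hθ k y

/-- The unit of the exterior algebra, as an element of degree zero. -/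
def extOne (S : Type*) [CommRing S] (d : ℕ) : ⋀[S]^0 (Fin d → S) := ⟨1, Submodule.one_le.1 (pow_zero _).ge⟩

theorem exists_eq_tmul_extOne (x : V ⊗[S] ⋀[S]^0 (Fin d → S)) : ∃ v : V, x = v ⊗ₜ extOne S d := by
  induction x using TensorProduct.induction_on with
  | zero => exact ⟨0, by simp⟩
  | add x y hx hy =>
    obtain ⟨v, rfl⟩ := hx
    obtain ⟨w, rfl⟩ := hy
    exact ⟨v + w, by rw [add_tmul]⟩
  | tmul v ω =>
    have hω : (ω : ExteriorAlgebra S (Fin d → S)) ∈ (1 : Submodule S (ExteriorAlgebra S (Fin d → S))) := by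
      have := ω.2
      change _ ∈ LinearMap.range _ ^ 0 at this
      rwa [pow_zero] at this
    obtain ⟨n, hn⟩ := Submodule.mem_one.1 hω
    refine ⟨n • v, ?_⟩
    rw [smul_tmul]
    congr 1
    refine Subtype.ext ?_
    rw [← hn]
    change algebraMap S _ n = n • (1 : ExteriorAlgebra S (Fin d → S))
    rw [Algebra.smul_def, mul_one]

theorem koszul_exists_of_zero (h1 : ∀ i, θ i * σ i = 1)
    (h2 : ∀ i j, i ≠ j → σ j * θ i = θ i * σ j) (hθ : ∀ i j, θ i * θ j = θ j * θ i)
    {x : V ⊗[S] ⋀[S]^0 (Fin d → S)} (hx : koszulMap θ 0 x = 0) :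
    ∃ v : V, x = ((List.finRange d).map fun i => 1 - σ i * θ i).prod v ⊗ₜ extOne S d := by
  obtain ⟨h, hh⟩ := exists_koszul_homotopy h1 h2 hθ
  obtain ⟨v, rfl⟩ := exists_eq_tmul_extOne x
  refine ⟨v, ?_⟩
  have hX : koszulTotal θ (v ⊗ₜ (1 : ExteriorAlgebra S (Fin d → S))) = 0 := by
    have := lTensor_subtype_koszulMap θ 0 (v ⊗ₜ extOne S d)
    rw [hx, map_zero] at this
    exact this.symm
  have e := LinearMap.congr_fun hh (v ⊗ₜ (1 : ExteriorAlgebra S (Fin d → S)))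
  rw [LinearMap.add_apply, LinearMap.sub_apply, Module.End.mul_apply, Module.End.mul_apply, hX,
    map_zero, add_zero, Module.End.one_apply, TensorProduct.map_tmul, degZero_one] at e
  -- The remaining boundary term has no component in degree zero.
  have e2 := congrArg ((degProj S 0).lTensor V) e
  rw [lTensor_degProj_zero_koszulTotal, map_sub, LinearMap.lTensor_tmul, LinearMap.lTensor_tmul,
    show degProj S 0 (1 : ExteriorAlgebra S (Fin d → S)) = extOne S d from degProj_coe (extOne S d)] at e2
  exact sub_eq_zero.1 e2.symm

theorem tmul_extOne_injective : Function.Injective fun v : V => v ⊗ₜ[S] extOne S d := by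
  intro v w h
  have h1 := congrArg (fun x => (TensorProduct.rid S V)
    ((ExteriorAlgebra.algebraMapInv.toLinearMap ∘ₗ (⋀[S]^0 (Fin d → S)).subtype).lTensor V x)) h
  have e : ∀ v : V, (TensorProduct.rid S V) ((ExteriorAlgebra.algebraMapInv.toLinearMap ∘ₗ
      (⋀[S]^0 (Fin d → S)).subtype).lTensor V (v ⊗ₜ[S] extOne S d)) = v := by
    intro v
    rw [LinearMap.lTensor_tmul, TensorProduct.rid_tmul]
    have : (ExteriorAlgebra.algebraMapInv.toLinearMap ∘ₗ (⋀[S]^0 (Fin d → S)).subtype) (extOne S d)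
        = (1 : S) := map_one ExteriorAlgebra.algebraMapInv
    rw [this, one_smul]
  simp only [e] at h1
  exact h1

end Koszul

/-! ### Nilpotence of (p, μ) modulo I^n -/

section NilIdeal

variable (p : ℕ) [hp : Fact p.Prime] (R : Type*) [CommRing R] [Algebra ℤ[X] R]

/-- The ideal `(p, μ)`. -/
def pμIdeal : Ideal R := Ideal.span {(p : R), qElt R qμ}

theorem natCast_mem_pμIdeal : (p : R) ∈ pμIdeal p R := Ideal.subset_span (Set.mem_insert _ _)

theorem qElt_qμ_mem_pμIdeal : qElt R qμ ∈ pμIdeal p R :=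
  Ideal.subset_span (Set.mem_insert_of_mem _ rfl)

theorem qElt_qNum_mem_pμIdeal : qElt R (qNum p) ∈ pμIdeal p R := by
  obtain ⟨g, hg⟩ : qμ ∣ qNum p - C ((qNum p).eval 1) := by
    rw [qμ, ← C_1, dvd_iff_isRoot]
    simp
  have e : qNum p = p + qμ * g := by
    rw [← hg, show (qNum p).eval 1 = p from eval_one_qNumIter p 0]
    simp
  rw [qElt, e, map_add, map_mul, map_natCast]
  exact add_mem (natCast_mem_pμIdeal p R) (Ideal.mul_mem_right _ _ (qElt_qμ_mem_pμIdeal p R))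

theorem qIdeal_le_pμIdeal : qIdeal p R ≤ pμIdeal p R := by
  refine Ideal.span_le.2 ?_
  rintro x (rfl | rfl)
  · exact natCast_mem_pμIdeal p R
  · exact qElt_qNum_mem_pμIdeal p R

/-- Both p and μ^p lie in I, so the finitely generated ideal (p, μ) is contained in the radical of
I. -/
theorem exists_pμIdeal_pow_le (n : ℕ) : ∃ N, pμIdeal p R ^ N ≤ qIdeal p R ^ n := by
  have h : pμIdeal p R ≤ (qIdeal p R).radical := by
    refine Ideal.span_le.2 ?_
    rintro x (rfl | rfl)
    · exact Ideal.le_radical (natCast_mem_qIdeal p R)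
    · exact ⟨p, qElt_qμ_pow_mem p R⟩
  obtain ⟨N, hN⟩ := Ideal.exists_pow_le_of_le_radical_of_fg h
    (Submodule.fg_span (Set.toFinite _))
  exact ⟨N * n, by rw [pow_mul]; exact Ideal.pow_right_mono hN n⟩

end NilIdeal

/-! ### Coordinates modulo I^n and the columns of θ_i -/

section Columns

variable {p : ℕ} [hp : Fact p.Prime] {R B : Type*} [CommRing R] [DeltaRing p R]
  [CommRing B] [DeltaRing p B] [Algebra R B] [IsDeltaAlgebra p R B]
  [Algebra ℤ[X] R] [IsDeltaAlgebra p ℤ[X] R]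
  {ι : Type*} [Fintype ι] [DecidableEq ι] {τ t : ι → B} {a : ι → R} {i : ι}
  {t₀ : B} [DeltaRing p (TwEps (shiftParam R t₀))]

theorem relation_of_eq (hτ : ∀ j, algebraMap R B (qElt R (qNum p)) * τ j + algebraMap R B (a j) = t j)
    (ht : ∀ j, δ p (t j) = 0) (j : ι) :
    δ p (algebraMap R B (qElt R (qNum p)) * τ j + algebraMap R B (a j)) = 0 := by
  rw [hτ, ht]

/-- Modulo `(p, μ)`, the derivation is triangular on the basis. -/
theorem exists_im_deltaPow_sub_mem
    (hE : ∀ x : TwEps (shiftParam R t₀), δ p x = TwEps.delta p _ (shiftEta p R t₀) x)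
    (hτ : ∀ j, algebraMap R B (qElt R (qNum p)) * τ j + algebraMap R B (a j) = t j)
    (ht : ∀ j, δ p (t j) = 0) (hi : t₀ = t i) (m : ℕ) :
    ∃ c : ℤ, ¬ (p : ℤ) ∣ c ∧ ∃ s ∈ Submodule.span R (deltaPow p (τ i) '' Set.Iio m),
      (deltaPow p (shiftGen R t₀ τ i i) (m + 1)).im - (c : R) • deltaPow p (τ i) m - s
        ∈ (pμIdeal p R).map (algebraMap R B) := by
  set J := (pμIdeal p R).map (algebraMap R B)
  set q : B →ₐ[R] B ⧸ J := Ideal.Quotient.mkₐ R J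
  have hq : ∀ r ∈ pμIdeal p R, q (algebraMap R B r) = 0 := fun r hr =>
    Ideal.Quotient.eq_zero_iff_mem.2 (Ideal.mem_map_of_mem _ hr)
  have hα : q (shiftParam R t₀) = 0 := by
    rw [shiftParam, map_mul, hq _ (qElt_qμ_mem_pμIdeal p R), mul_zero]
  have hp0 : q p = 0 := by
    rw [← map_natCast (algebraMap R B), hq _ (natCast_mem_pμIdeal p R)]
  have hqt : q t₀ = algebraMap R _ (a i) := by
    rw [hi, ← hτ, map_add, map_mul, hq _ (qElt_qNum_mem_pμIdeal p R), zero_mul, zero_add,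
      AlgHom.commutes]
  let Xf : TwEps (shiftParam R t₀) →+* TwEps (0 : B ⧸ J) := TwEps.map q.toRingHom hα
  set X : ℕ → TwEps (0 : B ⧸ J) := fun k => Xf ((δ p)^[k] (shiftGen R t₀ τ i i)) with hX
  set x : ℕ → B ⧸ J := fun k => q ((δ p)^[k] (τ i)) with hx
  have hre : ∀ k, (X k).re = x k := fun k => by
    change q ((δ p)^[k] (shiftGen R t₀ τ i i)).re = _
    rw [iterate_delta_re hE, shiftGen_re]
  have hpow := fun k => exists_quotient_pow_eq (J := J) (Ideal.map_mono (qIdeal_le_pμIdeal p R))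
    (relation_of_eq hτ ht i) k
  have h0 : (X 0).im = 1 := by
    change q (shiftGen R t₀ τ i i).im = 1
    rw [shiftGen_im_self, map_one]
  -- Modulo (p, μ) the parameter α vanishes, so δ-compatibility retains only the β-term and the
  -- summand ν = 1. Moreover t_i becomes a_i, which turns β into a scalar from R.
  have hsucc : ∀ k, (X (k + 1)).im = algebraMap R _ (a i ^ (p - 1) * qElt R (qη p)) * (X k).im ^ p
      - x k ^ (p - 1) * (X k).im := by
    intro k
    have hp1 := hp.out.one_lt
    change q ((δ p)^[k + 1] (shiftGen R t₀ τ i i)).im = _ * (q _) ^ p - _ * q _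
    have e : (X k).re = q ((δ p)^[k] (shiftGen R t₀ τ i i)).re := rfl
    rw [Function.iterate_succ_apply', hE, TwEps.delta_im, ← hre, e]
    set z := (δ p)^[k] (shiftGen R t₀ τ i i)
    have hβ : q (shiftEta p R t₀) = algebraMap R _ (a i ^ (p - 1) * qElt R (qη p)) := by
      rw [shiftEta, map_mul, map_pow, hqt, AlgHom.commutes, map_mul, map_pow]
    simp only [map_sub, map_add, map_mul, map_pow, map_sum, map_natCast, hα, hβ]
    rw [show ((p : ℕ) : B ⧸ J) = 0 by rw [← hp0, map_natCast], zero_pow (by omega), zero_mul,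
      add_zero, zero_mul, zero_add, Finset.sum_eq_single 1]
    · simp [Nat.div_self hp.out.pos]
    · intro ν hν hν1
      rw [Finset.mem_Ico] at hν
      rw [zero_pow (by omega), mul_zero, zero_mul]
    · intro h
      exact absurd (Finset.mem_Ico.2 ⟨le_rfl, hp1⟩) h
  obtain ⟨c, hc, hmem⟩ := exists_im_digitProd_sub_mem R X hre hpow _ h0 hsucc m
  have e1 : digitProd p X (m + 1) = Xf (deltaPow p (shiftGen R t₀ τ i i) (m + 1)) :=
    (map_digitProd p Xf _ _).symm
  have e2 : ∀ l, digitProd p x l = q (deltaPow p (τ i) l) := fun l =>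
    (map_digitProd p q.toRingHom _ _).symm
  have e3 : lowSpan x R p m = (Submodule.span R (deltaPow p (τ i) '' Set.Iio m)).map
      q.toLinearMap := by
    rw [Submodule.map_span, ← Set.image_comp, lowSpan]
    congr 1
    exact Set.image_congr fun l _ => e2 l
  rw [e3] at hmem
  obtain ⟨s, hs, hs'⟩ := hmem
  refine ⟨c, hc, s, hs, ?_⟩
  refine Ideal.Quotient.eq_zero_iff_mem.1 ?_
  change q _ = 0
  rw [map_sub, sub_eq_zero, map_sub, map_smul, ← e2]
  rw [e1] at hs'
  exact hs'.symm

/-- The quotient by I^n and the free module over R/I^n are both quotients of the free R-module on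
ℕ^ι, with the same kernel. -/
theorem exists_coordinates (hb : IsDeltaBasis p R τ) (n : ℕ) :
    ∃ ρ : B →ₗ[R] ((ι → ℕ) →₀ R ⧸ qIdeal p R ^ n), Function.Surjective ρ ∧
      (∀ x, ρ x = 0 ↔ x ∈ (qIdeal p R ^ n • ⊤ : Submodule R B)) ∧
      ∀ m : ι → ℕ, ρ (∏ j, deltaPow p (τ j) (m j)) = Finsupp.single m 1 := by
  set N : Submodule R B := qIdeal p R ^ n • ⊤
  set k := R ⧸ qIdeal p R ^ n
  let e : (ι → ℕ) → B := fun m => ∏ j, deltaPow p (τ j) (m j)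
  let f : ((ι → ℕ) →₀ R) →ₗ[R] B ⧸ N := N.mkQ ∘ₗ Finsupp.linearCombination R e
  let g : ((ι → ℕ) →₀ R) →ₗ[R] ((ι → ℕ) →₀ k) :=
    Finsupp.mapRange.linearMap (Algebra.linearMap R k)
  have hf : Function.Surjective f := fun y => by
    obtain ⟨b, rfl⟩ := N.mkQ_surjective y
    obtain ⟨c, hc⟩ := hb.span n b
    refine ⟨c, ?_⟩
    rw [eq_comm, ← sub_eq_zero]
    change N.mkQ b - N.mkQ _ = 0
    rw [← map_sub, Submodule.mkQ_apply, Submodule.Quotient.mk_eq_zero]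
    exact hc
  have hg : Function.Surjective g :=
    Finsupp.mapRange_surjective _ (map_zero _) Ideal.Quotient.mk_surjective
  have hker : LinearMap.ker f = LinearMap.ker g := by
    ext c
    rw [LinearMap.mem_ker, LinearMap.mem_ker]
    have h1 : f c = 0 ↔ Finsupp.linearCombination R e c ∈ N := Submodule.Quotient.mk_eq_zero _
    have h2 : g c = 0 ↔ ∀ m, c m ∈ qIdeal p R ^ n := by
      rw [Finsupp.ext_iff]
      exact forall_congr' fun m => Ideal.Quotient.eq_zero_iff_mem
    rw [h1, h2]
    refine ⟨hb.indep n c, fun h => ?_⟩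
    rw [Finsupp.linearCombination_apply]
    exact sum_mem fun m _ => Submodule.smul_mem_smul (h m) trivial
  let E : (B ⧸ N) ≃ₗ[R] ((ι → ℕ) →₀ k) := (f.quotKerEquivOfSurjective hf).symm.trans
    ((Submodule.quotEquivOfEq _ _ hker).trans (g.quotKerEquivOfSurjective hg))
  have hEf : ∀ c, E (f c) = g c := by
    intro c
    have : (f.quotKerEquivOfSurjective hf).symm (f c) = (LinearMap.ker f).mkQ c := by
      rw [LinearEquiv.symm_apply_eq]; rfl
    change (g.quotKerEquivOfSurjective hg) (Submodule.quotEquivOfEq _ _ hker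
      ((f.quotKerEquivOfSurjective hf).symm (f c))) = g c
    rw [this]
    rfl
  refine ⟨E.toLinearMap ∘ₗ N.mkQ, E.surjective.comp N.mkQ_surjective, ?_, ?_⟩
  · intro x
    change E (N.mkQ x) = 0 ↔ _
    rw [E.map_eq_zero_iff]
    exact Submodule.Quotient.mk_eq_zero _
  · intro m
    have h1 : f (Finsupp.single m 1) = N.mkQ (e m) := by
      change N.mkQ _ = _
      rw [Finsupp.linearCombination_single, one_smul]
    change E (N.mkQ (e m)) = _
    rw [← h1, hEf]
    exact Finsupp.mapRange_single (hf := map_zero (Algebra.linearMap R k))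

/-- This is the spanning result for the single generator τ_i: no other variable occurs in the
derivative of a δ-power of τ_i. -/
theorem exists_finsupp_sub_mem
    (hE : ∀ x : TwEps (shiftParam R t₀), δ p x = TwEps.delta p _ (shiftEta p R t₀) x)
    (hτ : ∀ j, algebraMap R B (qElt R (qNum p)) * τ j + algebraMap R B (a j) = t j)
    (ht : ∀ j, δ p (t j) = 0) (hi : t₀ = t i) (n l : ℕ) :
    ∃ y : ℕ →₀ R, (deltaPow p (shiftGen R t₀ τ i i) l).im
      - Finsupp.linearCombination R (deltaPow p (τ i)) y ∈ (qIdeal p R ^ n • ⊤ : Submodule R B) := by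
  have h1 := deltaAdjoin_le (τ := fun _ : Unit => τ i) (a := fun _ => a i)
    (fun _ => relation_of_eq hτ ht i) n (deltaPow_shiftGen_im_mem hE hτ hi l)
  obtain ⟨y, hy, z, hz, hyz⟩ := Submodule.mem_sup.1 h1
  have hy' : y ∈ Submodule.span R (Set.range (deltaPow p (τ i))) := by
    refine Submodule.span_mono ?_ hy
    rintro _ ⟨m, rfl⟩
    exact ⟨m (), by simp⟩
  obtain ⟨c, hc⟩ := (Finsupp.mem_span_range_iff_exists_finsupp).1 hy'
  refine ⟨c, ?_⟩
  rw [Finsupp.linearCombination_apply, hc, ← hyz, add_sub_cancel_left]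
  exact Submodule.smul_mono le_rfl le_top hz

theorem prod_erase_mul_deltaPow (m : ι → ℕ) (r : ℕ) :
    (∏ j ∈ Finset.univ.erase i, deltaPow p (τ j) (m j)) * deltaPow p (τ i) r
      = ∏ j, deltaPow p (τ j) (Function.update m i r j) := by
  rw [← Finset.prod_erase_mul _ _ (Finset.mem_univ i), Function.update_self]
  congr 1
  refine Finset.prod_congr rfl fun j hj => ?_
  rw [Function.update_of_ne (Finset.ne_of_mem_erase hj)]

theorem prod_deltaPow_single (r : ℕ) :
    ∏ j, deltaPow p (τ j) (Pi.single (M := fun _ => ℕ) i r j) = deltaPow p (τ i) r := by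
  rw [Finset.prod_eq_single i, Pi.single_eq_same]
  · intro j _ hj
    rw [Pi.single_eq_of_ne hj, deltaPow_eq_digitProd, digitProd_zero]
  · intro h
    exact absurd (Finset.mem_univ i) h

theorem coordinates_prod_mul_linearCombination {n : ℕ}
    {ρ : B →ₗ[R] ((ι → ℕ) →₀ R ⧸ qIdeal p R ^ n)}
    (hρ : ∀ m : ι → ℕ, ρ (∏ j, deltaPow p (τ j) (m j)) = Finsupp.single m 1)
    (m : ι → ℕ) (y : ℕ →₀ R) :
    ρ ((∏ j ∈ Finset.univ.erase i, deltaPow p (τ j) (m j))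
        * Finsupp.linearCombination R (deltaPow p (τ i)) y)
      = Finsupp.mapDomain (Function.update m i)
        (y.mapRange (Ideal.Quotient.mk (qIdeal p R ^ n)) (map_zero _)) := by
  induction y using Finsupp.induction_linear with
  | zero => simp
  | add v w hv hw =>
    rw [map_add, mul_add, map_add, hv, hw, Finsupp.mapRange_add (map_add _),
      Finsupp.mapDomain_add]
  | single r c =>
    rw [Finsupp.linearCombination_single, mul_smul_comm, prod_erase_mul_deltaPow, map_smul, hρ,
      Finsupp.mapRange_single, Finsupp.mapDomain_single, Finsupp.smul_single, Algebra.smul_def,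
      mul_one]
    rfl

end Columns

/-! ### The derivations in coordinates on the completion -/

section CompletedCoordinates

variable {p : ℕ} [hp : Fact p.Prime] {R B : Type*} [CommRing R] [DeltaRing p R]
  [CommRing B] [DeltaRing p B] [Algebra R B] [IsDeltaAlgebra p R B]
  [Algebra ℤ[X] R] [IsDeltaAlgebra p ℤ[X] R]
  {ι : Type*} [Fintype ι] [DecidableEq ι] {τ t : ι → B} {a : ι → R} {i : ι}
  {t₀ : B} [DeltaRing p (TwEps (shiftParam R t₀))]

/-- Coordinates modulo `I^n` extend to the completion. -/
theorem exists_completed_coordinates {n : ℕ} {U : Type*} [AddCommGroup U] [Module R U]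
    {ρ : B →ₗ[R] U} (hsurj : Function.Surjective ρ)
    (hker : ∀ x, ρ x = 0 ↔ x ∈ (qIdeal p R ^ n • ⊤ : Submodule R B)) :
    ∃ ρ' : AdicCompletion (qIdealMap p R B) B →ₗ[R] U, Function.Surjective ρ' ∧
      (∀ x, ρ' x = 0 ↔ valHom _ n x = 0) ∧ ∀ b, ρ' (algebraMap B _ b) = ρ b := by
  choose s hs using fun x : AdicCompletion (qIdealMap p R B) B =>
    Ideal.Quotient.mk_surjective (valHom _ n x)
  have hwd : ∀ x b, valHom _ n x = Ideal.Quotient.mk _ b → ρ (s x) = ρ b := by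
    intro x b h
    rw [← hs x, Ideal.Quotient.eq, mem_map_pow_smul_top, ← hker, map_sub, sub_eq_zero] at h
    exact h
  have halg : ∀ b, ρ (s (algebraMap B _ b)) = ρ b := fun b => hwd _ _ rfl
  refine ⟨{ toFun := fun x => ρ (s x), map_add' := ?_, map_smul' := ?_ }, ?_, ?_, halg⟩
  · intro x y
    rw [← map_add]
    refine hwd _ _ ?_
    rw [map_add, map_add, hs, hs]
  · intro r x
    rw [RingHom.id_apply, ← map_smul]
    refine hwd _ _ ?_
    rw [valHom_smul, ← hs]
    rfl
  · intro u
    obtain ⟨b, rfl⟩ := hsurj u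
    exact ⟨_, halg b⟩
  · intro x
    change ρ (s x) = 0 ↔ _
    rw [hker, ← mem_map_pow_smul_top, ← Ideal.Quotient.eq_zero_iff_mem, hs]

variable {n : ℕ} {ρ : B →ₗ[R] ((ι → ℕ) →₀ R ⧸ qIdeal p R ^ n)}

/-- The endomorphism of `(R/I^n)^(ℕ)` given by the derivation on the powers of one variable, with
a section. -/
theorem exists_column_map
    (hE : ∀ x : TwEps (shiftParam R t₀), δ p x = TwEps.delta p _ (shiftEta p R t₀) x)
    (hτ : ∀ j, algebraMap R B (qElt R (qNum p)) * τ j + algebraMap R B (a j) = t j)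
    (ht : ∀ j, δ p (t j) = 0) (hi : t₀ = t i)
    (hker : ∀ x, ρ x = 0 ↔ x ∈ (qIdeal p R ^ n • ⊤ : Submodule R B))
    (hρ : ∀ m : ι → ℕ, ρ (∏ j, deltaPow p (τ j) (m j)) = Finsupp.single m 1) :
    ∃ Θ σ : (ℕ →₀ R ⧸ qIdeal p R ^ n) →ₗ[R ⧸ qIdeal p R ^ n] (ℕ →₀ R ⧸ qIdeal p R ^ n),
      Θ * σ = 1 ∧ (∀ v, ∃ c, (1 - σ * Θ) v = Finsupp.single 0 c) ∧
      ∀ m : ι → ℕ, ρ (∏ j, deltaPow p (shiftGen R t₀ τ i j) (m j)).im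
        = dirExt i Θ (Finsupp.single m 1) := by
  have := isDeltaAlgebra_twEps hE
  set k := R ⧸ qIdeal p R ^ n
  set mk := Ideal.Quotient.mk (qIdeal p R ^ n)
  choose y hy using exists_finsupp_sub_mem hE hτ ht hi n
  let w : ℕ → (ℕ →₀ k) := fun l => (y l).mapRange mk (map_zero _)
  let Θ : (ℕ →₀ k) →ₗ[k] (ℕ →₀ k) := Finsupp.linearCombination k w
  have hΘ : ∀ l, Θ (Finsupp.single l 1) = w l := fun l => by
    rw [Finsupp.linearCombination_single, one_smul]
  have hcol : ∀ m : ι → ℕ, ρ ((∏ j ∈ Finset.univ.erase i, deltaPow p (τ j) (m j))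
      * (deltaPow p (shiftGen R t₀ τ i i) (m i)).im)
      = Finsupp.mapDomain (Function.update m i) (w (m i)) := by
    intro m
    rw [← coordinates_prod_mul_linearCombination hρ, ← sub_eq_zero, ← map_sub, ← mul_sub, hker]
    have h := hy (m i)
    rw [Ideal.smul_top_eq_map] at h ⊢
    exact Ideal.mul_mem_left _ _ h
  have hcol0 : ∀ l, ρ (deltaPow p (shiftGen R t₀ τ i i) l).im
      = Finsupp.mapDomain (Function.update (0 : ι → ℕ) i) (w l) := by
    intro l
    have h := hcol (Function.update (0 : ι → ℕ) i l)
    rw [Function.update_self, Finset.prod_eq_one, one_mul] at h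
    · rw [h]
      congr 1
      funext r
      rw [Function.update_idem]
    · intro j hj
      rw [Function.update_of_ne (Finset.ne_of_mem_erase hj)]
      exact digitProd_zero ..
  have hinj : Function.Injective (Function.update (0 : ι → ℕ) i) := Function.update_injective _ _
  -- The coordinates along the i-th axis, which read off the matrix entries of Θ.
  let κ : ℕ → B →ₗ[R] k := fun r =>
    (Finsupp.lapply (R := R) (Pi.single (M := fun _ => ℕ) i r)) ∘ₗ ρ
  have hκ : ∀ r x, κ r x = ρ x (Function.update (0 : ι → ℕ) i r) := fun r x => rfl
  have hκw : ∀ r l, κ r (deltaPow p (shiftGen R t₀ τ i i) l).im = w l r := fun r l => by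
    rw [hκ, hcol0, Finsupp.mapDomain_apply hinj]
  have hκe : ∀ r l, κ r (deltaPow p (τ i) l) = if l = r then 1 else 0 := fun r l => by
    rw [hκ, ← prod_deltaPow_single (i := i), hρ]
    change Finsupp.single (Function.update (0 : ι → ℕ) i l) 1 (Function.update (0 : ι → ℕ) i r) = _
    rw [Finsupp.single_apply]
    simp only [hinj.eq_iff]
  set 𝔫 := (pμIdeal p R).map mk
  have hκJ : ∀ r, ∀ x ∈ (pμIdeal p R).map (algebraMap R B), κ r x ∈ 𝔫 := by
    intro r x hx
    have hx' : x ∈ (pμIdeal p R • ⊤ : Submodule R B) := by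
      rw [Ideal.smul_top_eq_map]; exact hx
    refine Submodule.smul_induction_on hx' ?_ ?_
    · intro s hs b _
      rw [map_smul, Algebra.smul_def]
      exact Ideal.mul_mem_right _ _ (Ideal.mem_map_of_mem mk hs)
    · intro a b ha hb
      rw [map_add]
      exact add_mem ha hb
  have hκs : ∀ l m, m ≤ l → ∀ s ∈ Submodule.span R (deltaPow p (τ i) '' Set.Iio m), κ l s = 0 := by
    intro l m hml s hs
    have : Submodule.span R (deltaPow p (τ i) '' Set.Iio m) ≤ LinearMap.ker (κ l) := by
      rw [Submodule.span_le]
      rintro _ ⟨r, hr, rfl⟩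
      change κ l _ = 0
      rw [hκe, if_neg]
      rw [Set.mem_Iio] at hr
      omega
    exact this hs
  obtain ⟨N, hN⟩ := exists_pμIdeal_pow_le p R n
  have hN' : 𝔫 ^ N = ⊥ := by
    rw [← Ideal.map_pow, eq_bot_iff]
    refine (Ideal.map_mono hN).trans ?_
    rw [Ideal.map_quotient_self]
  have h0 : Θ (Finsupp.single 0 1) = 0 := by
    rw [hΘ]
    ext r
    rw [← hκw]
    have e : deltaPow p (shiftGen R t₀ τ i i) 0 = 1 := digitProd_zero ..
    rw [e, QuadraticAlgebra.im_one, map_zero, Finsupp.zero_apply]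
  -- Only entries on the diagonal and at larger indices matter; the combination `s` of lower
  -- δ-powers contributes nothing to them.
  have hentry : ∀ m l, m ≤ l → ∃ c : ℤ, ¬ (p : ℤ) ∣ c ∧
      w (m + 1) l - (c : k) * (if m = l then 1 else 0) ∈ 𝔫 := by
    intro m l hml
    obtain ⟨c, hc, s, hs, h⟩ := exists_im_deltaPow_sub_mem hE hτ ht hi m
    refine ⟨c, hc, ?_⟩
    have h2 := hκJ l _ h
    rw [map_sub, map_sub, hκs l m hml s hs, sub_zero, hκw, map_smul, hκe, Algebra.smul_def,
      map_intCast] at h2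
    exact h2
  obtain ⟨σ, h1, h2⟩ := exists_section_of_triangular hN' Θ h0 (by
    intro m
    obtain ⟨c, hc, h⟩ := hentry m m le_rfl
    rw [if_pos rfl, mul_one] at h
    -- An integer prime to p is invertible modulo 𝔫 by Bézout, since p ∈ 𝔫.
    have hco : IsCoprime c (p : ℤ) := by
      rw [isCoprime_comm]
      exact (Nat.prime_iff_prime_int.1 hp.out).coprime_iff_not_dvd.2 hc
    obtain ⟨u, v, huv⟩ := hco
    refine ⟨(u : k), ?_⟩
    rw [hΘ]
    have e : w (m + 1) m * (u : k) - 1 = (w (m + 1) m - (c : k)) * u - v * (p : k) := by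
      have := congrArg (Int.castRingHom k) huv
      rw [map_add, map_mul, map_mul, map_natCast, map_one] at this
      rw [← this, eq_intCast, eq_intCast, eq_intCast]
      ring
    rw [e]
    refine sub_mem (Ideal.mul_mem_right _ _ h) (Ideal.mul_mem_left _ _ ?_)
    have := Ideal.mem_map_of_mem mk (natCast_mem_pμIdeal p R)
    rwa [map_natCast] at this) (by
    intro m l hml
    obtain ⟨c, hc, h⟩ := hentry m l hml.le
    rwa [if_neg hml.ne, mul_zero, sub_zero, ← hΘ] at h)
  refine ⟨Θ, σ, h1, h2, fun m => ?_⟩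
  rw [prod_deltaPow_shiftGen_im hE, hcol, dirExt_single, one_smul, hΘ]

/-- Both sides agree on combinations of δ-monomials. Any x differs from such a combination by an
element of the kernel of the n-th projection, which θ preserves. -/
theorem completed_coordinates_derivation {ρ' : AdicCompletion (qIdealMap p R B) B →ₗ[R] _}
    {θ : AdicCompletion (qIdealMap p R B) B →ₗ[R] AdicCompletion (qIdealMap p R B) B}
    (hE : ∀ x : TwEps (shiftParam R t₀), δ p x = TwEps.delta p _ (shiftEta p R t₀) x)
    (hb : IsDeltaBasis p R τ)
    (hθ : ∀ n x, ∀ g ∈ deltaAdjoin p R (shiftGen R t₀ τ i),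
        valHom _ n x = Ideal.Quotient.mk _ g.re → valHom _ n (θ x) = Ideal.Quotient.mk _ g.im)
    (hρ : ∀ m : ι → ℕ, ρ (∏ j, deltaPow p (τ j) (m j)) = Finsupp.single m 1)
    (hker' : ∀ x, ρ' x = 0 ↔ valHom _ n x = 0) (halg : ∀ b, ρ' (algebraMap B _ b) = ρ b)
    {Θ : (ℕ →₀ R ⧸ qIdeal p R ^ n) →ₗ[R ⧸ qIdeal p R ^ n] (ℕ →₀ R ⧸ qIdeal p R ^ n)}
    (hΘ : ∀ m : ι → ℕ, ρ (∏ j, deltaPow p (shiftGen R t₀ τ i j) (m j)).im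
        = dirExt i Θ (Finsupp.single m 1)) (x : AdicCompletion (qIdealMap p R B) B) :
    ρ' (θ x) = dirExt i Θ (ρ' x) := by
  have := isDeltaAlgebra_twEps hE
  let e : (ι → ℕ) → B := fun m => ∏ j, deltaPow p (τ j) (m j)
  have hlin : ∀ c : (ι → ℕ) →₀ R, ρ' (θ (algebraMap B _ (Finsupp.linearCombination R e c)))
      = dirExt i Θ (ρ' (algebraMap B _ (Finsupp.linearCombination R e c))) := by
    intro c
    induction c using Finsupp.induction_linear with
    | zero => simp
    | add v w hv hw => simp only [map_add, hv, hw]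
    | single m r =>
      have e1 : algebraMap B (AdicCompletion (qIdealMap p R B) B)
          (Finsupp.linearCombination R e (Finsupp.single m r)) = r • algebraMap B _ (e m) := by
        rw [Finsupp.linearCombination_single]
        rfl
      have e2 := derivation_algebraMap (prod_deltaPow_mem_deltaAdjoin (shiftGen R t₀ τ i) m) hθ
      rw [prod_deltaPow_shiftGen_re hE] at e2
      rw [e1, map_smul, map_smul, map_smul, e2, halg, halg, hΘ, hρ]
      exact ((dirExt i Θ).restrictScalars R).map_smul r _ |>.symm
  obtain ⟨b, hbx⟩ := Ideal.Quotient.mk_surjective (valHom _ n x)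
  obtain ⟨c, hc⟩ := hb.span n b
  have hx0 : valHom _ n (x - algebraMap B _ (Finsupp.linearCombination R e c)) = 0 := by
    rw [map_sub, ← hbx, valHom_algebraMap, sub_eq_zero, Ideal.Quotient.eq, mem_map_pow_smul_top]
    exact hc
  have h1 := (hker' _).2 (valHom_map_eq_zero _ qIdeal_fg θ hx0)
  have h2 := (hker' _).2 hx0
  rw [map_sub, map_sub, sub_eq_zero] at h1
  rw [map_sub, sub_eq_zero] at h2
  rw [h1, h2, hlin]

end CompletedCoordinates

/-! ### Tensoring with a module killed by K -/

section TensorCoordinates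

variable {R : Type*} [CommRing R] {K : Ideal R} {M : Type*} [AddCommGroup M] [Module R M]

/-- The kernel of ρ lies in KC, and its image in M ⊗ C vanishes because K kills M. Thus M ⊗ C sees
only the coordinates modulo K. -/
theorem lTensor_bijective_of_smul_eq_zero (hM : ∀ r ∈ K, ∀ m : M, r • m = 0) {C U : Type*}
    [AddCommGroup C] [Module R C] [AddCommGroup U] [Module R U] {ρ : C →ₗ[R] U}
    (hsurj : Function.Surjective ρ) (hker : ∀ x, ρ x = 0 → x ∈ (K • ⊤ : Submodule R C)) :
    Function.Bijective (ρ.lTensor M) := by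
  refine ⟨?_, LinearMap.lTensor_surjective M hsurj⟩
  rw [injective_iff_map_eq_zero]
  intro x hx
  obtain ⟨y, rfl⟩ := (lTensor_exact M (LinearMap.exact_subtype_ker_map ρ) hsurj x).1 hx
  induction y using TensorProduct.induction_on with
  | zero => exact map_zero _
  | add y z hy hz =>
    rw [map_add, hy, hz, add_zero]
    · rw [← LinearMap.comp_apply, ← LinearMap.lTensor_comp, LinearMap.comp_ker_subtype,
        LinearMap.lTensor_zero, LinearMap.zero_apply]
    · rw [← LinearMap.comp_apply, ← LinearMap.lTensor_comp, LinearMap.comp_ker_subtype,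
        LinearMap.lTensor_zero, LinearMap.zero_apply]
  | tmul m c =>
    rw [LinearMap.lTensor_tmul, Submodule.subtype_apply]
    refine Submodule.smul_induction_on (p := fun c => m ⊗ₜ[R] c = 0) (hker c.1 c.2) ?_ ?_
    · intro r hr z _
      rw [tmul_smul, smul_tmul', hM r hr, zero_tmul]
    · intro a b ha hb
      rw [tmul_add, ha, hb, add_zero]

variable {κ : Type*}

/-- Projection to the l-th coordinate lands in M ⊗ R/K = M/KM = M. -/
theorem eq_zero_of_tmul_single_eq_zero (hM : ∀ r ∈ K, ∀ m : M, r • m = 0) {l : κ} {m : M}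
    (h : m ⊗ₜ[R] (Finsupp.single l 1 : κ →₀ R ⧸ K) = 0) : m = 0 := by
  have h1 := congrArg (TensorProduct.tensorQuotEquivQuotSMul M K)
    (congrArg ((Finsupp.lapply (R := R) l : (κ →₀ R ⧸ K) →ₗ[R] R ⧸ K).lTensor M) h)
  rw [LinearMap.lTensor_tmul, Finsupp.lapply_apply, Finsupp.single_eq_same, map_zero, map_zero] at h1
  have h2 : TensorProduct.tensorQuotEquivQuotSMul M K (m ⊗ₜ[R] (1 : R ⧸ K))
      = Submodule.Quotient.mk m := by
    have := TensorProduct.tensorQuotEquivQuotSMul_tmul_mk K m 1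
    rwa [map_one, one_smul] at this
  rw [h2, Submodule.Quotient.mk_eq_zero] at h1
  refine Submodule.smul_induction_on h1 (fun r hr m _ => hM r hr m) ?_
  intro a b ha hb
  rw [ha, hb, add_zero]

variable {U V : Type*} [AddCommGroup U] [Module R U] [Module (R ⧸ K) U] [IsScalarTower R (R ⧸ K) U]
  [AddCommGroup V] [Module R V]

/-- The action on `V` of the endomorphisms of `U` induced by an isomorphism `V ≃ M ⊗ U`. -/
def tensorEnd (e : V ≃ₗ[R] M ⊗[R] U) : Module.End (R ⧸ K) U →+* Module.End ℤ V where
  toFun T := (e.symm.toLinearMap ∘ₗ (T.restrictScalars R).lTensor M ∘ₗ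
    e.toLinearMap).restrictScalars ℤ
  map_one' := LinearMap.ext fun v => by
    change e.symm (LinearMap.lTensor M LinearMap.id (e v)) = v
    rw [LinearMap.lTensor_id, LinearMap.id_apply, e.symm_apply_apply]
  map_mul' T T' := LinearMap.ext fun v => by
    change e.symm ((T.restrictScalars R ∘ₗ T'.restrictScalars R).lTensor M (e v))
      = e.symm ((T.restrictScalars R).lTensor M (e (e.symm
        ((T'.restrictScalars R).lTensor M (e v)))))
    rw [LinearMap.lTensor_comp, LinearMap.comp_apply, e.apply_symm_apply]
  map_zero' := LinearMap.ext fun v => by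
    change e.symm ((0 : U →ₗ[R] U).lTensor M (e v)) = 0
    rw [LinearMap.lTensor_zero, LinearMap.zero_apply, map_zero]
  map_add' T T' := LinearMap.ext fun v => by
    change e.symm ((T.restrictScalars R + T'.restrictScalars R).lTensor M (e v))
      = e.symm ((T.restrictScalars R).lTensor M (e v))
        + e.symm ((T'.restrictScalars R).lTensor M (e v))
    rw [LinearMap.lTensor_add, LinearMap.add_apply, map_add]

theorem apply_tensorEnd (e : V ≃ₗ[R] M ⊗[R] U) (T : Module.End (R ⧸ K) U) (v : V) :
    e (tensorEnd e T v) = (T.restrictScalars R).lTensor M (e v) :=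
  e.apply_symm_apply _

theorem exists_lTensor_eq_tmul_single {l : κ} {T : Module.End (R ⧸ K) (κ →₀ R ⧸ K)}
    (hT : ∀ u, ∃ c, T u = Finsupp.single l c) (x : M ⊗[R] (κ →₀ R ⧸ K)) :
    ∃ m : M, (T.restrictScalars R).lTensor M x = m ⊗ₜ Finsupp.single l 1 := by
  induction x using TensorProduct.induction_on with
  | zero => exact ⟨0, by rw [map_zero, zero_tmul]⟩
  | add x y hx hy =>
    obtain ⟨m, hm⟩ := hx
    obtain ⟨m', hm'⟩ := hy
    exact ⟨m + m', by rw [map_add, hm, hm', add_tmul]⟩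
  | tmul m u =>
    obtain ⟨c, hc⟩ := hT u
    obtain ⟨r, rfl⟩ := Ideal.Quotient.mk_surjective c
    refine ⟨r • m, ?_⟩
    rw [LinearMap.lTensor_tmul, LinearMap.restrictScalars_apply, hc, smul_tmul,
      Finsupp.smul_single, Algebra.smul_def, mul_one]
    rfl

end TensorCoordinates

/-! ### From coordinates to the resolution -/

section Resolution

variable {R C : Type*} [CommRing R] [CommRing C] [Algebra R C] {d : ℕ} {θ : Fin d → C →ₗ[R] C}

/-- The forms live over ℤ, so the Koszul formalism is used with S = ℤ and R-linearity is forgotten.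
-/
theorem thetaMap_eq_koszulMap (k : ℕ) (x : C ⊗[ℤ] ⋀[ℤ]^k (Ω d)) :
    thetaMap θ k x = koszulMap (fun i => (θ i).restrictScalars ℤ) k x := by
  rw [thetaMap, koszulMap, LinearMap.sum_apply, LinearMap.sum_apply]
  rfl

theorem thetaMap_comp_thetaMap (hθ : ∀ i j, θ i ∘ₗ θ j = θ j ∘ₗ θ i) (k : ℕ) :
    thetaMap θ (k + 1) ∘ₗ thetaMap θ k = 0 := by
  refine LinearMap.ext fun x => ?_
  rw [LinearMap.comp_apply, thetaMap_eq_koszulMap, thetaMap_eq_koszulMap]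
  exact koszulMap_comp (θ := fun i => (θ i).restrictScalars ℤ)
    (fun i j => LinearMap.ext fun v => LinearMap.congr_fun (hθ i j) v) k x

variable {M : Type*} [AddCommGroup M] [Module R M]

/-- The associativity isomorphism between the two forms of the complex. -/
def assocEquiv (R C M : Type*) [CommRing R] [CommRing C] [Algebra R C] [AddCommGroup M]
    [Module R M] (d k : ℕ) :
    (M ⊗[R] C) ⊗[ℤ] ⋀[ℤ]^k (Ω d) ≃+ M ⊗[R] (C ⊗[ℤ] ⋀[ℤ]^k (Ω d)) :=
  (TensorProduct.AlgebraTensorModule.assoc ℤ R R M C (⋀[ℤ]^k (Ω d))).toAddEquiv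

theorem assocEquiv_tmul (k : ℕ) (m : M) (c : C) (ω : ⋀[ℤ]^k (Ω d)) :
    assocEquiv R C M d k ((m ⊗ₜ[R] c) ⊗ₜ[ℤ] ω) = m ⊗ₜ[R] (c ⊗ₜ[ℤ] ω) := rfl

theorem lTensor_thetaMap_assocEquiv {θV : Fin d → Module.End ℤ (M ⊗[R] C)}
    (hθV : ∀ i m c, θV i (m ⊗ₜ[R] c) = m ⊗ₜ[R] θ i c) (k : ℕ)
    (x : (M ⊗[R] C) ⊗[ℤ] ⋀[ℤ]^k (Ω d)) :
    (thetaMap θ k).lTensor M (assocEquiv R C M d k x)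
      = assocEquiv R C M d (k + 1) (koszulMap θV k x) := by
  induction x using TensorProduct.induction_on with
  | zero => simp only [map_zero]
  | add x y hx hy => simp only [map_add, hx, hy]
  | tmul v ω =>
    induction v using TensorProduct.induction_on with
    | zero => simp only [zero_tmul, map_zero]
    | add x y hx hy => simp only [add_tmul, map_add, hx, hy]
    | tmul m c =>
      rw [assocEquiv_tmul, LinearMap.lTensor_tmul, thetaMap, koszulMap, LinearMap.sum_apply,
        LinearMap.sum_apply, tmul_sum, map_sum]
      refine Finset.sum_congr rfl fun i _ => ?_
      rw [TensorProduct.map_tmul, hθV]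
      rfl

/-- If `M` is killed by `K`, and the operators `θ_i` act modulo `K` on a basis indexed by `ℕ^d` each
on its own index, by maps with a section, then the complex is a resolution. -/
theorem isResolution_of_coordinates {K : Ideal R} (hM : ∀ r ∈ K, ∀ m : M, r • m = 0)
    (hθ1 : ∀ i, θ i 1 = 0) {ρ : C →ₗ[R] ((Fin d → ℕ) →₀ R ⧸ K)} (hsurj : Function.Surjective ρ)
    (hker : ∀ x, ρ x = 0 → x ∈ (K • ⊤ : Submodule R C)) (hone : ρ 1 = Finsupp.single 0 1)
    {Θ σ : Fin d → (ℕ →₀ R ⧸ K) →ₗ[R ⧸ K] (ℕ →₀ R ⧸ K)} (h1 : ∀ i, Θ i * σ i = 1)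
    (h2 : ∀ i v, ∃ c, (1 - σ i * Θ i) v = Finsupp.single 0 c)
    (hρ : ∀ i x, ρ (θ i x) = dirExt i (Θ i) (ρ x)) : IsResolution θ M := by
  set e : M ⊗[R] C ≃ₗ[R] M ⊗[R] ((Fin d → ℕ) →₀ R ⧸ K) :=
    LinearEquiv.ofBijective (ρ.lTensor M) (lTensor_bijective_of_smul_eq_zero hM hsurj hker)
  have he : ∀ m c, e (m ⊗ₜ c) = m ⊗ₜ ρ c := fun m c => rfl
  -- The sections σ_i are given on coordinates only; Φ transports all operators and their relations
  -- to M ⊗ C.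
  let Φ := tensorEnd (K := K) e
  let θV : Fin d → Module.End ℤ (M ⊗[R] C) := fun i => Φ (dirExt i (Θ i))
  let σV : Fin d → Module.End ℤ (M ⊗[R] C) := fun i => Φ (dirExt i (σ i))
  have hθV : ∀ i m c, θV i (m ⊗ₜ[R] c) = m ⊗ₜ[R] θ i c := by
    intro i m c
    apply e.injective
    rw [apply_tensorEnd, he, he, hρ]
    rfl
  have k1 : ∀ i, θV i * σV i = 1 := fun i => by
    rw [← map_mul, ← dirExt_mul, h1, dirExt_one, map_one]
  have k2 : ∀ i j, i ≠ j → σV j * θV i = θV i * σV j := fun i j h => by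
    rw [← map_mul, ← map_mul, dirExt_comm h]
  have k3 : ∀ i j, θV i * θV j = θV j * θV i := fun i j => by
    rcases eq_or_ne i j with rfl | h
    · rfl
    · rw [← map_mul, ← map_mul, dirExt_comm h]
  have hprod : ((List.finRange d).map fun i => 1 - σV i * θV i).prod
      = Φ ((List.finRange d).map fun i => dirExt i (1 - σ i * Θ i)).prod := by
    rw [map_list_prod, List.map_map]
    congr 2
    funext i
    rw [Function.comp_apply, dirExt_sub, dirExt_one, dirExt_mul]
    refine Eq.symm ((map_sub Φ 1 (dirExt i (σ i) * dirExt i (Θ i))).trans ?_)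
    rw [map_one, map_mul]
  have haug : ∀ m, augmentation R C d M m
      = assocEquiv R C M d 0 ((m ⊗ₜ[R] (1 : C)) ⊗ₜ[ℤ] extOne ℤ d) := fun m => rfl
  have hlad := fun k x => lTensor_thetaMap_assocEquiv hθV k x
  refine ⟨?_, ?_, ?_⟩
  · rw [injective_iff_map_eq_zero]
    intro m hm
    rw [haug, EmbeddingLike.map_eq_zero_iff] at hm
    have hm1 : m ⊗ₜ[R] (1 : C) = 0 := tmul_extOne_injective (S := ℤ) (d := d) (by
      change (m ⊗ₜ[R] (1 : C)) ⊗ₜ[ℤ] extOne ℤ d = 0 ⊗ₜ[ℤ] extOne ℤ d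
      rw [hm, zero_tmul])
    have hm2 := congrArg e hm1
    rw [he, hone, map_zero] at hm2
    exact eq_zero_of_tmul_single_eq_zero hM hm2
  · intro x
    constructor
    · intro hx
      obtain ⟨y, rfl⟩ := (assocEquiv R C M d 0).surjective x
      rw [hlad, EmbeddingLike.map_eq_zero_iff] at hx
      obtain ⟨v, rfl⟩ := koszul_exists_of_zero k1 k2 k3 hx
      obtain ⟨m, hm⟩ := exists_lTensor_eq_tmul_single (M := M)
        (exists_prod_dirExt_apply (fun i => 1 - σ i * Θ i) h2 (List.finRange d)
          List.mem_finRange) (e v)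
      refine ⟨m, ?_⟩
      rw [haug, hprod]
      congr 2
      apply e.injective
      rw [apply_tensorEnd, hm, he, hone]
    · rintro ⟨m, rfl⟩
      rw [haug, hlad]
      have : koszulMap θV 0 ((m ⊗ₜ[R] (1 : C)) ⊗ₜ[ℤ] extOne ℤ d) = 0 := by
        rw [koszulMap, LinearMap.sum_apply]
        refine Finset.sum_eq_zero fun i _ => ?_
        rw [TensorProduct.map_tmul, hθV, hθ1, tmul_zero, zero_tmul]
      rw [this, map_zero]
  · intro k
    have hex := koszul_exact_succ k1 k2 k3 k
    intro x
    constructor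
    · intro hx
      obtain ⟨y, rfl⟩ := (assocEquiv R C M d (k + 1)).surjective x
      rw [hlad, EmbeddingLike.map_eq_zero_iff] at hx
      obtain ⟨z, rfl⟩ := (hex y).1 hx
      exact ⟨assocEquiv R C M d k z, hlad k z⟩
    · rintro ⟨w, rfl⟩
      obtain ⟨z, rfl⟩ := (assocEquiv R C M d k).surjective w
      rw [hlad, hlad, (hex _).2 ⟨z, rfl⟩, map_zero]

end Resolution

/-! ### The derivations, their commutation and the resolution -/

section Assembly

variable {p : ℕ} [hp : Fact p.Prime] {R B : Type*} [CommRing R] [DeltaRing p R]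
  [CommRing B] [DeltaRing p B] [Algebra R B] [IsDeltaAlgebra p R B]
  [Algebra ℤ[X] R] [IsDeltaAlgebra p ℤ[X] R] {d : ℕ} {τ t : Fin d → B} {a : Fin d → R}

/-- Commutation is checked modulo each I^n, where θ_i and θ_j act on different indices. The
resolution property needs only the one level n at which I^n kills M. -/
theorem exists_commuting_derivations
    (hτ : ∀ j, algebraMap R B (qElt R (qNum p)) * τ j + algebraMap R B (a j) = t j)
    (ht : ∀ j, δ p (t j) = 0) (hb : IsDeltaBasis p R τ) (hK : (p : B) ∈ qIdealMap p R B) :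
    ∃ θ : Fin d → AdicCompletion (qIdealMap p R B) B →ₗ[R] AdicCompletion (qIdealMap p R B) B,
      (∀ i, IsTwistedDerivation (algebraMap B _ (shiftParam R (t i))) (θ i) ∧
        (letI := completedDeltaRing hK;
          IsDeltaCompatible p (algebraMap B _ (shiftParam R (t i)))
            (algebraMap B _ (shiftEta p R (t i))) (θ i)) ∧
        θ i (algebraMap B _ (τ i)) = 1 ∧ ∀ j, j ≠ i → θ i (algebraMap B _ (τ j)) = 0) ∧
      (∀ i j, θ i ∘ₗ θ j = θ j ∘ₗ θ i) ∧
      ∀ (n : ℕ) (M : Type*) [AddCommGroup M] [Module R M],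
        (∀ r ∈ qIdeal p R ^ n, ∀ m : M, r • m = 0) → IsResolution θ M := by
  let _ : ∀ i, DeltaRing p (TwEps (shiftParam R (t i))) := fun i =>
    TwEps.deltaRing (delta_shiftParam (ht i))
  have hE : ∀ i, ∀ x : TwEps (shiftParam R (t i)),
    δ p x = TwEps.delta p _ (shiftEta p R (t i)) x := fun i x => rfl
  choose θ hθ using fun i => exists_derivation (hE i) hτ ht rfl hb
  have htw : ∀ i, IsTwistedDerivation (algebraMap B _ (shiftParam R (t i))) (θ i) := fun i =>
    isTwistedDerivation_of_quotient (hE i) hb (hθ i)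
  have hgen : ∀ i j, θ i (algebraMap B _ (τ j))
      = algebraMap B _ (shiftGen R (t i) τ i j).im := by
    intro i j
    have := isDeltaAlgebra_twEps (hE i)
    have := derivation_algebraMap (mem_deltaAdjoin (shiftGen R (t i) τ i) j) (hθ i)
    rwa [shiftGen_re] at this
  choose ρ hsurj hker hρ using exists_coordinates hb
  choose ρ' hsurj' hker' halg using fun n => exists_completed_coordinates (hsurj n) (hker n)
  choose Θ σ h1 h2 hΘ using fun i n =>
    exists_column_map (hE i) hτ ht rfl (hker n) (hρ n)
  have hcoord : ∀ i n x, ρ' n (θ i x) = dirExt i (Θ i n) (ρ' n x) := fun i n x =>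
    completed_coordinates_derivation (hE i) hb (hθ i) (hρ n) (hker' n) (halg n) (hΘ i n) x
  refine ⟨θ, fun i => ⟨htw i, isDeltaCompatible_of_quotient (hE i) hb (hθ i) hK, ?_, ?_⟩, ?_, ?_⟩
  · rw [hgen, shiftGen_im_self, map_one]
  · intro j hj
    rw [hgen, shiftGen_of_ne hj]
    exact map_zero _
  · intro i j
    rcases eq_or_ne i j with rfl | hij
    · rfl
    refine LinearMap.ext fun x => valHom_ext fun n => ?_
    rw [← sub_eq_zero, ← map_sub, ← hker', map_sub, sub_eq_zero, LinearMap.comp_apply,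
      LinearMap.comp_apply, hcoord, hcoord, hcoord, hcoord]
    exact LinearMap.congr_fun (dirExt_comm hij (Θ i n) (Θ j n)) _
  · intro n M _ _ hM
    refine isResolution_of_coordinates hM (fun i => (htw i).map_one) (hsurj' n) ?_ ?_
      (fun i => h1 i n) (fun i => h2 i n) (fun i => hcoord i n)
    · intro x hx
      exact (valHom_eq_zero_iff _ qIdeal_fg n x).1 ((hker' n x).1 hx)
    · rw [← map_one (algebraMap B _), halg, ← hρ]
      congr 1
      exact (Finset.prod_eq_one fun j _ => digitProd_zero ..).symm

end Assembly

/-! ### The divided δ-envelope satisfies the hypotheses -/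

section DividedEnvelope

variable (p : ℕ) [hp : Fact p.Prime] {R : Type*} [CommRing R] [DeltaRing p R] [Algebra ℤ[X] R]
  [IsDeltaAlgebra p ℤ[X] R] {A : Type*} [CommRing A] [DeltaRing p A] [Algebra R A]
  [IsDeltaAlgebra p R A] {d : ℕ} (T : Fin d → A)

theorem DivEnv.algebraMap_δ (x : A) :
    algebraMap A (DivEnv p R T) (δ p x) = δ p (algebraMap A (DivEnv p R T) x) :=
  have h : IsDeltaAlgebra p A
    (DeltaEnvelope p A (DivRing (algebraMap R A (qElt R (qNum p))) T)) := inferInstance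
  h.algebraMap_δ x

instance DivEnv.isDeltaAlgebra : IsDeltaAlgebra p R (DivEnv p R T) where
  algebraMap_δ x := by
    change algebraMap A (DivEnv p R T) (algebraMap R A (δ p x))
      = δ p (algebraMap A (DivEnv p R T) (algebraMap R A x))
    rw [IsDeltaAlgebra.algebraMap_δ, DivEnv.algebraMap_δ]

theorem DivEnv.qNum_mul_τ (i : Fin d) :
    algebraMap R (DivEnv p R T) (qElt R (qNum p)) * DivEnv.τ p R T i
      = algebraMap A (DivEnv p R T) (T i) := by
  set ξ := algebraMap R A (qElt R (qNum p))
  have h : (Ideal.Quotient.mk _ (MvPolynomial.C ξ * MvPolynomial.X i) : DivRing ξ T)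
      = Ideal.Quotient.mk _ (MvPolynomial.C (T i)) :=
    Ideal.Quotient.eq.2 (Ideal.subset_span ⟨i, rfl⟩)
  have h2 := congrArg (DeltaEnvelope.of p A (DivRing ξ T)) h
  rw [map_mul, map_mul] at h2
  exact h2

theorem isDeltaBasis_of_freeOnDeltaMonomials (h : FreeOnDeltaMonomials p R T) :
    IsDeltaBasis p R (DivEnv.τ p R T) := by
  have key : ∀ n, ∃ b : Module.Basis (Fin d → ℕ) (R ⧸ qIdeal p R ^ (n + 1))
      (DivEnv p R T ⧸ (qIdeal p R ^ (n + 1)).map (algebraMap R (DivEnv p R T))),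
      ∀ c : (Fin d → ℕ) →₀ R, Ideal.Quotient.mk _ (Finsupp.linearCombination R
        (fun m : Fin d → ℕ => ∏ j, deltaPow p (DivEnv.τ p R T j) (m j)) c)
        = b.repr.symm (c.mapRange (Ideal.Quotient.mk _) (map_zero _)) := by
    intro n
    obtain ⟨b, hb⟩ := h n
    refine ⟨b, fun c => ?_⟩
    induction c using Finsupp.induction_linear with
    | zero => simp
    | add v w hv hw =>
      rw [map_add, map_add, hv, hw, Finsupp.mapRange_add (map_add _), map_add]
    | single m r =>
      rw [Finsupp.linearCombination_single, Finsupp.mapRange_single, Module.Basis.repr_symm_single,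
        hb, Algebra.smul_def, map_mul]
      rfl
  constructor
  -- The freeness hypothesis starts with the first power of I; for the zeroth power the claim is
  -- trivial.
  · rintro (_ | n) x
    · refine ⟨0, ?_⟩
      rw [pow_zero, Ideal.one_eq_top, Submodule.top_smul]
      trivial
    obtain ⟨b, hb⟩ := key n
    obtain ⟨c, hc⟩ := Finsupp.mapRange_surjective (α := Fin d → ℕ)
      (Ideal.Quotient.mk (qIdeal p R ^ (n + 1))) (map_zero _) Ideal.Quotient.mk_surjective
      (b.repr (Ideal.Quotient.mk _ x))
    refine ⟨c, ?_⟩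
    rw [Ideal.smul_top_eq_map]
    refine Ideal.Quotient.eq.1 ?_
    rw [hb, hc, LinearEquiv.symm_apply_apply]
  · rintro (_ | n) c hc m
    · rw [pow_zero, Ideal.one_eq_top]
      trivial
    obtain ⟨b, hb⟩ := key n
    rw [Ideal.smul_top_eq_map] at hc
    have h0 := (hb c).symm.trans (Ideal.Quotient.eq_zero_iff_mem.2 hc)
    rw [LinearEquiv.map_eq_zero_iff] at h0
    exact Ideal.Quotient.eq_zero_iff_mem.1 (DFunLike.congr_fun h0 m)

end DividedEnvelope

end QHiggs

end

theorem mainTheorem6 (p : ℕ) [Fact p.Prime]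
    {R : Type*} [CommRing R] [DeltaRing p R] [Algebra ℤ[X] R] [IsDeltaAlgebra p ℤ[X] R]
    {A : Type*} [CommRing A] [DeltaRing p A] [Algebra R A] [IsDeltaAlgebra p R A]
    {d : ℕ} (t T : Fin d → A) (a : Fin d → R)
    (hT : ∀ i, T i = t i - algebraMap R A (a i))
    (ht : ∀ i, δ p (t i) = 0)
    (hfree : FreeOnDeltaMonomials p R T) :
    ∃ θ : Fin d → DivEnvHat p R T →ₗ[R] DivEnvHat p R T,
      (∀ i, ∀ θ' : DivEnvHat p R T →ₗ[R] DivEnvHat p R T,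
        IsQHiggsDerivation p T t i θ' ↔ θ' = θ i) ∧
      (∀ i j, θ i ∘ₗ θ j = θ j ∘ₗ θ i) ∧
      (∀ k, thetaMap θ (k + 1) ∘ₗ thetaMap θ k = 0) ∧
      ∀ J : Ideal R, (∃ n : ℕ, qIdeal p R ^ n ≤ J) →
        ∀ (M : Type*) [AddCommGroup M] [Module R M] [Module (R ⧸ J) M]
          [IsScalarTower R (R ⧸ J) M], IsResolution θ M := by
  have hb := isDeltaBasis_of_freeOnDeltaMonomials p T hfree
  have hK := DivEnv.p_mem_ideal p R T
  obtain ⟨θ, hder, hcomm, hres⟩ := exists_commuting_derivations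
    (τ := DivEnv.τ p R T) (t := fun i => algebraMap A (DivEnv p R T) (t i)) (a := a)
    -- In D one has [p]_q τ_j = T_j = t_j - a_j.
    (fun j => by
      rw [DivEnv.qNum_mul_τ, hT, map_sub]
      exact sub_add_cancel _ _)
    (fun j => by rw [← DivEnv.algebraMap_δ, ht, map_zero]) hb hK
  have hprop : ∀ i, IsQHiggsDerivation p T t i (θ i) := by
    intro i
    obtain ⟨h1, h2, h3, h4⟩ := hder i
    rw [shiftParam, map_mul] at h1 h2
    rw [shiftEta, map_mul, map_pow] at h2
    exact ⟨h1, h2, h3, h4⟩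
  refine ⟨θ, fun i θ' => ⟨fun h => ?_, ?_⟩, hcomm, thetaMap_comp_thetaMap hcomm, ?_⟩
  · refine derivation_unique hb hK h.twisted (hprop i).twisted h.compatible (hprop i).compatible
      fun j => ?_
    rcases eq_or_ne j i with rfl | hj
    · exact h.map_τ_self.trans (hprop j).map_τ_self.symm
    · exact (h.map_τ_ne j hj).trans ((hprop i).map_τ_ne j hj).symm
  · rintro rfl
    exact hprop i
  · rintro J ⟨n, hn⟩ M _ _ _ _
    -- As I^n ⊆ J, an R/J-module is killed by I^n.
    refine hres n M fun r hr m => ?_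
    rw [← IsScalarTower.algebraMap_smul (R ⧸ J) r m]
    have : algebraMap R (R ⧸ J) r = 0 := Ideal.Quotient.eq_zero_iff_mem.2 (hn hr)
    rw [this, zero_smul]
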